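/- Let $\mathcal G$ be a connected, locally finite graph with countable vertex set, without loops or multiple edges, each edge $e$ being identified with an interval of finite length $l_e>0$. Give $\mathcal G$ the geodesic metric and the Lebesgue measure, and let $\overline{\mathcal G}$ be its metric completion. Let $\partial\overline{\mathcal G}$ consist of the vertices with exactly one incident edge together with $\overline{\mathcal G}\setminus\mathcal G$. Assume that $\overline{\mathcal G}$ is compact and weakly connected: for any distinct $x,y\in\overline{\mathcal G}$ there are a finite set $W\subset\mathcal G$ and disjoint open sets $A\ni x$, $B\ni y$ with $\overline{\mathcal G}\setminus W=A\cup B$. Let $q:\mathcal G\to[0,\infty)$ be integrable, and suppose that there are weights $\omega(e)>0$ with $\sum_e\omega(e)<\infty$ and $\sum_e\int_e(\omega(e)^{-1}q)^2\,\omega(e)\,dx<\infty$. A function $u$ on $\mathcal G$ is $q$-harmonic if it is continuous, if on each edge $u'$ is absolutely continuous and $u''=qu$ almost everywhere, and if at each vertex with at least two incident edges the outgoing derivatives of $u$ sum to $0$. Let $\mathcal A$ be the set of continuous $\phi:\overline{\mathcal G}\to\mathbb R$ that are $C^\infty$ on the open edges and satisfy $\phi'=0$ outside finitely many edges and in a neighborhood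 of each vertex. Let $\Omega$ be a clopen subset of $\partial\overline{\mathcal G}$ with $\emptyset\neq\Omega\neq\partial\overline{\mathcal G}$. Then there is a unique continuous $u_\Omega:\overline{\mathcal G}\to\mathbb R$ that is $q$-harmonic on $\mathcal G$ and equals $1_\Omega$ on $\partial\overline{\mathcal G}$. For each clopen $E\subset\partial\overline{\mathcal G}$ there is $\phi\in\mathcal A$ with $\phi=1_E$ on $\partial\overline{\mathcal G}$, and the number $$\Lambda_q(1_\Omega,E)=\int_{\mathcal G}u_\Omega\,(-\phi''+q\phi)\,dx$$ (whose integrand is integrable) does not depend on the choice of such $\phi$. Moreover: 1. If $E_1,E_2,\dots$ are pairwise disjoint clopen subsets of $\partial\overline{\mathcal G}$ whose union $E$ is clopen, then $\Lambda_q(1_\Omega,E)=\sum_n\Lambda_q(1_\Omega,E_n)$. 2. There is a unique finite positive Borel measure $\nu$ on $\Omega$ with $\nu(E)=\Lambda_q(1_\Omega,E)$ for all clopen $E\subset\Omega$, and $\nu$ is a Radon measure. 3. There is a unique signed Borel measure $\mu$ on $\partial\overline{\mathcal G}$ with $\mu(E)=\Lambda_q(1_\Omega,E)$ for all clopen $E\subset\partial\overline{\mathcal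 G}$, and $\mu$ is a finite signed Radon measure (its total variation $|\mu|$ is a finite Radon measure). -/

import Mathlib

open Set Filter Topology MeasureTheory

/-- A metric graph: a (simple) graph, each of whose edges is given a finite positive length. -/
structure MetricGraph (V : Type*) where
  graph : SimpleGraph V
  len : graph.edgeSet → ℝ
  len_pos : ∀ e, 0 < len e

namespace MetricGraph

variable {V : Type*} (Γ : MetricGraph V)

/-- The edges. -/
abbrev Edge : Type _ := Γ.graph.edgeSet

/-- The edge `e` is identified with `[0, len e]`; `src e` is the end vertex with coordinate `0`. -/
noncomputable def src (e : Γ.Edge) : V := (Quot.out e.1).1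

/-- The end vertex of `e` with coordinate `len e`. -/
noncomputable def tgt (e : Γ.Edge) : V := (Quot.out e.1).2

/-- The two chosen ends of an edge are its two end vertices. -/
theorem mk_src_tgt (e : Γ.Edge) : s(Γ.src e, Γ.tgt e) = e.1 := Quot.out_eq e.1

/-- The points of the metric graph: the vertices, and the interior points of the edges. -/
inductive Point : Type _
  | vertex (v : V) : Point
  | inner (e : Γ.Edge) (t : ℝ) (h0 : 0 < t) (h1 : t < Γ.len e) : Point

/-- The point with coordinate `t ∈ [0, len e]` on the closed edge `e`
(coordinates outside this interval are moved to its nearest end). -/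
noncomputable def pt (e : Γ.Edge) (t : ℝ) : Γ.Point :=
  if h0 : t ≤ 0 then .vertex (Γ.src e)
  else if h1 : Γ.len e ≤ t then .vertex (Γ.tgt e)
  else .inner e t (not_le.1 h0) (not_le.1 h1)

/-- `Γ.IsPath p r L`: some path composed of finitely many intervals (each lying in an edge)
joins `p` to `r` and has total length `L`. -/
inductive IsPath : Γ.Point → Γ.Point → ℝ → Prop
  | refl (p : Γ.Point) : IsPath p p 0
  | segment (e : Γ.Edge) (s t : ℝ) (hs : s ∈ Icc 0 (Γ.len e)) (ht : t ∈ Icc 0 (Γ.len e)) :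
      IsPath (Γ.pt e s) (Γ.pt e t) |s - t|
  | trans {p r z : Γ.Point} {L M : ℝ} (h : IsPath p r L) (h' : IsPath r z M) :
      IsPath p z (L + M)

variable {Γ} in
theorem IsPath.symm {p r : Γ.Point} {L : ℝ} (h : Γ.IsPath p r L) : Γ.IsPath r p L := by
  induction h with
  | refl p => exact .refl p
  | segment e s t hs ht => rw [abs_sub_comm]; exact .segment e t s ht hs
  | trans _ _ h1 h2 => rw [add_comm]; exact .trans h2 h1

/-- The geodesic distance: the infimum of the lengths of the paths joining two points
(it is `∞` if there is no such path). -/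
noncomputable instance : PseudoEMetricSpace Γ.Point where
  edist p r := ⨅ (L : ℝ) (_ : Γ.IsPath p r L), ENNReal.ofReal L
  edist_self p := by
    refine le_antisymm (iInf₂_le_of_le 0 (.refl p) (by simp)) bot_le
  edist_comm p r := by
    refine le_antisymm ?_ ?_ <;>
      exact le_iInf₂ fun L h => iInf₂_le_of_le L h.symm le_rfl
  edist_triangle p r z := by
    simp only [ENNReal.iInf_add, ENNReal.add_iInf]
    exact le_iInf₂ fun M h' => le_iInf₂ fun L h =>
      iInf₂_le_of_le (L + M) (h.trans h') ENNReal.ofReal_add_le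

/-- The completion of the metric graph for the geodesic distance. -/
abbrev Completion : Type _ := UniformSpace.Completion Γ.Point

noncomputable instance : MeasurableSpace Γ.Completion := borel _

instance : BorelSpace Γ.Completion := ⟨rfl⟩

/-- The metric graph as a subset of its completion. -/
def carrier : Set Γ.Completion := range fun p : Γ.Point => (p : Γ.Completion)

/-- The boundary of the completion: the vertices with exactly one incident edge, together with
the points of the completion that are not in the graph. -/
def boundary : Set Γ.Completion :=
  {x | ∃ v : V, (Γ.graph.neighborSet v).ncard = 1 ∧ x = (Point.vertex v : Γ.Point)} ∪ Γ.carrierᶜ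

/-- Any two distinct points of the completion are separated by a finite set of points of the
graph. -/
def WeaklyConnected : Prop :=
  ∀ x y : Γ.Completion, x ≠ y → ∃ W : Set Γ.Completion, W.Finite ∧ W ⊆ Γ.carrier ∧
    ∃ A B : Set Γ.Completion, IsOpen A ∧ IsOpen B ∧ Disjoint A B ∧ Wᶜ = A ∪ B ∧ x ∈ A ∧ y ∈ B

/-- A function on the graph in the coordinate of the edge `e`. -/
noncomputable def onEdge (f : Γ.Point → ℝ) (e : Γ.Edge) (t : ℝ) : ℝ := f (Γ.pt e t)

/-- Integrability, for the Lebesgue measure of the graph, of a function given in the edge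
coordinates. -/
def GraphIntegrable (F : Γ.Edge → ℝ → ℝ) : Prop :=
  (∀ e, IntegrableOn (F e) (Ioo 0 (Γ.len e))) ∧
    Summable fun e => ∫ t in Ioo 0 (Γ.len e), |F e t|

/-- The integral over the graph of a function given in the edge coordinates. -/
noncomputable def graphIntegral (F : Γ.Edge → ℝ → ℝ) : ℝ :=
  ∑' e, ∫ t in Ioo 0 (Γ.len e), F e t

open scoped ContDiff in
/-- The algebra of eventually flat functions: continuous on the completion, smooth on the open
edges, with derivative zero outside finitely many edges and near each vertex. (The graphs we
consider are locally finite, so the last condition may be stated edge by edge.) -/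
structure IsEventuallyFlat (φ : Γ.Completion → ℝ) : Prop where
  continuous : Continuous φ
  smooth : ∀ e, ContDiffOn ℝ ∞ (Γ.onEdge (fun p => φ p) e) (Ioo 0 (Γ.len e))
  finite : {e | ∃ t ∈ Ioo 0 (Γ.len e), deriv (Γ.onEdge (fun p => φ p) e) t ≠ 0}.Finite
  flat_src : ∀ e, ∀ᶠ t in 𝓝[>] 0, deriv (Γ.onEdge (fun p => φ p) e) t = 0
  flat_tgt : ∀ e, ∀ᶠ t in 𝓝[<] Γ.len e, deriv (Γ.onEdge (fun p => φ p) e) t = 0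

/-- The derivative of `u` along the edge `e` at its end vertex `v`, in the local coordinate of
`e` that points away from `v`. -/
noncomputable def vertexDeriv (u : Γ.Point → ℝ) (e : Γ.Edge) (v : V) : ℝ :=
  open Classical in
  if v = Γ.src e then derivWithin (Γ.onEdge u e) (Icc 0 (Γ.len e)) 0
  else -derivWithin (Γ.onEdge u e) (Icc 0 (Γ.len e)) (Γ.len e)

/-- `q`-harmonic functions: continuous, `u'` is absolutely continuous on the edges and `u'' = q u`
almost everywhere, and at each vertex with at least two incident edges the sum of the outgoing
derivatives vanishes. -/
structure IsHarmonic (q u : Γ.Point → ℝ) : Prop where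
  continuous : Continuous u
  differentiable : ∀ e, DifferentiableOn ℝ (Γ.onEdge u e) (Icc 0 (Γ.len e))
  absCont : ∀ e, AbsolutelyContinuousOnInterval
    (derivWithin (Γ.onEdge u e) (Icc 0 (Γ.len e))) 0 (Γ.len e)
  equation : ∀ e, ∀ᵐ t ∂(volume.restrict (Ioo 0 (Γ.len e))),
    HasDerivAt (deriv (Γ.onEdge u e)) (Γ.onEdge q e t * Γ.onEdge u e t) t
  kirchhoff : ∀ v : V, 2 ≤ (Γ.graph.neighborSet v).ncard →
    ∑ᶠ e : {e : Γ.Edge // v ∈ e.1}, Γ.vertexDeriv u e.1 v = 0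

/-- `u` is a continuous function on the completion that is `q`-harmonic on the graph and has the
boundary values `U`. -/
structure IsHarmonicExtension (q : Γ.Point → ℝ) (U : Γ.boundary → ℝ) (u : Γ.Completion → ℝ) :
    Prop where
  continuous : Continuous u
  harmonic : Γ.IsHarmonic q fun p => u p
  boundary : ∀ x : Γ.boundary, u x = U x

/-- The characteristic function of a subset of the boundary. -/
noncomputable def charFun (E : Set Γ.boundary) : Γ.boundary → ℝ := E.indicator fun _ => 1

/-- `φ` is eventually flat, equal to `1` on `E` and to `0` on the rest of the boundary. -/
def IsTestFunction (E : Set Γ.boundary) (φ : Γ.Completion → ℝ) : Prop :=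
  Γ.IsEventuallyFlat φ ∧ ∀ x : Γ.boundary, φ x = Γ.charFun E x

/-- The function `u * L φ`, where `L φ = - φ'' + q φ`, in the edge coordinates. -/
noncomputable def pairing (q : Γ.Point → ℝ) (u φ : Γ.Completion → ℝ) (e : Γ.Edge) (t : ℝ) : ℝ :=
  Γ.onEdge (fun p => u p) e t *
    (-deriv (deriv (Γ.onEdge (fun p => φ p) e)) t +
      Γ.onEdge q e t * Γ.onEdge (fun p => φ p) e t)

/-- The Dirichlet-Neumann function `Λ_q(U, E) = ∫ u * L φ`, where `u` is the harmonic extension of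
`U` and `φ` is a test function for the clopen set `E`. -/
noncomputable def dirichletNeumann (q : Γ.Point → ℝ) (U : Γ.boundary → ℝ) (E : Set Γ.boundary) :
    ℝ :=
  Γ.graphIntegral (Γ.pairing q (Classical.epsilon (Γ.IsHarmonicExtension q U))
    (Classical.epsilon (Γ.IsTestFunction E)))

end MetricGraph

/-! The measure theory reduces to finite additivity and a sign. Removing finitely many points of the
graph separates any two boundary points, and boundary points lying in the graph are isolated in the
boundary, so the boundary is a second countable profinite space (`totallySeparatedSpace_boundary`).
There a closed union of disjoint clopen sets has only finitely many nonempty members, by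
compactness; finite additivity on clopen sets is therefore countable additivity, and Carathéodory's
theorem produces a Borel measure (`exists_measure_of_isClopen`). Clopen sets form a π-system
generating the Borel sets, whence uniqueness.

The analysis is Hilbert space theory for the energy `∫ u'² + q u²`. Distances from a vertex are
bounded, so Cauchy–Schwarz along simple paths bounds the oscillation of a function by the `L²` norm
of its derivative (`exists_norm_bound`). Hence the functions of finite energy that vanish on the
boundary form a closed subspace for the energy, made of functions continuous on the whole
completion. Test functions for clopen sets are products of bumps (`exists_isTestFunction`);
subtracting from one its projection onto this subspace solves the Dirichlet problem weakly
(`exists_weakSolution`). Testing against tents inside an edge and at a vertex gives the differential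
equation and the Kirchhoff condition (`IsWeakSolution.isHarmonic`). The maximum principle gives
uniqueness (`IsHarmonic.le_of_boundary`).

Integrating by parts, `∫ u (-φ'' + q φ)` becomes the bilinear form `∫ u' φ' + q u φ`
(`graphIntegral_pairing`). It is additive in `φ` and, `u` being a weak solution, depends only on the
boundary values of `φ`. Truncation to `[0, 1]` does not increase the energy, and `u` minimizes it
for its boundary values; perturbing by `ε φ` and truncating shows that the form is nonnegative for
clopen sets inside `Ω` and nonpositive for those disjoint from `Ω` (`IsWeakSolution.inner_nonneg`).
The signed measure is the difference of the two positive measures obtained from `E ∩ Ω` and `E \ Ω`.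
-/

namespace MetricGraph

variable {V : Type*} {Γ : MetricGraph V}

/-! ### Edge coordinates -/

theorem pt_of_nonpos (e : Γ.Edge) {t : ℝ} (h : t ≤ 0) : Γ.pt e t = .vertex (Γ.src e) := by
  simp [pt, h]

theorem pt_of_len_le (e : Γ.Edge) {t : ℝ} (h : Γ.len e ≤ t) : Γ.pt e t = .vertex (Γ.tgt e) := by
  have := Γ.len_pos e
  simp [pt, h, show ¬ t ≤ 0 by linarith]

theorem pt_of_mem_Ioo (e : Γ.Edge) {t : ℝ} (h : t ∈ Ioo 0 (Γ.len e)) :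
    Γ.pt e t = .inner e t h.1 h.2 := by
  simp [pt, not_le.2 h.1, not_le.2 h.2]

@[simp] theorem pt_zero (e : Γ.Edge) : Γ.pt e 0 = .vertex (Γ.src e) := pt_of_nonpos e le_rfl

@[simp] theorem pt_len (e : Γ.Edge) : Γ.pt e (Γ.len e) = .vertex (Γ.tgt e) := pt_of_len_le e le_rfl

theorem pt_clamp (e : Γ.Edge) (t : ℝ) : Γ.pt e (max 0 (min t (Γ.len e))) = Γ.pt e t := by
  have := Γ.len_pos e
  rcases le_or_gt t 0 with h | h
  · rw [min_eq_left (by linarith), max_eq_left h, pt_zero, pt_of_nonpos e h]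
  · rcases le_or_gt (Γ.len e) t with h' | h'
    · rw [min_eq_right h', max_eq_right this.le, pt_len, pt_of_len_le e h']
    · rw [min_eq_left h'.le, max_eq_right h.le]

theorem clamp_mem (e : Γ.Edge) (t : ℝ) : max 0 (min t (Γ.len e)) ∈ Icc 0 (Γ.len e) :=
  ⟨le_max_left _ _, max_le (Γ.len_pos e).le (min_le_right _ _)⟩

theorem adj_src_tgt (e : Γ.Edge) : Γ.graph.Adj (Γ.src e) (Γ.tgt e) := by
  have := e.2
  rwa [← Γ.mk_src_tgt e, SimpleGraph.mem_edgeSet] at this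

theorem src_ne_tgt (e : Γ.Edge) : Γ.src e ≠ Γ.tgt e := (adj_src_tgt e).ne

theorem mem_edge_iff {e : Γ.Edge} {v : V} : v ∈ e.1 ↔ v = Γ.src e ∨ v = Γ.tgt e := by
  rw [← Γ.mk_src_tgt e, Sym2.mem_iff]

theorem src_mem (e : Γ.Edge) : Γ.src e ∈ e.1 := mem_edge_iff.2 (.inl rfl)

/-- An adjacent pair of vertices is the pair of ends of an edge. -/
theorem exists_edge_of_adj {v w : V} (h : Γ.graph.Adj v w) :
    ∃ e : Γ.Edge, e.1 = s(v, w) ∧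
      (Γ.src e = v ∧ Γ.tgt e = w ∨ Γ.src e = w ∧ Γ.tgt e = v) := by
  refine ⟨⟨s(v, w), h⟩, rfl, ?_⟩
  have := Γ.mk_src_tgt ⟨s(v, w), h⟩
  simpa using this

theorem finite_incident (hfin : ∀ v, (Γ.graph.neighborSet v).Finite) (v : V) :
    {e : Γ.Edge | v ∈ e.1}.Finite := by
  have h : (Γ.graph.incidenceSet v).Finite := by
    classical
    have := (hfin v).to_subtype
    exact Set.finite_coe_iff.1 <| Finite.of_equiv _ (Γ.graph.incidenceSetEquivNeighborSet v).symm
  exact (h.preimage Subtype.val_injective.injOn).subset fun e he => ⟨e.2, he⟩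

/-! ### The geodesic distance -/

theorem edist_le_of_isPath {p r : Γ.Point} {L : ℝ} (h : Γ.IsPath p r L) :
    edist p r ≤ ENNReal.ofReal L := iInf₂_le_of_le L h le_rfl

theorem edist_pt_le (e : Γ.Edge) {s t : ℝ} (hs : s ∈ Icc 0 (Γ.len e)) (ht : t ∈ Icc 0 (Γ.len e)) :
    edist (Γ.pt e s) (Γ.pt e t) ≤ ENNReal.ofReal |s - t| :=
  edist_le_of_isPath (.segment e s t hs ht)

theorem continuous_pt (e : Γ.Edge) : Continuous (Γ.pt e) := by
  have : LipschitzWith 1 (Γ.pt e) := by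
    intro s t
    rw [← pt_clamp e s, ← pt_clamp e t]
    refine (edist_pt_le e (clamp_mem e s) (clamp_mem e t)).trans ?_
    rw [ENNReal.coe_one, one_mul, edist_dist, Real.dist_eq]
    refine ENNReal.ofReal_le_ofReal ?_
    refine (abs_max_sub_max_le_max _ _ _ _).trans (max_le (by simp) ?_)
    exact (abs_min_sub_min_le_max _ _ _ _).trans (max_le le_rfl (by simp))
  exact this.continuous

theorem IsPath.abs_sub_le {f : Γ.Point → ℝ} {C : ℝ}
    (h : ∀ e, ∀ s ∈ Icc 0 (Γ.len e), ∀ t ∈ Icc 0 (Γ.len e),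
      |f (Γ.pt e s) - f (Γ.pt e t)| ≤ C * |s - t|) {p r : Γ.Point} {L : ℝ} (hp : Γ.IsPath p r L) :
    |f p - f r| ≤ C * L := by
  induction hp with
  | refl p => simp
  | segment e s t hs ht => exact h e s hs t ht
  | trans _ _ h1 h2 =>
    rw [mul_add]
    exact (_root_.abs_sub_le _ _ _).trans (add_le_add h1 h2)

/-- A function that is Lipschitz on each edge, with the same constant, is Lipschitz. -/
theorem lipschitzWith_of_edges {f : Γ.Point → ℝ} {C : NNReal} (hC : C ≠ 0)
    (h : ∀ e, ∀ s ∈ Icc 0 (Γ.len e), ∀ t ∈ Icc 0 (Γ.len e),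
      |f (Γ.pt e s) - f (Γ.pt e t)| ≤ C * |s - t|) : LipschitzWith C f := by
  intro p r
  have key : ∀ L, Γ.IsPath p r L → edist (f p) (f r) ≤ C * ENNReal.ofReal L := fun L hL => by
    rw [edist_dist, Real.dist_eq, ← ENNReal.ofReal_coe_nnreal, ← ENNReal.ofReal_mul C.coe_nonneg]
    exact ENNReal.ofReal_le_ofReal (hL.abs_sub_le h)
  change _ ≤ (C : ENNReal) * ⨅ (L : ℝ) (_ : Γ.IsPath p r L), ENNReal.ofReal L
  -- If no path joins `p` to `r`, the infimum is `∞`, and a factor `0` would turn it into `0`; hence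
  -- the need for `C ≠ 0`.
  have hC' : (C : ENNReal) ≠ 0 := by simpa using hC
  simp only [ENNReal.mul_iInf_of_ne hC' ENNReal.coe_ne_top]
  exact le_iInf₂ key

/-- A function that is Lipschitz on each edge, with the same constant, extends continuously to the
completion. -/
theorem exists_extension {f : Γ.Point → ℝ} {C : ℝ}
    (h : ∀ e, ∀ s ∈ Icc 0 (Γ.len e), ∀ t ∈ Icc 0 (Γ.len e),
      |f (Γ.pt e s) - f (Γ.pt e t)| ≤ C * |s - t|) :
    ∃ F : C(Γ.Completion, ℝ), ∀ p : Γ.Point, F p = f p := by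
  have hC : Real.toNNReal (max C 1) ≠ 0 := by simp
  refine ⟨⟨UniformSpace.Completion.extension f, UniformSpace.Completion.continuous_extension⟩,
    fun p => UniformSpace.Completion.extension_coe
      (lipschitzWith_of_edges hC fun e s hs t ht => (h e s hs t ht).trans ?_).uniformContinuous p⟩
  rw [Real.coe_toNNReal _ (by positivity)]
  gcongr
  exact le_max_left _ _

/-- The function on the graph with the values `a` at the vertices that is given by `b` in the edge
coordinates. -/
def glue (a : V → ℝ) (b : Γ.Edge → ℝ → ℝ) : Γ.Point → ℝ
  | .vertex v => a v
  | .inner e t _ _ => b e t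

theorem glue_pt {a : V → ℝ} {b : Γ.Edge → ℝ → ℝ} {e : Γ.Edge} (h0 : b e 0 = a (Γ.src e))
    (h1 : b e (Γ.len e) = a (Γ.tgt e)) {t : ℝ} (ht : t ∈ Icc 0 (Γ.len e)) :
    glue a b (Γ.pt e t) = b e t := by
  rcases ht.1.eq_or_lt with rfl | h
  · simp [glue, h0]
  rcases ht.2.eq_or_lt with rfl | h'
  · simp [glue, h1]
  rw [pt_of_mem_Ioo e ⟨h, h'⟩]
  rfl

/-- The point with coordinate `t` on `e`, in the completion. -/
noncomputable def cpt (e : Γ.Edge) (t : ℝ) : Γ.Completion := (Γ.pt e t : Γ.Completion)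

theorem continuous_cpt (e : Γ.Edge) : Continuous (Γ.cpt e) :=
  (UniformSpace.Completion.continuous_coe _).comp (continuous_pt e)

theorem denseRange_coe : DenseRange ((↑) : Γ.Point → Γ.Completion) :=
  UniformSpace.Completion.denseRange_coe

/-! ### Gluing functions on the edges -/

/-- Functions that are Lipschitz on each edge, agree at the vertices and are constant outside
finitely many edges extend to a continuous function on the completion. -/
theorem exists_continuousMap_glue {a : V → ℝ} {b : Γ.Edge → ℝ → ℝ} {K : Γ.Edge → ℝ}
    {S : Set Γ.Edge} (hS : S.Finite) (h0 : ∀ e, b e 0 = a (Γ.src e))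
    (h1 : ∀ e, b e (Γ.len e) = a (Γ.tgt e)) (hK : ∀ e, 0 ≤ K e) (hKS : ∀ e ∉ S, K e = 0)
    (hb : ∀ e, ∀ s ∈ Icc 0 (Γ.len e), ∀ t ∈ Icc 0 (Γ.len e), |b e s - b e t| ≤ K e * |s - t|) :
    ∃ F : C(Γ.Completion, ℝ), (∀ v, F (Point.vertex v : Γ.Point) = a v) ∧
      ∀ e, ∀ t ∈ Icc 0 (Γ.len e), F (Γ.cpt e t) = b e t := by
  have hC : ∀ e, K e ≤ ∑ e ∈ hS.toFinset, K e := fun e => by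
    by_cases he : e ∈ S
    · exact Finset.single_le_sum (fun i _ => hK i) (hS.mem_toFinset.2 he)
    · rw [hKS e he]
      exact Finset.sum_nonneg fun i _ => hK i
  obtain ⟨F, hF⟩ := exists_extension (f := glue a b) (C := ∑ e ∈ hS.toFinset, K e)
    fun e s hs t ht => by
      rw [glue_pt (h0 e) (h1 e) hs, glue_pt (h0 e) (h1 e) ht]
      exact (hb e s hs t ht).trans (by gcongr; exact hC e)
  exact ⟨F, fun v => hF _, fun e t ht => (hF _).trans (glue_pt (h0 e) (h1 e) ht)⟩

/-- A continuous function on the completion that vanishes at the points of the graph outside a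
compact set vanishes outside that set. -/
theorem mem_of_apply_ne_zero {F : C(Γ.Completion, ℝ)} {Z : Set Γ.Completion} (hZ : IsClosed Z)
    (h : ∀ p : Γ.Point, F p ≠ 0 → (p : Γ.Completion) ∈ Z) {x : Γ.Completion} (hx : F x ≠ 0) :
    x ∈ Z := by
  have ho : IsOpen {y | F y ≠ 0} := isOpen_ne_fun F.continuous continuous_const
  have := denseRange_coe (Γ := Γ)
  have h2 := this.open_subset_closure_inter ho hx
  refine closure_minimal ?_ hZ h2
  rintro _ ⟨hy, p, rfl⟩
  exact h p hy

/-! ### Tents at the vertices -/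

open Classical in
/-- The function on the edge `e` that is affine with the value `1` at `v` and `0` at the other
vertices. -/
noncomputable def edgeTent (v : V) (e : Γ.Edge) (t : ℝ) : ℝ :=
  (if Γ.src e = v then 1 - t / Γ.len e else 0) + if Γ.tgt e = v then t / Γ.len e else 0

theorem edgeTent_of_src (e : Γ.Edge) (t : ℝ) : edgeTent (Γ.src e) e t = 1 - t / Γ.len e := by
  simp [edgeTent, (src_ne_tgt e).symm]

theorem edgeTent_of_tgt (e : Γ.Edge) (t : ℝ) : edgeTent (Γ.tgt e) e t = t / Γ.len e := by
  simp [edgeTent, src_ne_tgt e]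

theorem edgeTent_of_notMem {v : V} {e : Γ.Edge} (h : v ∉ e.1) (t : ℝ) : edgeTent v e t = 0 := by
  rw [mem_edge_iff, not_or] at h
  simp [edgeTent, Ne.symm h.1, Ne.symm h.2]

open Classical in
theorem exists_vertexTent (hfin : ∀ v, (Γ.graph.neighborSet v).Finite) (v : V) :
    ∃ τ : C(Γ.Completion, ℝ), (∀ w, τ (Point.vertex w : Γ.Point) = if w = v then 1 else 0) ∧
      ∀ e, ∀ t ∈ Icc 0 (Γ.len e), τ (Γ.cpt e t) = edgeTent v e t := by
  refine exists_continuousMap_glue (K := fun e => if v ∈ e.1 then (Γ.len e)⁻¹ else 0)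
    (finite_incident hfin v) (fun e => ?_) (fun e => ?_) (fun e => ?_) (fun e he => ?_) ?_
  · by_cases h : Γ.src e = v <;> simp [edgeTent, h]
  · by_cases h : Γ.tgt e = v <;> simp [edgeTent, h, (Γ.len_pos e).ne']
  · have := Γ.len_pos e
    positivity
  · exact if_neg he
  · intro e s _ t _
    have hl := Γ.len_pos e
    by_cases h : v ∈ e.1
    · rw [if_pos h]
      rcases mem_edge_iff.1 h with rfl | rfl
      · rw [edgeTent_of_src, edgeTent_of_src, ← abs_of_pos (inv_pos.2 hl), ← abs_mul, ← abs_neg]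
        exact le_of_eq (by congr 1; ring)
      · rw [edgeTent_of_tgt, edgeTent_of_tgt, ← abs_of_pos (inv_pos.2 hl), ← abs_mul]
        exact le_of_eq (by congr 1; ring)
    · simp [edgeTent_of_notMem h, h]

/-- The tent function of a vertex. -/
noncomputable def vertexTent (hfin : ∀ v, (Γ.graph.neighborSet v).Finite) (v : V) :
    C(Γ.Completion, ℝ) := (exists_vertexTent hfin v).choose

variable (hfin : ∀ v, (Γ.graph.neighborSet v).Finite)

open Classical in
theorem vertexTent_vertex (v w : V) :
    vertexTent hfin v (Point.vertex w : Γ.Point) = if w = v then 1 else 0 :=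
  (exists_vertexTent hfin v).choose_spec.1 w

theorem vertexTent_cpt (v : V) (e : Γ.Edge) {t : ℝ} (ht : t ∈ Icc 0 (Γ.len e)) :
    vertexTent hfin v (Γ.cpt e t) = edgeTent v e t :=
  (exists_vertexTent hfin v).choose_spec.2 e t ht

theorem coe_inner (e : Γ.Edge) (t : ℝ) (h0 : 0 < t) (h1 : t < Γ.len e) :
    ((Point.inner e t h0 h1 : Γ.Point) : Γ.Completion) = Γ.cpt e t := by
  rw [cpt, pt_of_mem_Ioo e ⟨h0, h1⟩]

include hfin in
/-- The tent function of `v` vanishes outside the star of `v`. -/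
theorem eq_of_vertexTent_ne_zero {v : V} {x : Γ.Completion} (hx : vertexTent hfin v x ≠ 0) :
    x = (Point.vertex v : Γ.Point) ∨
      ∃ e : Γ.Edge, v ∈ e.1 ∧ ∃ t ∈ Icc 0 (Γ.len e), x = Γ.cpt e t := by
  -- By local finiteness the closed star is a finite union of compact edges, so passing to the
  -- completion adds no point to it.
  have hc : IsClosed ({((Point.vertex v : Γ.Point) : Γ.Completion)} ∪
      ⋃ e ∈ {e : Γ.Edge | v ∈ e.1}, Γ.cpt e '' Icc 0 (Γ.len e)) :=
    isClosed_singleton.union <| (finite_incident hfin v).isClosed_biUnion fun e _ =>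
      (isCompact_Icc.image (continuous_cpt e)).isClosed
  have := mem_of_apply_ne_zero hc (F := vertexTent hfin v) (fun p hp => ?_) hx
  · rcases this with h | h
    · exact .inl h
    · simp only [mem_iUnion] at h
      obtain ⟨e, he, t, ht, rfl⟩ := h
      exact .inr ⟨e, he, t, ht, rfl⟩
  · rcases p with w | ⟨e, t, h0, h1⟩
    · rw [vertexTent_vertex] at hp
      left
      by_contra h
      exact hp (if_neg fun h' => h (by rw [h']; rfl))
    · right
      rw [coe_inner, vertexTent_cpt hfin v e ⟨h0.le, h1.le⟩] at hp
      simp only [mem_iUnion]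
      refine ⟨e, ?_, t, ⟨h0.le, h1.le⟩, (coe_inner e t h0 h1).symm⟩
      by_contra h
      exact hp (edgeTent_of_notMem h t)

theorem cpt_mem_carrier (e : Γ.Edge) (t : ℝ) : Γ.cpt e t ∈ Γ.carrier := ⟨_, rfl⟩

-- The support of the tent lies in the closed star of `v`, which is part of the graph, so it
-- contains no point at infinity; and the tent vanishes at all vertices other than `v`. Tents thus
-- isolate vertices from the rest of the boundary.
include hfin in
theorem eq_of_mem_boundary {x : Γ.Completion} (hx : x ∈ Γ.boundary) {v : V}
    (h : vertexTent hfin v x ≠ 0) :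
    x = (Point.vertex v : Γ.Point) ∧ (Γ.graph.neighborSet v).ncard = 1 := by
  rcases hx with ⟨w, hw, rfl⟩ | hx
  · rw [vertexTent_vertex] at h
    have : w = v := by
      by_contra h'
      exact h (if_neg h')
    exact this ▸ ⟨rfl, hw⟩
  · exfalso
    rcases eq_of_vertexTent_ne_zero hfin h with rfl | ⟨e, _, t, _, rfl⟩
    · exact hx ⟨_, rfl⟩
    · exact hx (cpt_mem_carrier e t)

theorem vertexTent_eq_zero_of_mem_boundary {x : Γ.Completion} (hx : x ∈ Γ.boundary) {v : V}
    (h : x ≠ (Point.vertex v : Γ.Point)) : vertexTent hfin v x = 0 := by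
  by_contra h'
  exact h (eq_of_mem_boundary hfin hx h').1

/-! ### The boundary -/

theorem isOpen_vertexTent_ne (v : V) : IsOpen {x | vertexTent hfin v x ≠ 0} :=
  isOpen_ne_fun (vertexTent hfin v).continuous continuous_const

-- Every point off the boundary lies in the graph and has a neighbourhood free of boundary points:
-- the set where a tent is nonzero, with the vertex removed when the point is interior to an edge.
include hfin in
theorem isClosed_boundary : IsClosed Γ.boundary := by
  rw [← isOpen_compl_iff, isOpen_iff_mem_nhds]
  intro x hx
  have hxc : x ∈ Γ.carrier := by
    by_contra h
    exact hx (.inr h)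
  obtain ⟨p, rfl⟩ := hxc
  rcases p with v | ⟨e, t, h0, h1⟩
  · refine mem_of_superset ((isOpen_vertexTent_ne hfin v).mem_nhds ?_) fun y hy hyb => ?_
    · simp [vertexTent_vertex]
    · exact hx (.inl ⟨v, (eq_of_mem_boundary hfin hyb hy).2, rfl⟩)
  · have hl := Γ.len_pos e
    have htl : 0 < t / Γ.len e := div_pos h0 hl
    have htl' : t / Γ.len e < 1 := (div_lt_one hl).2 h1
    have hval : vertexTent hfin (Γ.src e) (Γ.cpt e t) = 1 - t / Γ.len e := by
      rw [vertexTent_cpt hfin _ _ ⟨h0.le, h1.le⟩, edgeTent_of_src]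
    simp only [coe_inner]
    refine mem_of_superset (((isOpen_vertexTent_ne hfin (Γ.src e)).inter
      (isOpen_compl_singleton (x := ((Point.vertex (Γ.src e) : Γ.Point) : Γ.Completion)))).mem_nhds
        ⟨?_, ?_⟩) fun y hy hyb => hy.2 (eq_of_mem_boundary hfin hyb hy.1).1
    · change _ ≠ _
      rw [hval]
      linarith
    · intro h
      rw [mem_singleton_iff] at h
      rw [h, vertexTent_vertex, if_pos rfl] at hval
      linarith

include hfin in
theorem isOpen_vertex_boundary (v : V) :
    IsOpen {x : Γ.boundary | (x : Γ.Completion) = (Point.vertex v : Γ.Point)} := by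
  convert (isOpen_vertexTent_ne hfin v).preimage continuous_subtype_val using 1
  ext x
  refine ⟨fun h => ?_, fun h => (eq_of_mem_boundary hfin x.2 h).1⟩
  have h' : (x : Γ.Completion) = (Point.vertex v : Γ.Point) := h
  simp [h', vertexTent_vertex]

include hfin in
/-- A boundary point in the graph is isolated in the boundary. -/
theorem isOpen_singleton_of_mem_carrier {x : Γ.boundary} (hx : (x : Γ.Completion) ∈ Γ.carrier) :
    IsOpen {x} := by
  rcases x.2 with ⟨v, _, h⟩ | h
  · convert isOpen_vertex_boundary hfin v using 1
    ext y
    simp [Subtype.ext_iff, h]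
  · exact absurd hx h

-- The trace of `A` on the boundary is clopen: a boundary point outside `A` lies either in the open
-- set `B` or in `W`, and in the second case it is a point of the graph, hence isolated in the
-- boundary.
include hfin in
theorem totallySeparatedSpace_boundary (hweak : Γ.WeaklyConnected) :
    TotallySeparatedSpace Γ.boundary := by
  rw [totallySeparatedSpace_iff_exists_isClopen]
  intro x y hxy
  obtain ⟨W, -, hWc, A, B, hA, hB, hAB, hW, hxA, hyB⟩ :=
    hweak x y (Subtype.coe_injective.ne hxy)
  refine ⟨Subtype.val ⁻¹' A, ⟨⟨?_⟩, hA.preimage continuous_subtype_val⟩, hxA,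
    fun h => disjoint_left.1 hAB h hyB⟩
  rw [isOpen_iff_mem_nhds]
  intro z hz
  by_cases hzW : (z : Γ.Completion) ∈ W
  · refine mem_of_superset ((isOpen_singleton_of_mem_carrier hfin (hWc hzW)).mem_nhds rfl) ?_
    rintro _ rfl
    exact hz
  · have hzB : (z : Γ.Completion) ∈ B := by
      have h : (z : Γ.Completion) ∈ A ∪ B := hW ▸ hzW
      exact h.resolve_left hz
    exact mem_of_superset ((hB.preimage continuous_subtype_val).mem_nhds hzB)
      fun w hw hwA => disjoint_left.1 hAB hwA hw

/-- The points carry only an extended pseudometric, so metrizability of the completion is obtained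
from its uniformity: a countable basis passes to Cauchy filters and then to their separation
quotient. -/
instance isCountablyGenerated_uniformity_completion :
    (uniformity Γ.Completion).IsCountablyGenerated := by
  obtain ⟨s, hs⟩ := (uniformity Γ.Point).exists_antitone_basis
  have h : (uniformity (CauchyFilter Γ.Point)).IsCountablyGenerated :=
    (CauchyFilter.basis_uniformity hs.1).isCountablyGenerated
  change (uniformity (SeparationQuotient (CauchyFilter Γ.Point))).IsCountablyGenerated
  rw [SeparationQuotient.uniformity_eq]
  infer_instance

theorem metrizableSpace_completion : TopologicalSpace.MetrizableSpace Γ.Completion :=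
  UniformSpace.metrizableSpace

theorem secondCountableTopology_completion [CompactSpace Γ.Completion] :
    SecondCountableTopology Γ.Completion := by
  let _ := TopologicalSpace.metrizableSpaceMetric Γ.Completion
  infer_instance

end MetricGraph

/-! ### Finitely additive functions on the clopen sets of a profinite space -/

section ClopenContent

variable {X : Type*} [TopologicalSpace X] [CompactSpace X]

/-- If the union of disjoint clopen sets is closed, then all but finitely many of them are empty. -/
theorem eventually_eq_empty_of_isClopen_iUnion {E : ℕ → Set X} (hE : ∀ n, IsClopen (E n))
    (hd : Pairwise (Function.onFun Disjoint E)) (hU : IsClosed (⋃ n, E n)) :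
    ∃ N, ∀ n, N ≤ n → E n = ∅ := by
  obtain ⟨s, hs⟩ := hU.isCompact.elim_finite_subcover E (fun n => (hE n).isOpen) le_rfl
  refine ⟨s.sup id + 1, fun n hn => ?_⟩
  rw [eq_empty_iff_forall_notMem]
  intro x hx
  obtain ⟨m, hm, hxm⟩ := mem_iUnion₂.1 (hs (mem_iUnion.2 ⟨n, hx⟩))
  have hmn : m ≠ n := by
    have := Finset.le_sup (f := id) hm
    simp only [id] at this
    omega
  exact disjoint_left.1 (hd hmn) hxm hx

/-- A finitely additive function on the clopen subsets of a compact space is countably additive. -/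
theorem hasSum_of_isClopen_iUnion {M : Type*} [AddCommMonoid M] [TopologicalSpace M]
    {m : Set X → M} (h0 : m ∅ = 0)
    (hadd : ∀ A B, IsClopen A → IsClopen B → Disjoint A B → m (A ∪ B) = m A + m B)
    {E : ℕ → Set X} (hE : ∀ n, IsClopen (E n))
    (hd : Pairwise (Function.onFun Disjoint E)) (hU : IsClosed (⋃ n, E n)) :
    HasSum (fun n => m (E n)) (m (⋃ n, E n)) := by
  obtain ⟨N, hN⟩ := eventually_eq_empty_of_isClopen_iUnion hE hd hU
  have h1 : ∀ k, IsClopen (⋃ n ∈ Finset.range k, E n) ∧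
      m (⋃ n ∈ Finset.range k, E n) = ∑ n ∈ Finset.range k, m (E n) := by
    intro k
    induction k with
    | zero => simp [h0, isClopen_empty]
    | succ k ih =>
      have hu : ⋃ n ∈ Finset.range (k + 1), E n = (⋃ n ∈ Finset.range k, E n) ∪ E k := by
        rw [Finset.range_add_one, Finset.set_biUnion_insert, union_comm]
      rw [hu]
      refine ⟨ih.1.union (hE k), ?_⟩
      rw [hadd _ _ ih.1 (hE k), ih.2, Finset.sum_range_succ]
      rw [disjoint_iUnion₂_left]
      intro n hn
      exact hd (Finset.mem_range.1 hn).ne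
  have h2 : ⋃ n, E n = ⋃ n ∈ Finset.range N, E n := by
    refine subset_antisymm (iUnion_subset fun n => ?_) (iUnion₂_subset fun n _ => subset_iUnion E n)
    rcases lt_or_ge n N with h | h
    · exact subset_biUnion_of_mem (u := E) (Finset.mem_coe.2 (Finset.mem_range.2 h))
    · simp [hN n h]
  rw [h2, (h1 N).2]
  refine hasSum_sum_of_ne_finset_zero fun n hn => ?_
  rw [hN n (by simpa using hn), h0]

omit [CompactSpace X] in
theorem isPiSystem_isClopen : IsPiSystem {s : Set X | IsClopen s} :=
  fun _ hs _ ht _ => hs.inter ht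

variable [T2Space X] [TotallyDisconnectedSpace X] [SecondCountableTopology X] [MeasurableSpace X]
  [BorelSpace X]

/-- In a compact Hausdorff totally disconnected space the clopen sets are a basis, and in a second
countable space any basis generates the Borel sets. -/
theorem borel_eq_generateFrom_isClopen :
    ‹MeasurableSpace X› = MeasurableSpace.generateFrom {s : Set X | IsClopen s} :=
  (BorelSpace.measurable_eq).trans isTopologicalBasis_isClopen.borel_eq_generateFrom

/-- A nonnegative finitely additive function on the clopen subsets of a second countable profinite
space is the restriction of a finite Borel measure. -/
theorem exists_measure_of_isClopen {m : Set X → ℝ} (h0 : m ∅ = 0)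
    (hadd : ∀ A B, IsClopen A → IsClopen B → Disjoint A B → m (A ∪ B) = m A + m B)
    (hnn : ∀ A, IsClopen A → 0 ≤ m A) :
    ∃ ν : Measure X, IsFiniteMeasure ν ∧ ∀ A, IsClopen A → ν.real A = m A := by
  have hC : IsSetRing {s : Set X | IsClopen s} :=
    ⟨isClopen_empty, fun _ _ hs ht => hs.union ht, fun _ _ hs ht => hs.diff ht⟩
  let c : AddContent ENNReal {s : Set X | IsClopen s} :=
    hC.addContent_of_union (fun s => ENNReal.ofReal (m s)) (by simp [h0]) fun {s t} hs ht hst => by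
      rw [hadd s t hs ht hst, ENNReal.ofReal_add (hnn s hs) (hnn t ht)]
  -- The countable hypothesis of Carathéodory's theorem is free here: a countable disjoint union
  -- that is again clopen is a finite one.
  have hsub : c.IsSigmaSubadditive := by
    refine isSigmaSubadditive_of_addContent_iUnion_eq_tsum hC fun f hf hU hd => ?_
    refine (hasSum_of_isClopen_iUnion (m := fun s => c s) addContent_empty
      (fun A B hA hB hAB => addContent_union hC hA hB hAB) hf hd hU.isClosed).tsum_eq.symm
  have key : ∀ A, IsClopen A →
      c.measure hC.isSetSemiring borel_eq_generateFrom_isClopen.le hsub A = ENNReal.ofReal (m A) :=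
    fun A hA => c.measure_eq hC.isSetSemiring borel_eq_generateFrom_isClopen hsub hA
  refine ⟨c.measure hC.isSetSemiring borel_eq_generateFrom_isClopen.le hsub, ⟨?_⟩, fun A hA => ?_⟩
  · rw [key _ isClopen_univ]
    exact ENNReal.ofReal_lt_top
  · rw [measureReal_def, key A hA, ENNReal.toReal_ofReal (hnn A hA)]

/-- Finite Borel measures that agree on the clopen sets are equal. -/
theorem measure_ext_of_isClopen {μ ν : Measure X} [IsFiniteMeasure μ] [IsFiniteMeasure ν]
    (h : ∀ A, IsClopen A → μ.real A = ν.real A) : μ = ν := by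
  have h' : ∀ A, IsClopen A → μ A = ν A := fun A hA => by
    rw [← ENNReal.toReal_eq_toReal_iff' (measure_ne_top _ _) (measure_ne_top _ _)]
    exact h A hA
  exact ext_of_generate_finite _ borel_eq_generateFrom_isClopen isPiSystem_isClopen h'
    (h' _ isClopen_univ)

/-- Signed Borel measures that agree on the clopen sets are equal. -/
theorem signedMeasure_ext_of_isClopen {μ ν : SignedMeasure X}
    (h : ∀ A, IsClopen A → μ A = ν A) : μ = ν :=
  VectorMeasure.ext_of_generateFrom _ h borel_eq_generateFrom_isClopen isPiSystem_isClopen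
    (h _ isClopen_univ)

end ClopenContent

namespace MetricGraph

open scoped ContDiff

variable {V : Type*} {Γ : MetricGraph V}

/-! ### The algebra of eventually flat functions -/

/-- A function on the completion in the coordinate of the edge `e`. -/
noncomputable abbrev edgeFun (φ : Γ.Completion → ℝ) (e : Γ.Edge) : ℝ → ℝ :=
  Γ.onEdge (fun p => φ p) e

theorem edgeFun_apply (φ : Γ.Completion → ℝ) (e : Γ.Edge) (t : ℝ) :
    edgeFun φ e t = φ (Γ.cpt e t) := rfl

theorem continuous_edgeFun {φ : Γ.Completion → ℝ} (hφ : Continuous φ) (e : Γ.Edge) :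
    Continuous (edgeFun φ e) := hφ.comp (continuous_cpt e)

theorem IsEventuallyFlat.const (c : ℝ) : Γ.IsEventuallyFlat fun _ => c := by
  have h : ∀ e, Γ.onEdge (fun _ => c) e = fun _ => c := fun e => rfl
  refine ⟨continuous_const, fun e => contDiffOn_const, ?_, fun e => ?_, fun e => ?_⟩ <;> simp [h]

theorem differentiableAt_of_smooth {φ : Γ.Completion → ℝ} {e : Γ.Edge}
    (hφ : ContDiffOn ℝ ∞ (edgeFun φ e) (Ioo 0 (Γ.len e))) {t : ℝ} (ht : t ∈ Ioo 0 (Γ.len e)) :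
    DifferentiableAt ℝ (edgeFun φ e) t :=
  (hφ.differentiableOn (by simp)).differentiableAt (isOpen_Ioo.mem_nhds ht)

theorem IsEventuallyFlat.differentiableAt {φ : Γ.Completion → ℝ} (hφ : Γ.IsEventuallyFlat φ)
    {e : Γ.Edge} {t : ℝ} (ht : t ∈ Ioo 0 (Γ.len e)) : DifferentiableAt ℝ (edgeFun φ e) t :=
  differentiableAt_of_smooth (hφ.smooth e) ht

theorem eventually_mem_Ioo_src (e : Γ.Edge) : ∀ᶠ t in 𝓝[>] 0, t ∈ Ioo 0 (Γ.len e) :=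
  Ioo_mem_nhdsGT (Γ.len_pos e)

theorem eventually_mem_Ioo_tgt (e : Γ.Edge) : ∀ᶠ t in 𝓝[<] Γ.len e, t ∈ Ioo 0 (Γ.len e) :=
  Ioo_mem_nhdsLT (Γ.len_pos e)

/-- A continuous function that is smooth on the open edges is eventually flat if its derivative
vanishes wherever the derivatives of two eventually flat functions vanish. -/
theorem IsEventuallyFlat.of_deriv {φ ψ f : Γ.Completion → ℝ} (hφ : Γ.IsEventuallyFlat φ)
    (hψ : Γ.IsEventuallyFlat ψ) (hf : Continuous f)
    (hs : ∀ e, ContDiffOn ℝ ∞ (edgeFun f e) (Ioo 0 (Γ.len e)))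
    (h : ∀ e, ∀ t ∈ Ioo 0 (Γ.len e), deriv (edgeFun φ e) t = 0 → deriv (edgeFun ψ e) t = 0 →
      deriv (edgeFun f e) t = 0) : Γ.IsEventuallyFlat f where
  continuous := hf
  smooth := hs
  finite := by
    refine (hφ.finite.union hψ.finite).subset ?_
    rintro e ⟨t, ht, hne⟩
    by_contra hc
    simp only [mem_union, mem_ofPred_eq, not_or, not_exists, not_and, not_not] at hc
    exact hne (h e t ht (hc.1 t ht) (hc.2 t ht))
  flat_src e := by
    filter_upwards [hφ.flat_src e, hψ.flat_src e, eventually_mem_Ioo_src e] with t h1 h2 ht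
    exact h e t ht h1 h2
  flat_tgt e := by
    filter_upwards [hφ.flat_tgt e, hψ.flat_tgt e, eventually_mem_Ioo_tgt e] with t h1 h2 ht
    exact h e t ht h1 h2

theorem IsEventuallyFlat.add {φ ψ : Γ.Completion → ℝ} (hφ : Γ.IsEventuallyFlat φ)
    (hψ : Γ.IsEventuallyFlat ψ) : Γ.IsEventuallyFlat fun x => φ x + ψ x :=
  hφ.of_deriv hψ (hφ.continuous.add hψ.continuous) (fun e => (hφ.smooth e).add (hψ.smooth e))
    fun e t ht h1 h2 => by
      have := ((hφ.differentiableAt ht).hasDerivAt.add (hψ.differentiableAt ht).hasDerivAt).deriv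
      rw [h1, h2, add_zero] at this
      exact this

theorem IsEventuallyFlat.mul {φ ψ : Γ.Completion → ℝ} (hφ : Γ.IsEventuallyFlat φ)
    (hψ : Γ.IsEventuallyFlat ψ) : Γ.IsEventuallyFlat fun x => φ x * ψ x :=
  hφ.of_deriv hψ (hφ.continuous.mul hψ.continuous) (fun e => (hφ.smooth e).mul (hψ.smooth e))
    fun e t ht h1 h2 => by
      have := ((hφ.differentiableAt ht).hasDerivAt.mul (hψ.differentiableAt ht).hasDerivAt).deriv
      rw [h1, h2, zero_mul, mul_zero, add_zero] at this
      exact this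

theorem IsEventuallyFlat.const_mul {φ : Γ.Completion → ℝ} (hφ : Γ.IsEventuallyFlat φ) (c : ℝ) :
    Γ.IsEventuallyFlat fun x => c * φ x := (IsEventuallyFlat.const c).mul hφ

theorem IsEventuallyFlat.sub {φ ψ : Γ.Completion → ℝ} (hφ : Γ.IsEventuallyFlat φ)
    (hψ : Γ.IsEventuallyFlat ψ) : Γ.IsEventuallyFlat fun x => φ x - ψ x := by
  convert hφ.add (hψ.const_mul (-1)) using 2
  ring

theorem IsEventuallyFlat.prod {ι : Type*} {s : Finset ι} {φ : ι → Γ.Completion → ℝ}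
    (h : ∀ i ∈ s, Γ.IsEventuallyFlat (φ i)) : Γ.IsEventuallyFlat fun x => ∏ i ∈ s, φ i x := by
  classical
  induction s using Finset.induction_on with
  | empty => simpa using IsEventuallyFlat.const 1
  | insert i s hi ih =>
    simp only [Finset.prod_insert hi]
    exact (h i (Finset.mem_insert_self i s)).mul
      (ih fun j hj => h j (Finset.mem_insert_of_mem hj))

/-- A function that is locally equal to an eventually flat function or to `0` is eventually flat. -/
theorem IsEventuallyFlat.of_eventuallyEq {φ f : Γ.Completion → ℝ} (hφ : Γ.IsEventuallyFlat φ)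
    (h : ∀ x, f =ᶠ[𝓝 x] φ ∨ f =ᶠ[𝓝 x] fun _ => 0) : Γ.IsEventuallyFlat f := by
  have he : ∀ e t, edgeFun f e =ᶠ[𝓝 t] edgeFun φ e ∨ edgeFun f e =ᶠ[𝓝 t] fun _ => 0 := by
    intro e t
    have hc := (continuous_cpt e).continuousAt (x := t)
    refine (h (Γ.cpt e t)).imp (fun h => ?_) fun h => ?_
    · filter_upwards [hc.eventually h] with s hs using hs
    · filter_upwards [hc.eventually h] with s hs using hs
  refine hφ.of_deriv hφ ?_ (fun e t ht => ?_) fun e t ht h1 _ => ?_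
  · rw [continuous_iff_continuousAt]
    intro x
    rcases h x with h | h
    · exact hφ.continuous.continuousAt.congr h.symm
    · exact continuousAt_const.congr h.symm
  · rcases he e t with h | h
    · exact (((hφ.smooth e).contDiffAt (isOpen_Ioo.mem_nhds ht)).congr_of_eventuallyEq
        h).contDiffWithinAt
    · exact (contDiffAt_const.congr_of_eventuallyEq h).contDiffWithinAt
  · rcases he e t with h | h
    · rw [h.deriv_eq, h1]
    · rw [h.deriv_eq, deriv_const]

theorem eq_of_deriv_eq_zero_Ioo {f : ℝ → ℝ} {a b : ℝ} (hab : a < b) (hc : Continuous f)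
    (hd : DifferentiableOn ℝ f (Ioo a b)) (h : ∀ t ∈ Ioo a b, deriv f t = 0) : f b = f a := by
  obtain ⟨c, hc, hc'⟩ := exists_deriv_eq_slope f hab hc.continuousOn hd
  rw [h c hc, eq_comm, div_eq_zero_iff] at hc'
  exact sub_eq_zero.1 (hc'.resolve_right (sub_pos.2 hab).ne')

/-- The coordinate map is constant on `(-∞, 0]`, so flatness on the right of `0` gives constancy on
a two-sided neighbourhood. This extends smoothness to all of `ℝ` and removes the boundary terms in
integrations by parts. -/
theorem IsEventuallyFlat.eventuallyEq_src {φ : Γ.Completion → ℝ} (hφ : Γ.IsEventuallyFlat φ)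
    (e : Γ.Edge) {t : ℝ} (ht : t ≤ 0) : edgeFun φ e =ᶠ[𝓝 t] fun _ => edgeFun φ e 0 := by
  have hneg : ∀ s ≤ 0, edgeFun φ e s = edgeFun φ e 0 := fun s hs => by
    rw [edgeFun_apply, edgeFun_apply, cpt, cpt, pt_of_nonpos e hs, pt_zero]
  obtain ⟨ε, hε, h⟩ := mem_nhdsGT_iff_exists_Ioo_subset.1
    ((hφ.flat_src e).and (eventually_mem_Ioo_src e))
  filter_upwards [Iio_mem_nhds (ht.trans_lt hε)] with s hs
  rcases le_or_gt s 0 with h0 | h0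
  · exact hneg s h0
  · have hsub : ∀ r ∈ Ioo 0 s, r ∈ Ioo 0 ε := fun r hr => ⟨hr.1, hr.2.trans hs⟩
    exact eq_of_deriv_eq_zero_Ioo h0 (continuous_edgeFun hφ.continuous e)
      (fun r hr => (hφ.differentiableAt (h (hsub r hr)).2).differentiableWithinAt)
      fun r hr => (h (hsub r hr)).1

theorem IsEventuallyFlat.eventuallyEq_tgt {φ : Γ.Completion → ℝ} (hφ : Γ.IsEventuallyFlat φ)
    (e : Γ.Edge) {t : ℝ} (ht : Γ.len e ≤ t) :
    edgeFun φ e =ᶠ[𝓝 t] fun _ => edgeFun φ e (Γ.len e) := by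
  have hge : ∀ s, Γ.len e ≤ s → edgeFun φ e s = edgeFun φ e (Γ.len e) := fun s hs => by
    rw [edgeFun_apply, edgeFun_apply, cpt, cpt, pt_of_len_le e hs, pt_len]
  obtain ⟨ε, hε, h⟩ := mem_nhdsLT_iff_exists_Ioo_subset.1
    ((hφ.flat_tgt e).and (eventually_mem_Ioo_tgt e))
  filter_upwards [Ioi_mem_nhds ((mem_Iio.1 hε).trans_le ht)] with s hs
  rcases le_or_gt (Γ.len e) s with h0 | h0
  · exact hge s h0
  · have hsub : ∀ r ∈ Ioo s (Γ.len e), r ∈ Ioo ε (Γ.len e) := fun r hr =>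
      ⟨(mem_Ioi.1 hs).trans hr.1, hr.2⟩
    exact (eq_of_deriv_eq_zero_Ioo h0 (continuous_edgeFun hφ.continuous e)
      (fun r hr => (hφ.differentiableAt (h (hsub r hr)).2).differentiableWithinAt)
      fun r hr => (h (hsub r hr)).1).symm

/-- An eventually flat function is smooth in the (extended) edge coordinates. -/
theorem IsEventuallyFlat.contDiff {φ : Γ.Completion → ℝ} (hφ : Γ.IsEventuallyFlat φ)
    (e : Γ.Edge) : ContDiff ℝ ∞ (edgeFun φ e) := by
  rw [contDiff_iff_contDiffAt]
  intro t
  rcases le_or_gt t 0 with h0 | h0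
  · exact contDiffAt_const.congr_of_eventuallyEq (hφ.eventuallyEq_src e h0)
  rcases le_or_gt (Γ.len e) t with h1 | h1
  · exact contDiffAt_const.congr_of_eventuallyEq (hφ.eventuallyEq_tgt e h1)
  · exact (hφ.smooth e).contDiffAt (isOpen_Ioo.mem_nhds ⟨h0, h1⟩)

theorem IsEventuallyFlat.deriv_zero {φ : Γ.Completion → ℝ} (hφ : Γ.IsEventuallyFlat φ)
    (e : Γ.Edge) : deriv (edgeFun φ e) 0 = 0 := by
  rw [(hφ.eventuallyEq_src e le_rfl).deriv_eq, deriv_const]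

theorem IsEventuallyFlat.deriv_len {φ : Γ.Completion → ℝ} (hφ : Γ.IsEventuallyFlat φ)
    (e : Γ.Edge) : deriv (edgeFun φ e) (Γ.len e) = 0 := by
  rw [(hφ.eventuallyEq_tgt e le_rfl).deriv_eq, deriv_const]

/-! ### Test functions -/

/-- A smooth step, equal to `0` near `0` and to `1` near `1`. -/
noncomputable def plateau (s : ℝ) : ℝ := Real.smoothTransition (3 * s - 1)

theorem contDiff_plateau : ContDiff ℝ ∞ plateau :=
  Real.smoothTransition.contDiff.comp ((contDiff_const.mul contDiff_id).sub contDiff_const)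

theorem plateau_eventuallyEq_zero : plateau =ᶠ[𝓝 0] fun _ => 0 := by
  filter_upwards [Iio_mem_nhds (show (0 : ℝ) < 1 / 3 by norm_num)] with s hs
  have hs' : s < 1 / 3 := hs
  exact Real.smoothTransition.zero_of_nonpos (by linarith)

theorem plateau_eventuallyEq_one : plateau =ᶠ[𝓝 1] fun _ => 1 := by
  filter_upwards [Ioi_mem_nhds (show (2 / 3 : ℝ) < 1 by norm_num)] with s hs
  have hs' : 2 / 3 < s := hs
  exact Real.smoothTransition.one_of_one_le (by linarith)

theorem eventually_deriv_plateau {c : ℝ} (hc : c = 0 ∨ c = 1) :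
    ∀ᶠ s in 𝓝 c, deriv plateau s = 0 := by
  rcases hc with rfl | rfl
  · filter_upwards [plateau_eventuallyEq_zero.eventuallyEq_nhds] with s hs
    rw [hs.deriv_eq, deriv_const]
  · filter_upwards [plateau_eventuallyEq_one.eventuallyEq_nhds] with s hs
    rw [hs.deriv_eq, deriv_const]

/-- Composing with `plateau` makes a function eventually flat, if it is smooth on the edges,
constant outside finitely many edges, and has the values `0` and `1` at the vertices. -/
theorem isEventuallyFlat_plateau_comp {τ : C(Γ.Completion, ℝ)}
    (hv : ∀ v, τ (Point.vertex v : Γ.Point) = 0 ∨ τ (Point.vertex v : Γ.Point) = 1)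
    (hs : ∀ e, ContDiffOn ℝ ∞ (edgeFun τ e) (Ioo 0 (Γ.len e))) {S : Set Γ.Edge} (hS : S.Finite)
    (hτ : ∀ e ∉ S, ∀ t ∈ Ioo 0 (Γ.len e), deriv (edgeFun τ e) t = 0) :
    Γ.IsEventuallyFlat fun x => plateau (τ x) := by
  have hd : ∀ e, ∀ t ∈ Ioo 0 (Γ.len e), deriv (edgeFun (fun x => plateau (τ x)) e) t =
      deriv plateau (edgeFun τ e t) * deriv (edgeFun τ e) t := fun e t ht =>
    deriv_comp t ((contDiff_plateau.differentiable (by simp)) _)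
      (differentiableAt_of_smooth (hs e) ht)
  have hc : ∀ e t, (edgeFun τ e t = 0 ∨ edgeFun τ e t = 1) →
      ∀ᶠ s in 𝓝 t, deriv plateau (edgeFun τ e s) = 0 := fun e t h =>
    (continuous_edgeFun τ.continuous e).continuousAt.eventually (eventually_deriv_plateau h)
  refine ⟨contDiff_plateau.continuous.comp τ.continuous, fun e => contDiff_plateau.comp_contDiffOn
    (hs e), hS.subset ?_, fun e => ?_, fun e => ?_⟩
  · rintro e ⟨t, ht, hne⟩
    by_contra he
    refine hne ?_
    rw [hd e t ht, hτ e he t ht, mul_zero]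
  · have h0 : edgeFun τ e 0 = 0 ∨ edgeFun τ e 0 = 1 := by
      rw [edgeFun_apply, cpt, pt_zero]
      exact hv _
    filter_upwards [nhdsWithin_le_nhds (hc e 0 h0), eventually_mem_Ioo_src e] with t ht ht'
    exact (hd e t ht').trans (by rw [ht, zero_mul])
  · have h0 : edgeFun τ e (Γ.len e) = 0 ∨ edgeFun τ e (Γ.len e) = 1 := by
      rw [edgeFun_apply, cpt, pt_len]
      exact hv _
    filter_upwards [nhdsWithin_le_nhds (hc e _ h0), eventually_mem_Ioo_tgt e] with t ht ht'
    exact (hd e t ht').trans (by rw [ht, zero_mul])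

theorem contDiff_edgeTent (v : V) (e : Γ.Edge) : ContDiff ℝ ∞ (edgeTent v e) := by
  unfold edgeTent
  refine ContDiff.add ?_ ?_
  · split_ifs
    · exact contDiff_const.sub (contDiff_id.div_const _)
    · exact contDiff_const
  · split_ifs
    · exact contDiff_id.div_const _
    · exact contDiff_const

/-- A function on an edge that vanishes at its ends, extended by `0`. -/
theorem exists_edgeBump (e₀ : Γ.Edge) {g : ℝ → ℝ} {C : ℝ} (h0 : g 0 = 0) (h1 : g (Γ.len e₀) = 0)
    (hC : 0 ≤ C)
    (hg : ∀ s ∈ Icc 0 (Γ.len e₀), ∀ t ∈ Icc 0 (Γ.len e₀), |g s - g t| ≤ C * |s - t|) :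
    ∃ τ : C(Γ.Completion, ℝ), (∀ v, τ (Point.vertex v : Γ.Point) = 0) ∧
      (∀ t ∈ Icc 0 (Γ.len e₀), τ (Γ.cpt e₀ t) = g t) ∧
      (∀ e, e ≠ e₀ → ∀ t, τ (Γ.cpt e t) = 0) ∧ ∀ x ∈ Γ.boundary, τ x = 0 := by
  classical
  obtain ⟨τ, hv, he⟩ := exists_continuousMap_glue (a := fun _ : V => (0 : ℝ))
    (b := fun e t => if e = e₀ then g t else 0) (K := fun e => if e = e₀ then C else 0)
    (finite_singleton e₀)
    (fun e => by by_cases h : e = e₀ <;> simp [h, h0])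
    (fun e => by by_cases h : e = e₀ <;> simp [h, h1])
    (fun e => by by_cases h : e = e₀ <;> simp [h, hC])
    (fun e h => if_neg h)
    (fun e s hs t ht => by
      by_cases h : e = e₀
      · subst h
        simpa using hg s hs t ht
      · simp [h])
  have hne : ∀ e, e ≠ e₀ → ∀ t, τ (Γ.cpt e t) = 0 := fun e h t => by
    rw [cpt, ← pt_clamp, ← cpt, he e _ (clamp_mem e t), if_neg h]
  refine ⟨τ, hv, fun t ht => by simpa using he e₀ t ht, hne, fun x hx => ?_⟩
  rcases hx with ⟨v, _, rfl⟩ | hx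
  · exact hv v
  · by_contra hτ
    -- The support stays in one compact edge, so the function vanishes at the points at infinity.
    have hZ : ∀ p : Γ.Point, τ p ≠ 0 → (p : Γ.Completion) ∈ Γ.cpt e₀ '' Icc 0 (Γ.len e₀) := by
      intro p hp
      rcases p with v | ⟨e, t, ht0, ht1⟩
      · exact absurd (hv v) hp
      · rw [coe_inner] at hp ⊢
        have : e = e₀ := by
          by_contra h
          exact hp (hne e h t)
        subst this
        exact ⟨t, ⟨ht0.le, ht1.le⟩, rfl⟩
    obtain ⟨t, _, rfl⟩ := mem_of_apply_ne_zero
      (isCompact_Icc.image (continuous_cpt e₀)).isClosed hZ hτ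
    exact hx (cpt_mem_carrier e₀ t)

/-- An eventually flat function that is `1` near a given point of the graph and `0` near the other
boundary points. -/
theorem exists_isEventuallyFlat_bump (hfin : ∀ v, (Γ.graph.neighborSet v).Finite)
    {w : Γ.Completion} (hw : w ∈ Γ.carrier) :
    ∃ b : Γ.Completion → ℝ, Γ.IsEventuallyFlat b ∧ (∀ᶠ x in 𝓝 w, b x = 1) ∧
      ∀ x ∈ Γ.boundary, x ≠ w → ∀ᶠ y in 𝓝 x, b y = 0 := by
  have key : ∀ τ : C(Γ.Completion, ℝ), τ w = 1 → (∀ x ∈ Γ.boundary, x ≠ w → τ x = 0) →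
      Γ.IsEventuallyFlat (fun x => plateau (τ x)) →
      ∃ b : Γ.Completion → ℝ, Γ.IsEventuallyFlat b ∧ (∀ᶠ x in 𝓝 w, b x = 1) ∧
        ∀ x ∈ Γ.boundary, x ≠ w → ∀ᶠ y in 𝓝 x, b y = 0 := fun τ h1 h0 hflat => by
    refine ⟨_, hflat, ?_, fun x hx hxw => ?_⟩
    · have := plateau_eventuallyEq_one
      rw [← h1] at this
      filter_upwards [τ.continuous.continuousAt.eventually this] with y hy
      rw [hy, h1]
    · have := plateau_eventuallyEq_zero
      rw [← h0 x hx hxw] at this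
      filter_upwards [τ.continuous.continuousAt.eventually this] with y hy
      rw [hy, h0 x hx hxw]
  obtain ⟨p, rfl⟩ := hw
  rcases p with v | ⟨e, t, ht0, ht1⟩
  · have hsm : ∀ e, EqOn (edgeFun (vertexTent hfin v) e) (edgeTent v e) (Ioo 0 (Γ.len e)) :=
      fun e t ht => vertexTent_cpt hfin v e (Ioo_subset_Icc_self ht)
    refine key (vertexTent hfin v) (by simp [vertexTent_vertex])
      (fun x hx hxw => vertexTent_eq_zero_of_mem_boundary hfin hx hxw) ?_
    refine isEventuallyFlat_plateau_comp (fun w => ?_)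
      (fun e => (contDiff_edgeTent v e).contDiffOn.congr (hsm e)) (finite_incident hfin v)
      fun e he t ht => ?_
    · rw [vertexTent_vertex]
      split_ifs <;> simp
    · rw [((hsm e).eventuallyEq_of_mem (isOpen_Ioo.mem_nhds ht)).deriv_eq,
        funext (edgeTent_of_notMem he), deriv_const]
  · have hl := Γ.len_pos e
    have hpos : 0 < t * (Γ.len e - t) := mul_pos ht0 (sub_pos.2 ht1)
    -- A parabola that vanishes at both ends and equals `1` at `t`; its Lipschitz constant comes
    -- from `|len e - s - r| ≤ len e`.
    obtain ⟨τ, hv, hτ, hne, hb⟩ := exists_edgeBump e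
      (g := fun s => s * (Γ.len e - s) / (t * (Γ.len e - t)))
      (C := Γ.len e / (t * (Γ.len e - t))) (by simp) (by simp) (by positivity)
      fun s hs r hr => by
        have h1 : s * (Γ.len e - s) / (t * (Γ.len e - t)) - r * (Γ.len e - r) / (t * (Γ.len e - t))
            = (Γ.len e - s - r) / (t * (Γ.len e - t)) * (s - r) := by ring
        rw [h1, abs_mul, abs_div, abs_of_pos hpos]
        gcongr
        rw [abs_le]
        constructor <;> linarith [hs.1, hs.2, hr.1, hr.2]
    have hsm : EqOn (edgeFun τ e) (fun s => s * (Γ.len e - s) / (t * (Γ.len e - t)))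
      (Ioo 0 (Γ.len e)) := fun s hs => hτ s (Ioo_subset_Icc_self hs)
    have hne' : ∀ e', e' ≠ e → edgeFun τ e' = fun _ => 0 := fun e' h => funext (hne e' h)
    refine key τ ?_ (fun x hx _ => hb x hx) ?_
    · simp only [coe_inner]
      rw [hτ t ⟨ht0.le, ht1.le⟩, div_self hpos.ne']
    · refine isEventuallyFlat_plateau_comp (fun v => .inl (hv v)) (fun e' => ?_)
        (finite_singleton e) fun e' he' s _ => ?_
      · by_cases h : e' = e
        · subst h
          exact ContDiffOn.congr ((contDiff_id.mul (contDiff_const.sub contDiff_id)).div_const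
            _).contDiffOn hsm
        · rw [hne' e' h]
          exact contDiffOn_const
      · rw [hne' e' he', deriv_const]

/-- Two boundary points are separated by an eventually flat function. -/
theorem exists_isEventuallyFlat_separating (hfin : ∀ v, (Γ.graph.neighborSet v).Finite)
    (hweak : Γ.WeaklyConnected) {x y : Γ.Completion} (hx : x ∈ Γ.boundary)
    (hxy : x ≠ y) : ∃ f : Γ.Completion → ℝ, Γ.IsEventuallyFlat f ∧ (∀ᶠ z in 𝓝 x, f z = 1) ∧
      ∀ᶠ z in 𝓝 y, f z = 0 := by
  classical
  obtain ⟨W, hWf, hWc, A, B, hA, hB, hAB, hW, hxA, hyB⟩ := hweak x y hxy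
  choose! b hb hb1 hb0 using fun w (hw : w ∈ W) => exists_isEventuallyFlat_bump hfin (hWc hw)
  -- The product vanishes near every removed point, and away from `W` the set `A` is relatively
  -- clopen; cutting the product off outside `A` therefore causes no discontinuity.
  have hρ : Γ.IsEventuallyFlat fun z => ∏ w ∈ hWf.toFinset, (1 - b w z) :=
    .prod fun w hw => (IsEventuallyFlat.const 1).sub (hb w (hWf.mem_toFinset.1 hw))
  refine ⟨fun z => if z ∈ A then ∏ w ∈ hWf.toFinset, (1 - b w z) else 0,
    hρ.of_eventuallyEq fun z => ?_, ?_, ?_⟩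
  · by_cases hzW : z ∈ W
    · right
      filter_upwards [hb1 z hzW] with u hu
      split_ifs
      · exact Finset.prod_eq_zero (hWf.mem_toFinset.2 hzW) (by rw [hu, sub_self])
      · rfl
    · have h : z ∈ A ∪ B := hW ▸ hzW
      rcases h with h | h
      · left
        filter_upwards [hA.mem_nhds h] with u hu using if_pos hu
      · right
        filter_upwards [hB.mem_nhds h] with u hu using if_neg (disjoint_right.1 hAB hu)
  · have h : ∀ᶠ z in 𝓝 x, ∀ w ∈ hWf.toFinset, b w z = 0 := by
      rw [Filter.eventually_all_finset]
      intro w hw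
      have hw' := hWf.mem_toFinset.1 hw
      refine hb0 w hw' x hx fun h => ?_
      have : x ∈ Wᶜ := hW ▸ .inl hxA
      exact this (h ▸ hw')
    filter_upwards [h, hA.mem_nhds hxA] with z hz hzA
    rw [if_pos hzA]
    exact Finset.prod_eq_one fun w hw => by rw [hz w hw, sub_zero]
  · filter_upwards [hB.mem_nhds hyB] with u hu using if_neg (disjoint_right.1 hAB hu)

/-- Every clopen subset of the boundary has a test function. -/
theorem exists_isTestFunction (hfin : ∀ v, (Γ.graph.neighborSet v).Finite)
    [CompactSpace Γ.Completion] (hweak : Γ.WeaklyConnected) {E : Set Γ.boundary}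
    (hE : IsClopen E) : ∃ φ, Γ.IsTestFunction E φ := by
  have hcl := isClosed_boundary hfin (Γ := Γ)
  have hcomp : ∀ F : Set Γ.boundary, IsClosed F → IsCompact (Subtype.val '' F : Set Γ.Completion) :=
    fun F hF => (hcl.isClosedEmbedding_subtypeVal.isClosedMap F hF).isCompact
  -- For a fixed point of `E`, compactness of `Eᶜ` leaves finitely many separating functions, and
  -- their product works.
  have h1 : ∀ x ∈ (Subtype.val '' E : Set Γ.Completion), ∃ f, Γ.IsEventuallyFlat f ∧
      (∀ᶠ z in 𝓝 x, f z = 1) ∧ ∀ z ∈ (Subtype.val '' Eᶜ : Set Γ.Completion), f z = 0 := by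
    rintro _ ⟨x, hx, rfl⟩
    refine (hcomp _ hE.compl.isClosed).induction_on (p := fun s => ∃ f, Γ.IsEventuallyFlat f ∧
      (∀ᶠ z in 𝓝 (x : Γ.Completion), f z = 1) ∧ ∀ z ∈ s, f z = 0) ?_ ?_ ?_ ?_
    · exact ⟨_, .const 1, by simp, by simp⟩
    · rintro s t hst ⟨f, hf, hf1, hf0⟩
      exact ⟨f, hf, hf1, fun z hz => hf0 z (hst hz)⟩
    · rintro s t ⟨f, hf, hf1, hf0⟩ ⟨g, hg, hg1, hg0⟩
      refine ⟨_, hf.mul hg, ?_, ?_⟩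
      · filter_upwards [hf1, hg1] with z h h'
        rw [h, h', mul_one]
      · rintro z (hz | hz)
        · rw [hf0 z hz, zero_mul]
        · rw [hg0 z hz, mul_zero]
    · rintro _ ⟨y, hy, rfl⟩
      have hxy : (x : Γ.Completion) ≠ y := fun h => hy (Subtype.ext h ▸ hx)
      obtain ⟨f, hf, hf1, hf0⟩ := exists_isEventuallyFlat_separating hfin hweak x.2 hxy
      exact ⟨_, nhdsWithin_le_nhds hf0, f, hf, hf1, fun z hz => hz⟩
  obtain ⟨f, hf, hf1, hf0⟩ : ∃ f, Γ.IsEventuallyFlat f ∧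
      (∀ z ∈ (Subtype.val '' E : Set Γ.Completion), f z = 1) ∧
      ∀ z ∈ (Subtype.val '' Eᶜ : Set Γ.Completion), f z = 0 := by
    -- Compactness of `E` now; functions are combined by `f + g - f g = 1 - (1 - f) (1 - g)`, which
    -- is `1` where either factor is and `0` where both are.
    refine (hcomp _ hE.isClosed).induction_on (p := fun s => ∃ f, Γ.IsEventuallyFlat f ∧
      (∀ z ∈ s, f z = 1) ∧ ∀ z ∈ (Subtype.val '' Eᶜ : Set Γ.Completion), f z = 0) ?_ ?_ ?_ ?_
    · exact ⟨_, .const 0, by simp, by simp⟩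
    · rintro s t hst ⟨f, hf, hf1, hf0⟩
      exact ⟨f, hf, fun z hz => hf1 z (hst hz), hf0⟩
    · rintro s t ⟨f, hf, hf1, hf0⟩ ⟨g, hg, hg1, hg0⟩
      refine ⟨_, (hf.add hg).sub (hf.mul hg), ?_, fun z hz => ?_⟩
      · rintro z (hz | hz)
        · rw [hf1 z hz]
          ring
        · rw [hg1 z hz]
          ring
      · rw [hf0 z hz, hg0 z hz]
        ring
    · intro x hx
      obtain ⟨f, hf, hf1, hf0⟩ := h1 x hx
      exact ⟨_, nhdsWithin_le_nhds hf1, f, hf, fun z hz => hz, hf0⟩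
  refine ⟨f, hf, fun x => ?_⟩
  by_cases hx : x ∈ E
  · rw [charFun, indicator_of_mem hx, hf1 _ ⟨x, hx, rfl⟩]
  · rw [charFun, indicator_of_notMem hx, hf0 _ ⟨x, hx, rfl⟩]

/-! ### Bounding a function by its energy -/

open Classical in
/-- A function of the edges, extended by `0` to all pairs of vertices. -/
noncomputable def extendEdge (n : Γ.Edge → ℝ) (x : Sym2 V) : ℝ :=
  if h : x ∈ Γ.graph.edgeSet then n ⟨x, h⟩ else 0

theorem extendEdge_apply (n : Γ.Edge → ℝ) (e : Γ.Edge) : extendEdge n e.1 = n e := by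
  rw [extendEdge, dif_pos e.2]

theorem extendEdge_nonneg {n : Γ.Edge → ℝ} (hn : ∀ e, 0 ≤ n e) (x : Sym2 V) :
    0 ≤ extendEdge n x := by
  unfold extendEdge
  split_ifs
  · exact hn _
  · exact le_rfl

/-- The sum of a function of the edges along a walk. -/
noncomputable def walkSum (n : Γ.Edge → ℝ) {u v : V} (w : Γ.graph.Walk u v) : ℝ :=
  (w.edges.map (extendEdge n)).sum

theorem walkSum_nonneg {n : Γ.Edge → ℝ} (hn : ∀ e, 0 ≤ n e) {u v : V} (w : Γ.graph.Walk u v) :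
    0 ≤ walkSum n w := by
  refine List.sum_nonneg fun x hx => ?_
  obtain ⟨y, _, rfl⟩ := List.mem_map.1 hx
  exact extendEdge_nonneg hn y

theorem walkSum_bypass_le [DecidableEq V] {n : Γ.Edge → ℝ} (hn : ∀ e, 0 ≤ n e) {u v : V}
    (w : Γ.graph.Walk u v) : walkSum n w.bypass ≤ walkSum n w := by
  refine List.Sublist.sum_le_sum (w.edges_bypass_sublist_edges.map _) fun x hx => ?_
  obtain ⟨y, _, rfl⟩ := List.mem_map.1 hx
  exact extendEdge_nonneg hn y

/-- The distance of two vertices, measured along walks. -/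
noncomputable def walkDist (v₀ v : V) : ℝ := ⨅ w : Γ.graph.Walk v₀ v, walkSum Γ.len w

theorem bddBelow_walkSum (v₀ v : V) :
    BddBelow (range fun w : Γ.graph.Walk v₀ v => walkSum Γ.len w) :=
  ⟨0, by rintro _ ⟨w, rfl⟩; exact walkSum_nonneg (fun e => (Γ.len_pos e).le) w⟩

theorem walkDist_nonneg (v₀ v : V) : 0 ≤ walkDist (Γ := Γ) v₀ v :=
  Real.iInf_nonneg fun w => walkSum_nonneg (fun e => (Γ.len_pos e).le) w

theorem walkDist_le_add (hconn : Γ.graph.Connected) (v₀ : V) {u v : V} (e : Γ.Edge)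
    (he : e.1 = s(u, v)) : walkDist (Γ := Γ) v₀ v ≤ walkDist (Γ := Γ) v₀ u + Γ.len e := by
  have : Nonempty (Γ.graph.Walk v₀ u) := hconn.preconnected v₀ u
  have hadj : Γ.graph.Adj u v := by
    rw [← SimpleGraph.mem_edgeSet, ← he]
    exact e.2
  rw [walkDist, walkDist, ← sub_le_iff_le_add]
  refine le_ciInf fun w => ?_
  rw [sub_le_iff_le_add]
  refine (ciInf_le (bddBelow_walkSum v₀ v) (w.concat hadj)).trans (le_of_eq ?_)
  simp only [walkSum, SimpleGraph.Walk.edges_concat, List.concat_eq_append, List.map_append,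
    List.sum_append, List.map_cons, List.map_nil, List.sum_cons, List.sum_nil, add_zero]
  rw [← he, extendEdge_apply]

/-- The distances from a vertex are bounded, if the completion is compact. -/
theorem exists_bound_walkDist [CompactSpace Γ.Completion] (hconn : Γ.graph.Connected) (v₀ : V) :
    ∃ D : ℝ, ∀ e, ∀ t ∈ Icc 0 (Γ.len e), walkDist (Γ := Γ) v₀ (Γ.src e) + t < D ∨
      walkDist (Γ := Γ) v₀ (Γ.tgt e) + (Γ.len e - t) < D := by
  set ρ : V → ℝ := walkDist (Γ := Γ) v₀ with hρ
  have h1 : ∀ e, ρ (Γ.tgt e) ≤ ρ (Γ.src e) + Γ.len e := fun e =>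
    walkDist_le_add hconn v₀ e (Γ.mk_src_tgt e).symm
  have h2 : ∀ e, ρ (Γ.src e) ≤ ρ (Γ.tgt e) + Γ.len e := fun e =>
    walkDist_le_add hconn v₀ e (by rw [Sym2.eq_swap, Γ.mk_src_tgt e])
  -- The distance to `v₀` of an interior point is realized through one of the two ends of its edge.
  -- This function is `1`-Lipschitz, so it extends to the compact completion and is bounded.
  have hg : ∀ e, ∀ t ∈ Icc 0 (Γ.len e), glue ρ (fun e t => min (ρ (Γ.src e) + t)
      (ρ (Γ.tgt e) + (Γ.len e - t))) (Γ.pt e t) =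
      min (ρ (Γ.src e) + t) (ρ (Γ.tgt e) + (Γ.len e - t)) := fun e t ht => by
    refine glue_pt (b := fun e t => min (ρ (Γ.src e) + t) (ρ (Γ.tgt e) + (Γ.len e - t))) ?_ ?_ ht
    · simp [h2 e]
    · simp [h1 e]
  obtain ⟨F, hF⟩ := exists_extension (C := 1) (f := glue ρ fun e t => min (ρ (Γ.src e) + t)
      (ρ (Γ.tgt e) + (Γ.len e - t))) fun e s hs t ht => by
    rw [hg e s hs, hg e t ht, one_mul]
    refine (abs_min_sub_min_le_max _ _ _ _).trans (max_le (le_of_eq (by congr 1; ring)) ?_)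
    rw [← abs_neg]
    exact le_of_eq (by congr 1; ring)
  refine ⟨‖F‖ + 1, fun e t ht => ?_⟩
  have h3 : F (Γ.pt e t) < ‖F‖ + 1 :=
    ((le_abs_self _).trans (F.norm_coe_le_norm _)).trans_lt (lt_add_one _)
  rw [hF, hg e t ht] at h3
  exact min_lt_iff.1 h3

theorem abs_sub_le_walkSum {f : Γ.Completion → ℝ} {m : Γ.Edge → ℝ}
    (h : ∀ e, |f (Point.vertex (Γ.src e) : Γ.Point) - f (Point.vertex (Γ.tgt e) : Γ.Point)| ≤ m e)
    {u v : V} (w : Γ.graph.Walk u v) :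
    |f (Point.vertex u : Γ.Point) - f (Point.vertex v : Γ.Point)| ≤ walkSum m w := by
  induction w with
  | nil => simp [walkSum]
  | @cons a b c hab w ih =>
    have hs : walkSum m (SimpleGraph.Walk.cons hab w) = extendEdge m s(a, b) + walkSum m w := by
      simp [walkSum]
    rw [hs]
    refine (_root_.abs_sub_le _ (f (Point.vertex b : Γ.Point)) _).trans (add_le_add ?_ ih)
    obtain ⟨e, he, h'⟩ := exists_edge_of_adj hab
    rw [← he, extendEdge_apply]
    rcases h' with ⟨rfl, rfl⟩ | ⟨rfl, rfl⟩
    · exact h e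
    · rw [abs_sub_comm]
      exact h e

/-- Cauchy–Schwarz along a simple path. -/
theorem walkSum_sqrt_mul_le {n : Γ.Edge → ℝ} {M : ℝ} (hM : 0 ≤ M)
    (hnM : ∀ S : Finset Γ.Edge, ∑ e ∈ S, n e ^ 2 ≤ M ^ 2) {u v : V} {w : Γ.graph.Walk u v}
    (hw : w.IsPath) : walkSum (fun e => √(Γ.len e) * n e) w ≤ √(walkSum Γ.len w) * M := by
  classical
  have hnd := hw.isTrail.edges_nodup
  have hE : ∀ x ∈ w.edges.toFinset, x ∈ Γ.graph.edgeSet := fun x hx =>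
    w.edges_subset_edgeSet (List.mem_toFinset.1 hx)
  -- A simple path uses each edge once, so the sum along it is a sum over a finite set of edges and
  -- no edge's energy is counted twice.
  have key : ∀ m : Γ.Edge → ℝ, walkSum m w =
      ∑ e ∈ w.edges.toFinset.subtype (· ∈ Γ.graph.edgeSet), m e := fun m => by
    rw [walkSum, ← List.sum_toFinset _ hnd, ← Finset.sum_subtype_of_mem _ hE]
    exact Finset.sum_congr rfl fun e _ => extendEdge_apply m e
  rw [key, key]
  refine (Real.sum_mul_le_sqrt_mul_sqrt _ _ _).trans ?_
  simp only [Real.sq_sqrt (Γ.len_pos _).le]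
  gcongr
  exact Real.sqrt_le_iff.2 ⟨hM, hnM _⟩

/-- On a graph with compact completion, the oscillation of a function is bounded by its energy. -/
theorem exists_oscillation_bound [CompactSpace Γ.Completion] (hconn : Γ.graph.Connected) :
    ∃ C : ℝ, 0 ≤ C ∧ ∀ (f : Γ.Completion → ℝ) (n : Γ.Edge → ℝ) (M : ℝ), 0 ≤ M →
      (∀ S : Finset Γ.Edge, ∑ e ∈ S, n e ^ 2 ≤ M ^ 2) →
      (∀ e, ∀ s ∈ Icc 0 (Γ.len e), ∀ t ∈ Icc 0 (Γ.len e),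
        |f (Γ.cpt e s) - f (Γ.cpt e t)| ≤ √|s - t| * n e) →
      ∀ p r : Γ.Point, |f p - f r| ≤ C * M := by
  classical
  obtain ⟨v₀⟩ := hconn.nonempty
  obtain ⟨D₀, hD₀⟩ := exists_bound_walkDist hconn v₀ (Γ := Γ)
  set D := max D₀ 0
  have hD : ∀ e, ∀ t ∈ Icc 0 (Γ.len e), walkDist (Γ := Γ) v₀ (Γ.src e) + t < D ∨
      walkDist (Γ := Γ) v₀ (Γ.tgt e) + (Γ.len e - t) < D := fun e t ht =>
    (hD₀ e t ht).imp (fun h => h.trans_le (le_max_left _ _)) fun h => h.trans_le (le_max_left _ _)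
  -- From `v₀` to any point: `√D` for reaching a vertex and `√D` for the last piece of an edge. Two
  -- points give the factor `4`.
  refine ⟨4 * √D, by positivity, fun f n M hM hnM hf => ?_⟩
  have hn : ∀ e, n e ≤ M := fun e => by
    have := hnM {e}
    rw [Finset.sum_singleton] at this
    exact le_of_sq_le_sq this hM
  have hvert : ∀ v, walkDist (Γ := Γ) v₀ v < D →
      |f (Point.vertex v₀ : Γ.Point) - f (Point.vertex v : Γ.Point)| ≤ √D * M := fun v hv => by
    have : Nonempty (Γ.graph.Walk v₀ v) := hconn.preconnected v₀ v
    obtain ⟨w, hw⟩ := exists_lt_of_ciInf_lt hv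
    -- Shortcutting the walk to a simple path does not lengthen it, and Cauchy–Schwarz is available
    -- only for simple paths.
    have hb := (walkSum_bypass_le (fun e => (Γ.len_pos e).le) w).trans hw.le
    refine (abs_sub_le_walkSum (m := fun e => √(Γ.len e) * n e) (fun e => ?_) w.bypass).trans
      ((walkSum_sqrt_mul_le hM hnM w.bypass_isPath).trans (by gcongr))
    have hl := (Γ.len_pos e).le
    have := hf e 0 ⟨le_rfl, hl⟩ (Γ.len e) ⟨hl, le_rfl⟩
    rwa [cpt, cpt, pt_zero, pt_len, zero_sub, abs_neg, abs_of_nonneg hl] at this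
  have hpt : ∀ e, ∀ t ∈ Icc 0 (Γ.len e),
      |f (Point.vertex v₀ : Γ.Point) - f (Γ.cpt e t)| ≤ 2 * √D * M := fun e t ht => by
    have hl := (Γ.len_pos e).le
    rcases hD e t ht with h | h
    · have h1 := hvert (Γ.src e) (by linarith [ht.1])
      have h2 := hf e 0 ⟨le_rfl, hl⟩ t ht
      have h3 : √|0 - t| * n e ≤ √D * M := by
        refine (mul_le_mul_of_nonneg_left (hn e) (Real.sqrt_nonneg _)).trans
          (mul_le_mul_of_nonneg_right ?_ hM)
        rw [zero_sub, abs_neg, abs_of_nonneg ht.1]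
        exact Real.sqrt_le_sqrt (by linarith [walkDist_nonneg (Γ := Γ) v₀ (Γ.src e)])
      rw [cpt, pt_zero] at h2
      exact (_root_.abs_sub_le _ _ _).trans ((add_le_add h1 (h2.trans h3)).trans_eq (by ring))
    · have h1 := hvert (Γ.tgt e) (by linarith [ht.2])
      have h2 := hf e (Γ.len e) ⟨hl, le_rfl⟩ t ht
      have h3 : √|Γ.len e - t| * n e ≤ √D * M := by
        refine (mul_le_mul_of_nonneg_left (hn e) (Real.sqrt_nonneg _)).trans
          (mul_le_mul_of_nonneg_right ?_ hM)
        rw [abs_of_nonneg (sub_nonneg.2 ht.2)]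
        exact Real.sqrt_le_sqrt (by linarith [walkDist_nonneg (Γ := Γ) v₀ (Γ.tgt e)])
      rw [cpt, pt_len] at h2
      exact (_root_.abs_sub_le _ _ _).trans ((add_le_add h1 (h2.trans h3)).trans_eq (by ring))
  have hall : ∀ p : Γ.Point, |f (Point.vertex v₀ : Γ.Point) - f p| ≤ 2 * √D * M := fun p => by
    rcases p with v | ⟨e, t, h0, h1⟩
    · by_cases hv : v = v₀
      · subst hv
        rw [sub_self, abs_zero]
        positivity
      · obtain ⟨u, hu⟩ : ∃ u, Γ.graph.Adj v u := by
          have : Nontrivial V := ⟨v, v₀, hv⟩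
          exact hconn.preconnected.exists_adj_of_nontrivial v
        obtain ⟨e, -, h | h⟩ := exists_edge_of_adj hu
        · have := hpt e 0 ⟨le_rfl, (Γ.len_pos e).le⟩
          rwa [cpt, pt_zero, h.1] at this
        · have := hpt e _ ⟨(Γ.len_pos e).le, le_rfl⟩
          rwa [cpt, pt_len, h.2] at this
    · rw [coe_inner]
      exact hpt e t ⟨h0.le, h1.le⟩
  intro p r
  have h1 := hall p
  have h2 := hall r
  rw [abs_sub_comm] at h1
  exact (_root_.abs_sub_le _ _ _).trans ((add_le_add h1 h2).trans_eq (by ring))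

/-! ### Weak derivatives and the weak Dirichlet problem -/

/-- The Lebesgue measure of the interior of an edge, in the edge coordinate. -/
noncomputable abbrev edgeVol (e : Γ.Edge) : Measure ℝ := volume.restrict (Ioo 0 (Γ.len e))

variable (Γ) in
/-- The square integrable functions on the graph, in the edge coordinates. -/
abbrev Field : Type _ := lp (fun e : Γ.Edge => Lp ℝ 2 (edgeVol e)) 2

/-- The characteristic function of an interval in an edge. -/
noncomputable def intervalL2 (e : Γ.Edge) (s t : ℝ) : Lp ℝ 2 (edgeVol e) :=
  indicatorConstLp 2 (measurableSet_Ioc (a := s) (b := t)) (measure_ne_top _ _) 1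

open Classical in
/-- The characteristic function of an interval in an edge, as a function on the graph. -/
noncomputable def intervalField (e : Γ.Edge) (s t : ℝ) : Γ.Field :=
  lp.single 2 e (intervalL2 e s t)

/-- `g` is the derivative of `f` on each edge, in the integral sense. -/
def HasWeakDeriv (f : Γ.Completion → ℝ) (g : Γ.Field) : Prop :=
  ∀ e s t, 0 ≤ s → s ≤ t → t ≤ Γ.len e →
    f (Γ.cpt e t) - f (Γ.cpt e s) = inner ℝ (intervalField e s t) g

theorem inner_intervalField (e : Γ.Edge) (s t : ℝ) (g : Γ.Field) :
    inner ℝ (intervalField e s t) g = inner ℝ (intervalL2 e s t) (g e) := by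
  classical
  exact lp.inner_single_left e _ g

theorem inner_intervalL2 (e : Γ.Edge) {s t : ℝ} (hs : 0 ≤ s) (hst : s ≤ t) (ht : t ≤ Γ.len e)
    (g : Lp ℝ 2 (edgeVol e)) : inner ℝ (intervalL2 e s t) g = ∫ x in s..t, g x := by
  have h : (edgeVol e).restrict (Ioc s t) = volume.restrict (Ioc s t) := by
    change (volume.restrict (Ioo 0 (Γ.len e))).restrict (Ioc s t) = _
    rw [Measure.restrict_congr_set (μ := volume) Ioo_ae_eq_Ioc,
      Measure.restrict_restrict measurableSet_Ioc, inter_eq_left.2 (Ioc_subset_Ioc hs ht)]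
  rw [intervalL2, L2.inner_indicatorConstLp_one, intervalIntegral.integral_of_le hst, h]

theorem HasWeakDeriv.sub_eq {f : Γ.Completion → ℝ} {g : Γ.Field} (h : HasWeakDeriv f g)
    (e : Γ.Edge) {s t : ℝ} (hs : 0 ≤ s) (hst : s ≤ t) (ht : t ≤ Γ.len e) :
    f (Γ.cpt e t) - f (Γ.cpt e s) = ∫ x in s..t, g e x := by
  rw [h e s t hs hst ht, inner_intervalField, inner_intervalL2 e hs hst ht]

theorem hasWeakDeriv_iff {f : Γ.Completion → ℝ} {g : Γ.Field} : HasWeakDeriv f g ↔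
    ∀ e s t, 0 ≤ s → s ≤ t → t ≤ Γ.len e →
      f (Γ.cpt e t) - f (Γ.cpt e s) = ∫ x in s..t, g e x :=
  forall₃_congr fun e s t => forall₃_congr fun hs hst ht => by
    rw [inner_intervalField, inner_intervalL2 e hs hst ht]

theorem HasWeakDeriv.add {f h : Γ.Completion → ℝ} {g k : Γ.Field} (hf : HasWeakDeriv f g)
    (hh : HasWeakDeriv h k) : HasWeakDeriv (fun x => f x + h x) (g + k) := fun e s t h1 h2 h3 => by
  rw [inner_add_right, ← hf e s t h1 h2 h3, ← hh e s t h1 h2 h3]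
  ring

theorem HasWeakDeriv.const_mul {f : Γ.Completion → ℝ} {g : Γ.Field} (hf : HasWeakDeriv f g)
    (c : ℝ) : HasWeakDeriv (fun x => c * f x) (c • g) := fun e s t h1 h2 h3 => by
  rw [inner_smul_right, ← hf e s t h1 h2 h3]
  ring

theorem HasWeakDeriv.sub {f h : Γ.Completion → ℝ} {g k : Γ.Field} (hf : HasWeakDeriv f g)
    (hh : HasWeakDeriv h k) : HasWeakDeriv (fun x => f x - h x) (g - k) := fun e s t h1 h2 h3 => by
  rw [inner_sub_right, ← hf e s t h1 h2 h3, ← hh e s t h1 h2 h3]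
  ring

theorem HasWeakDeriv.abs_sub_le {f : Γ.Completion → ℝ} {g : Γ.Field} (h : HasWeakDeriv f g)
    (e : Γ.Edge) {s t : ℝ} (hs : s ∈ Icc 0 (Γ.len e)) (ht : t ∈ Icc 0 (Γ.len e)) :
    |f (Γ.cpt e s) - f (Γ.cpt e t)| ≤ √|s - t| * ‖g e‖ := by
  wlog hst : s ≤ t generalizing s t
  · rw [abs_sub_comm, abs_sub_comm s]
    exact this ht hs (le_of_not_ge hst)
  rw [abs_sub_comm, abs_sub_comm s, h e s t hs.1 hst ht.2, inner_intervalField]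
  refine (abs_real_inner_le_norm _ _).trans ?_
  gcongr
  rw [intervalL2, norm_indicatorConstLp (by simp) (by simp), norm_one, one_mul,
    ENNReal.toReal_ofNat,
    ← Real.sqrt_eq_rpow, abs_of_nonneg (sub_nonneg.2 hst)]
  refine Real.sqrt_le_sqrt (ENNReal.toReal_le_of_le_ofReal (sub_nonneg.2 hst) ?_)
  rw [← Real.volume_Ioc]
  exact Measure.restrict_apply_le _ _

theorem sum_sq_norm_le (g : Γ.Field) (S : Finset Γ.Edge) : ∑ e ∈ S, ‖g e‖ ^ 2 ≤ ‖g‖ ^ 2 := by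
  have := lp.sum_rpow_le_norm_rpow (p := 2) (by simp) g S
  simpa using this

/-- The values of a function that vanishes at a point are bounded by its energy. -/
theorem exists_norm_bound [CompactSpace Γ.Completion] (hconn : Γ.graph.Connected) :
    ∃ C : ℝ, 0 ≤ C ∧ ∀ (f : C(Γ.Completion, ℝ)) (g : Γ.Field), HasWeakDeriv f g →
      (∃ x, f x = 0) → ‖f‖ ≤ C * ‖g‖ := by
  obtain ⟨C, hC0, hC⟩ := exists_oscillation_bound hconn (Γ := Γ)
  refine ⟨C, hC0, fun f g hfg hx => ?_⟩
  obtain ⟨x, hx⟩ := hx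
  have h1 := hC f (fun e => ‖g e‖) ‖g‖ (norm_nonneg _) (sum_sq_norm_le g)
    fun e s hs t ht => hfg.abs_sub_le e hs ht
  have h2 : ∀ (p : Γ.Point) (y : Γ.Completion), |f p - f y| ≤ C * ‖g‖ := fun p y =>
    denseRange_coe.induction_on (p := fun y => |f p - f y| ≤ C * ‖g‖) y
      (isClosed_le (by fun_prop) continuous_const) (h1 p)
  have h3 : ∀ z y : Γ.Completion, |f z - f y| ≤ C * ‖g‖ := fun z y =>
    denseRange_coe.induction_on (p := fun z => |f z - f y| ≤ C * ‖g‖) z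
      (isClosed_le (by fun_prop) continuous_const) fun p => h2 p y
  refine (ContinuousMap.norm_le f (by positivity)).2 fun y => ?_
  have := h3 y x
  rwa [hx, sub_zero] at this

variable (Γ) in
/-- The functions with square integrable derivative that vanish on the boundary, with their
derivatives. -/
def zeroTrace : Submodule ℝ (C(Γ.Completion, ℝ) × Γ.Field) where
  carrier := {p | HasWeakDeriv p.1 p.2 ∧ ∀ x ∈ Γ.boundary, p.1 x = 0}
  zero_mem' := ⟨fun e s t _ _ _ => by simp, fun x _ => rfl⟩
  add_mem' := fun {p r} hp hr => ⟨hp.1.add hr.1, fun x hx => by simp [hp.2 x hx, hr.2 x hx]⟩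
  smul_mem' := fun c p hp => ⟨hp.1.const_mul c, fun x hx => by simp [hp.2 x hx]⟩

theorem isClosed_zeroTrace [CompactSpace Γ.Completion] :
    IsClosed (Γ.zeroTrace : Set (C(Γ.Completion, ℝ) × Γ.Field)) := by
  have : (Γ.zeroTrace : Set (C(Γ.Completion, ℝ) × Γ.Field)) =
      (⋂ (e) (s) (t) (_ : 0 ≤ s) (_ : s ≤ t) (_ : t ≤ Γ.len e),
        {p | p.1 (Γ.cpt e t) - p.1 (Γ.cpt e s) = inner ℝ (intervalField e s t) p.2}) ∩
      ⋂ x ∈ Γ.boundary, {p | p.1 x = 0} := by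
    ext p
    simp only [mem_inter_iff, mem_iInter]
    rfl
  rw [this]
  refine IsClosed.inter ?_ ?_
  · refine isClosed_iInter fun e => isClosed_iInter fun s => isClosed_iInter fun t =>
      isClosed_iInter fun _ => isClosed_iInter fun _ => isClosed_iInter fun _ => ?_
    exact isClosed_eq (by fun_prop) (by fun_prop)
  · exact isClosed_iInter fun x => isClosed_iInter fun _ => isClosed_eq (by fun_prop) (by fun_prop)

/-- The weak Dirichlet problem is solvable. -/
theorem exists_weakSolution [CompactSpace Γ.Completion] (hconn : Γ.graph.Connected)
    (hne : Γ.boundary.Nonempty) (η : Measure Γ.Completion) [IsFiniteMeasure η]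
    {φ : C(Γ.Completion, ℝ)} {k : Γ.Field} (hφ : HasWeakDeriv φ k) :
    ∃ (u : C(Γ.Completion, ℝ)) (g : Γ.Field), HasWeakDeriv u g ∧ (∀ x ∈ Γ.boundary, u x = φ x) ∧
      ∀ (h : C(Γ.Completion, ℝ)) (m : Γ.Field), HasWeakDeriv h m → (∀ x ∈ Γ.boundary, h x = 0) →
        inner ℝ g m + ∫ x, u x * h x ∂η = 0 := by
  have := secondCountableTopology_completion (Γ := Γ)
  -- The inner product of the target pulls back along `T` to the energy form.
  let T : C(Γ.Completion, ℝ) × Γ.Field →L[ℝ] WithLp 2 (Γ.Field × Lp ℝ 2 η) :=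
    ((WithLp.prodContinuousLinearEquiv 2 ℝ Γ.Field (Lp ℝ 2 η)).symm :
      Γ.Field × Lp ℝ 2 η →L[ℝ] WithLp 2 (Γ.Field × Lp ℝ 2 η)) ∘L
    ((ContinuousLinearMap.snd ℝ _ _).prod
      (ContinuousMap.toLp 2 η ℝ ∘L ContinuousLinearMap.fst ℝ _ _))
  have hT : ∀ p r, inner ℝ (T p) (T r) = inner ℝ p.2 r.2 + ∫ x, p.1 x * r.1 x ∂η := fun p r => by
    rw [WithLp.prod_inner_apply]
    change inner ℝ p.2 r.2 +
      inner ℝ (ContinuousMap.toLp 2 η ℝ p.1) (ContinuousMap.toLp 2 η ℝ r.1) = _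
    rw [ContinuousMap.inner_toLp]
    congr 2 with x
    simp [mul_comm]
  have hT2 : ∀ p, ‖p.2‖ ≤ ‖T p‖ := fun p => by
    refine le_of_sq_le_sq ?_ (norm_nonneg _)
    rw [← real_inner_self_eq_norm_sq (T p), hT, real_inner_self_eq_norm_sq]
    have : 0 ≤ ∫ x, p.1 x * p.1 x ∂η := integral_nonneg fun x => mul_self_nonneg _
    linarith
  obtain ⟨C, hC0, hC⟩ := exists_norm_bound hconn (Γ := Γ)
  obtain ⟨x₀, hx₀⟩ := hne
  have : CompleteSpace Γ.zeroTrace := isClosed_zeroTrace.completeSpace_coe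
  let S := T ∘L Γ.zeroTrace.subtypeL
  -- Functions in `zeroTrace` vanish at `x₀`, so the energy controls their supremum as well. Hence
  -- `S` has closed range and the orthogonal projection onto it exists.
  have hS : AntilipschitzWith (Real.toNNReal (max C 1)) S := by
    refine S.antilipschitz_of_bound fun p => ?_
    rw [Real.coe_toNNReal _ (by positivity)]
    have h2 : ‖(p : C(Γ.Completion, ℝ) × Γ.Field).2‖ ≤ ‖S p‖ := hT2 p
    have h1 := hC _ _ p.2.1 ⟨x₀, p.2.2 x₀ hx₀⟩
    have h3 := le_max_left C 1
    have h4 := le_max_right C 1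
    refine max_le ?_ ?_
    · refine h1.trans (mul_le_mul h3 h2 (norm_nonneg _) (by positivity))
    · exact h2.trans (le_mul_of_one_le_left (norm_nonneg _) h4)
  let R : Submodule ℝ (WithLp 2 (Γ.Field × Lp ℝ 2 η)) :=
    LinearMap.range (S : Γ.zeroTrace →ₗ[ℝ] WithLp 2 (Γ.Field × Lp ℝ 2 η))
  have hclosed : IsClosed (R : Set (WithLp 2 (Γ.Field × Lp ℝ 2 η))) := by
    have := hS.isClosed_range S.uniformContinuous
    rwa [LinearMap.coe_range]
  have : CompleteSpace R := hclosed.completeSpace_coe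
  obtain ⟨p, hp⟩ := R.starProjection_apply_mem (T (φ, k))
  have horth := R.sub_starProjection_mem_orthogonal (T (φ, k))
  rw [← hp] at horth
  -- Subtracting an element of `zeroTrace` keeps the boundary values; orthogonality of the remainder
  -- is the weak equation.
  refine ⟨φ - p.1.1, k - p.1.2, hφ.sub p.2.1, fun x hx => ?_, fun h m hhm hh => ?_⟩
  · rw [ContinuousMap.sub_apply, p.2.2 x hx, sub_zero]
  · have h1 := (Submodule.mem_orthogonal' _ _).1 horth (T (h, m)) ⟨⟨(h, m), hhm, hh⟩, rfl⟩
    have h2 : T (φ, k) - S p = T (φ - p.1.1, k - p.1.2) := by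
      change T (φ, k) - T p.1 = _
      rw [← map_sub]
      rfl
    change inner ℝ (T (φ, k) - S p) _ = 0 at h1
    rw [h2, hT] at h1
    exact h1

/-! ### Fields and integrals in the edge coordinates -/

theorem ae_edgeVol_iff {e : Γ.Edge} {P : ℝ → Prop} :
    (∀ᵐ t ∂edgeVol e, P t) ↔ ∀ᵐ t, t ∈ Ioc 0 (Γ.len e) → P t := by
  have h : edgeVol e = volume.restrict (Ioc 0 (Γ.len e)) :=
    Measure.restrict_congr_set Ioo_ae_eq_Ioc
  rw [h, ae_restrict_iff' measurableSet_Ioc]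

theorem integral_congr_edgeVol {e : Γ.Edge} {f g : ℝ → ℝ} (h : f =ᵐ[edgeVol e] g) {s t : ℝ}
    (hs : 0 ≤ s) (hst : s ≤ t) (ht : t ≤ Γ.len e) : ∫ x in s..t, f x = ∫ x in s..t, g x := by
  refine intervalIntegral.integral_congr_ae ?_
  filter_upwards [ae_edgeVol_iff.1 h] with x hx hx'
  rw [uIoc_of_le hst] at hx'
  exact hx (Ioc_subset_Ioc hs ht hx')

theorem integral_edgeVol (e : Γ.Edge) (f : ℝ → ℝ) :
    ∫ t, f t ∂edgeVol e = ∫ t in (0)..(Γ.len e), f t := by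
  rw [intervalIntegral.integral_of_le (Γ.len_pos e).le, integral_Ioc_eq_integral_Ioo]

theorem intervalIntegrable_iff_edgeVol {e : Γ.Edge} {f : ℝ → ℝ} :
    IntervalIntegrable f volume 0 (Γ.len e) ↔ Integrable f (edgeVol e) := by
  rw [intervalIntegrable_iff_integrableOn_Ioo_of_le (Γ.len_pos e).le]
  rfl

theorem inner_field (g k : Γ.Field) (e : Γ.Edge) :
    inner ℝ (g e) (k e) = ∫ t in (0)..(Γ.len e), g e t * k e t := by
  rw [L2.inner_def, ← integral_edgeVol]
  refine integral_congr_ae (ae_of_all _ fun t => ?_)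
  simp [mul_comm]

theorem hasSum_inner_field (g k : Γ.Field) :
    HasSum (fun e => ∫ t in (0)..(Γ.len e), g e t * k e t) (inner ℝ g k) := by
  simpa only [inner_field] using lp.hasSum_inner (𝕜 := ℝ) g k

theorem exists_field {g : Γ.Edge → ℝ → ℝ} (hg : ∀ e, MemLp (g e) 2 (edgeVol e))
    (hs : Summable fun e => ‖(hg e).toLp‖ ^ 2) :
    ∃ G : Γ.Field, ∀ e, G e = (hg e).toLp :=
  ⟨⟨fun e => (hg e).toLp, memℓp_gen (by simpa using hs)⟩, fun _ => rfl⟩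

theorem exists_field_of_finite {g : Γ.Edge → ℝ → ℝ} (hg : ∀ e, MemLp (g e) 2 (edgeVol e))
    {S : Set Γ.Edge} (hS : S.Finite) (h0 : ∀ e ∉ S, ∀ t ∈ Ioo 0 (Γ.len e), g e t = 0) :
    ∃ G : Γ.Field, ∀ e, G e =ᵐ[edgeVol e] g e := by
  obtain ⟨G, hG⟩ := exists_field hg (summable_of_ne_finset_zero (s := hS.toFinset) fun e he => by
    have : (hg e).toLp = 0 := by
      refine Lp.ext ?_
      filter_upwards [(hg e).coeFn_toLp, Lp.coeFn_zero ℝ 2 (edgeVol e),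
        ae_restrict_mem measurableSet_Ioo] with t h1 h2 ht
      rw [h1, h2, h0 e (by simpa using he) t ht]
      rfl
    rw [this, norm_zero, zero_pow two_ne_zero])
  exact ⟨G, fun e => hG e ▸ (hg e).coeFn_toLp⟩

theorem exists_field_of_abs_le {g : Γ.Edge → ℝ → ℝ} {k : Γ.Field}
    (hg : ∀ e, AEStronglyMeasurable (g e) (edgeVol e))
    (hk : ∀ e, ∀ᵐ t ∂edgeVol e, |g e t| ≤ |k e t|) :
    ∃ G : Γ.Field, (∀ e, G e =ᵐ[edgeVol e] g e) ∧ ‖G‖ ≤ ‖k‖ := by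
  have hm : ∀ e, MemLp (g e) 2 (edgeVol e) := fun e =>
    (Lp.memLp (k e)).mono (hg e) (hk e)
  have hle : ∀ e, ‖(hm e).toLp‖ ^ 2 ≤ ‖k e‖ ^ 2 := fun e => by
    gcongr
    refine Lp.norm_le_norm_of_ae_le ?_
    filter_upwards [(hm e).coeFn_toLp, hk e] with t h1 h2
    rw [h1]
    exact h2
  have hks : HasSum (fun e => ‖k e‖ ^ 2) (‖k‖ ^ 2) := by
    have := lp.hasSum_inner (𝕜 := ℝ) k k
    simpa only [real_inner_self_eq_norm_sq] using this
  obtain ⟨G, hG⟩ := exists_field hm (.of_nonneg_of_le (fun e => by positivity) hle hks.summable)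
  refine ⟨G, fun e => hG e ▸ (hm e).coeFn_toLp, ?_⟩
  have hGs : HasSum (fun e => ‖G e‖ ^ 2) (‖G‖ ^ 2) := by
    have := lp.hasSum_inner (𝕜 := ℝ) G G
    simpa only [real_inner_self_eq_norm_sq] using this
  refine le_of_sq_le_sq (hasSum_le (fun e => ?_) hGs hks) (norm_nonneg _)
  rw [hG e]
  exact hle e

open scoped ContDiff in
/-- Eventually flat functions have a square integrable derivative. -/
theorem IsEventuallyFlat.exists_hasWeakDeriv {φ : Γ.Completion → ℝ} (hφ : Γ.IsEventuallyFlat φ) :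
    ∃ k : Γ.Field, HasWeakDeriv φ k ∧ ∀ e, k e =ᵐ[edgeVol e] deriv (edgeFun φ e) := by
  have hc : ∀ e, Continuous (deriv (edgeFun φ e)) := fun e =>
    (hφ.contDiff e).continuous_deriv (by simp)
  have hm : ∀ e, MemLp (deriv (edgeFun φ e)) 2 (edgeVol e) := fun e => by
    obtain ⟨C, hC⟩ := isCompact_Icc.exists_bound_of_continuousOn (s := Icc 0 (Γ.len e))
      (hc e).continuousOn
    refine MemLp.of_bound (hc e).aestronglyMeasurable C ?_
    filter_upwards [ae_restrict_mem measurableSet_Ioo] with t ht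
    exact hC t (Ioo_subset_Icc_self ht)
  obtain ⟨k, hk⟩ := exists_field_of_finite hm hφ.finite fun e he t ht => by
    by_contra h
    exact he ⟨t, ht, h⟩
  refine ⟨k, hasWeakDeriv_iff.2 fun e s t hs hst ht => ?_, hk⟩
  rw [integral_congr_edgeVol (hk e) hs hst ht, intervalIntegral.integral_deriv_eq_sub
    (fun x _ => ((hφ.contDiff e).differentiable (by simp)).differentiableAt)
    ((hc e).intervalIntegrable _ _)]
  rfl

/-! ### Piecewise linear functions -/

theorem inner_intervalL2_zero_left {e : Γ.Edge} {s t a : ℝ} (hs : 0 ≤ s) (hst : s ≤ t)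
    (ht : t ≤ Γ.len e) :
    inner ℝ (intervalL2 e s t) (intervalL2 e 0 a) = min t a - min s a := by
  have h : (edgeVol e).restrict (Ioc s t ∩ Ioc 0 a) =
      volume.restrict (Ioc s (min t a)) := by
    have h1 : edgeVol e = volume.restrict (Ioc 0 (Γ.len e)) :=
      Measure.restrict_congr_set Ioo_ae_eq_Ioc
    rw [h1, Measure.restrict_restrict (measurableSet_Ioc.inter measurableSet_Ioc), Ioc_inter_Ioc,
      Ioc_inter_Ioc, max_eq_left hs, max_eq_left hs, min_eq_left ((min_le_left _ _).trans ht)]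
  have h2 : (edgeVol e).real (Ioc s t ∩ Ioc 0 a) = volume.real (Ioc s (min t a)) := by
    have := congrArg (fun μ : Measure ℝ => μ univ) h
    simp only [Measure.restrict_apply_univ] at this
    rw [measureReal_def, measureReal_def, this]
  rw [intervalL2, intervalL2, L2.real_inner_indicatorConstLp_one_indicatorConstLp_one, h2,
    Real.volume_real_Ioc]
  rcases le_total s a with h | h
  · rw [min_eq_left h, max_eq_left (sub_nonneg.2 (le_min hst h))]
  · rw [min_eq_right h, min_eq_right (h.trans hst), max_eq_right (by linarith), sub_self]

theorem intervalField_apply_self (e : Γ.Edge) (s t : ℝ) :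
    intervalField e s t e = intervalL2 e s t := by
  classical
  exact lp.single_apply_self 2 e _

theorem intervalField_apply_ne {e e' : Γ.Edge} (h : e' ≠ e) (s t : ℝ) :
    intervalField e s t e' = 0 := by
  classical
  exact lp.single_apply_ne 2 e _ h

theorem inner_intervalField_zero_left {e : Γ.Edge} {s t a : ℝ} (hs : 0 ≤ s) (hst : s ≤ t)
    (ht : t ≤ Γ.len e) :
    inner ℝ (intervalField e s t) (intervalField e 0 a) = min t a - min s a := by
  rw [inner_intervalField, intervalField_apply_self, inner_intervalL2_zero_left hs hst ht]

theorem inner_intervalField_of_ne {e e' : Γ.Edge} (h : e ≠ e') (s t a b : ℝ) :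
    inner ℝ (intervalField e s t) (intervalField e' a b) = 0 := by
  rw [inner_intervalField, intervalField_apply_ne h, inner_zero_right]

/-- The tent on the edge `e` with its top at `a`. -/
theorem exists_innerTent (e : Γ.Edge) {a : ℝ} (ha : a ∈ Icc 0 (Γ.len e)) :
    ∃ h : C(Γ.Completion, ℝ), (∀ x ∈ Γ.boundary, h x = 0) ∧
      (∀ t ∈ Icc 0 (Γ.len e), h (Γ.cpt e t) = a / Γ.len e * (Γ.len e - t) - max (a - t) 0) ∧
      (∀ e', e' ≠ e → ∀ t, h (Γ.cpt e' t) = 0) ∧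
      HasWeakDeriv h (intervalField e 0 a - (a / Γ.len e) • intervalField e 0 (Γ.len e)) := by
  have hl := Γ.len_pos e
  have ha1 : a / Γ.len e ≤ 1 := (div_le_one hl).2 ha.2
  have ha0 : 0 ≤ a / Γ.len e := div_nonneg ha.1 hl.le
  -- This is the Green function of `-d²/dt²` on the edge with pole `a`: slope `1 - a / len e` before
  -- `a` and `-a / len e` after. Each of its two terms is `1`-Lipschitz, whence `C = 2`.
  obtain ⟨h, -, h1, h2, h3⟩ := exists_edgeBump e
    (g := fun t => a / Γ.len e * (Γ.len e - t) - max (a - t) 0) (C := 2)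
    (by rw [sub_zero, div_mul_cancel₀ _ hl.ne', sub_zero, max_eq_left ha.1, sub_self])
    (by rw [sub_self, mul_zero, max_eq_right (by linarith [ha.2]), sub_self]) (by norm_num)
    fun s _ t _ => by
      have h1 : |max (a - s) 0 - max (a - t) 0| ≤ |s - t| := by
        refine (abs_max_sub_max_le_abs _ _ _).trans (le_of_eq ?_)
        rw [← abs_neg]
        congr 1
        ring
      have h2 : |a / Γ.len e * (Γ.len e - s) - a / Γ.len e * (Γ.len e - t)| ≤ |s - t| := by
        rw [← mul_sub, abs_mul, abs_of_nonneg ha0, sub_sub_sub_cancel_left, abs_sub_comm]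
        exact mul_le_of_le_one_left (abs_nonneg _) ha1
      rw [sub_sub_sub_comm]
      exact (abs_sub _ _).trans (by linarith)
  refine ⟨h, h3, h1, h2, fun e' s t hs hst ht => ?_⟩
  rw [inner_sub_right, inner_smul_right]
  by_cases he : e' = e
  · subst he
    rw [inner_intervalField_zero_left hs hst ht, inner_intervalField_zero_left hs hst ht,
      h1 t ⟨hs.trans hst, ht⟩, h1 s ⟨hs, hst.trans ht⟩, min_eq_left ht, min_eq_left (hst.trans ht)]
    have key : ∀ r, max (a - r) 0 = a - min r a := fun r => by
      rcases le_total r a with h | h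
      · rw [min_eq_left h, max_eq_left (by linarith)]
      · rw [min_eq_right h, max_eq_right (by linarith), sub_self]
    rw [key, key]
    ring
  · rw [h2 e' he, h2 e' he, inner_intervalField_of_ne he, inner_intervalField_of_ne he]
    simp

open Classical in
/-- The slope of the tent function of `v` on the edge `e`. -/
noncomputable def tentSlope (v : V) (e : Γ.Edge) : ℝ :=
  (if Γ.tgt e = v then 1 / Γ.len e else 0) - if Γ.src e = v then 1 / Γ.len e else 0

theorem tentSlope_of_notMem {v : V} {e : Γ.Edge} (h : v ∉ e.1) : tentSlope v e = 0 := by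
  rw [mem_edge_iff, not_or] at h
  simp [tentSlope, Ne.symm h.1, Ne.symm h.2]

theorem edgeTent_sub (v : V) (e : Γ.Edge) (s t : ℝ) :
    edgeTent v e t - edgeTent v e s = tentSlope v e * (t - s) := by
  unfold edgeTent tentSlope
  split_ifs <;> ring

theorem hasWeakDeriv_vertexTent (hfin : ∀ v, (Γ.graph.neighborSet v).Finite) (v : V) :
    HasWeakDeriv (vertexTent hfin v)
      (∑ e ∈ (finite_incident hfin v).toFinset, tentSlope v e • intervalField e 0 (Γ.len e)) := by
  intro e s t hs hst ht
  rw [vertexTent_cpt hfin v e ⟨hs.trans hst, ht⟩, vertexTent_cpt hfin v e ⟨hs, hst.trans ht⟩,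
    edgeTent_sub, inner_sum]
  have h0 : ∀ e', e' ≠ e →
      inner ℝ (intervalField e s t) (tentSlope v e' • intervalField e' 0 (Γ.len e')) = 0 :=
    fun e' he' => by rw [inner_smul_right, inner_intervalField_of_ne he'.symm, mul_zero]
  rw [Finset.sum_eq_single e (fun e' _ he' => h0 e' he') fun he => ?_]
  · rw [inner_smul_right, inner_intervalField_zero_left hs hst ht, min_eq_left ht,
      min_eq_left (hst.trans ht)]
  · rw [tentSlope_of_notMem (by simpa using he), zero_smul, inner_zero_right]

/-! ### The measure of a potential -/

/-- The measure `q dx` on the completion. -/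
noncomputable def potentialMeasure (q : Γ.Point → ℝ) : Measure Γ.Completion :=
  Measure.sum fun e =>
    ((edgeVol e).withDensity fun t => ENNReal.ofReal (Γ.onEdge q e t)).map (Γ.cpt e)

/-- Viewing `q dx` as a finite measure on the completion makes the zeroth order term of the energy
an `L²` inner product, the form in which `exists_weakSolution` takes it. -/
theorem isFiniteMeasure_potentialMeasure {q : Γ.Point → ℝ} (hq0 : ∀ p, 0 ≤ q p)
    (hq1 : Γ.GraphIntegrable (Γ.onEdge q)) : IsFiniteMeasure (potentialMeasure q) := by
  constructor
  rw [potentialMeasure, Measure.sum_apply _ MeasurableSet.univ]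
  have h : ∀ e, (((edgeVol e).withDensity fun t => ENNReal.ofReal (Γ.onEdge q e t)).map
      (Γ.cpt e)) univ = ENNReal.ofReal (∫ t in Ioo 0 (Γ.len e), |Γ.onEdge q e t|) := fun e => by
    rw [Measure.map_apply (continuous_cpt e).measurable MeasurableSet.univ, preimage_univ,
      withDensity_apply _ MeasurableSet.univ, Measure.restrict_univ,
      ← ofReal_integral_eq_lintegral_ofReal (hq1.1 e) (ae_of_all _ fun t => hq0 _)]
    congr 1
    refine integral_congr_ae (ae_of_all _ fun t => ?_)
    exact (abs_of_nonneg (hq0 _)).symm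
  simp only [h]
  rw [← ENNReal.ofReal_tsum_of_nonneg (fun e => integral_nonneg fun t => abs_nonneg _) hq1.2]
  exact ENNReal.ofReal_lt_top

theorem hasSum_integral_potentialMeasure [CompactSpace Γ.Completion] {q : Γ.Point → ℝ}
    (hq0 : ∀ p, 0 ≤ q p) (hq1 : Γ.GraphIntegrable (Γ.onEdge q)) {F : Γ.Completion → ℝ}
    (hF : Continuous F) :
    HasSum (fun e => ∫ t in (0)..(Γ.len e), Γ.onEdge q e t * F (Γ.cpt e t))
      (∫ x, F x ∂potentialMeasure q) := by
  have := isFiniteMeasure_potentialMeasure hq0 hq1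
  have := secondCountableTopology_completion (Γ := Γ)
  have hint : Integrable F (potentialMeasure q) :=
    hF.integrable_of_hasCompactSupport (HasCompactSupport.of_compactSpace F)
  have key : ∀ e, ∫ t in (0)..(Γ.len e), Γ.onEdge q e t * F (Γ.cpt e t) =
      ∫ x, F x ∂((edgeVol e).withDensity fun t => ENNReal.ofReal (Γ.onEdge q e t)).map
        (Γ.cpt e) := fun e => by
    rw [integral_map (continuous_cpt e).aemeasurable hF.aestronglyMeasurable,
      integral_withDensity_eq_integral_toReal_smul₀ (hq1.1 e).aemeasurable.ennreal_ofReal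
        (ae_of_all _ fun t => ENNReal.ofReal_lt_top), integral_edgeVol]
    refine intervalIntegral.integral_congr fun t _ => ?_
    simp only [smul_eq_mul]
    rw [ENNReal.toReal_ofReal (show 0 ≤ Γ.onEdge q e t from hq0 _)]
  simp only [key]
  exact hasSum_integral_measure hint

end MetricGraph

/-! ### Calculus on an interval -/

theorem AbsolutelyContinuousOnInterval.congr_on {f g : ℝ → ℝ} {a b : ℝ}
    (hf : AbsolutelyContinuousOnInterval f a b) (h : EqOn f g (uIcc a b)) :
    AbsolutelyContinuousOnInterval g a b := by
  rw [absolutelyContinuousOnInterval_iff] at hf ⊢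
  intro ε hε
  obtain ⟨δ, hδ, H⟩ := hf ε hε
  refine ⟨δ, hδ, fun E hE hlt => ?_⟩
  convert H E hE hlt using 1
  refine Finset.sum_congr rfl fun i hi => ?_
  have := hE.1 i hi
  rw [h this.1, h this.2]

/-- Repeated integration. -/
theorem integral_mul_sub_eq_integral_integral {Q : ℝ → ℝ} {a : ℝ}
    (hQ : IntervalIntegrable Q volume 0 a) :
    ∫ s in (0)..a, Q s * (a - s) = ∫ s in (0)..a, ∫ r in (0)..s, Q r := by
  have hP := hQ.absolutelyContinuousOnInterval_intervalIntegral (c := 0) left_mem_uIcc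
  have hf : AbsolutelyContinuousOnInterval (fun s : ℝ => a - s) 0 a :=
    (contDiff_const.sub contDiff_id).contDiffOn.absolutelyContinuousOnInterval
  have h := hf.integral_mul_deriv_eq_deriv_mul hP
  have h1 : ∫ s in (0)..a, Q s * (a - s) =
      ∫ s in (0)..a, (a - s) * deriv (fun x => ∫ r in (0)..x, Q r) s := by
    refine intervalIntegral.integral_congr_ae ?_
    filter_upwards [hQ.ae_hasDerivAt_integral] with s hs hs'
    rw [(hs (uIoc_subset_uIcc hs') 0 left_mem_uIcc).deriv, mul_comm]
  have h2 : ∀ s : ℝ, deriv (fun s : ℝ => a - s) s = -1 := fun s => by simp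
  rw [h1, h]
  simp [h2]

/-- Integration against a tent. -/
theorem integral_mul_tent {Q : ℝ → ℝ} {a l : ℝ} (hl : 0 < l) (ha : a ∈ Icc 0 l)
    (hQ : IntervalIntegrable Q volume 0 l) :
    ∫ s in (0)..l, Q s * (a / l * (l - s) - max (a - s) 0) =
      a / l * (∫ s in (0)..l, ∫ r in (0)..s, Q r) - ∫ s in (0)..a, ∫ r in (0)..s, Q r := by
  have hsub : uIcc 0 a ⊆ uIcc 0 l := by
    rw [uIcc_of_le ha.1, uIcc_of_le hl.le]
    exact Icc_subset_Icc_right ha.2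
  have hsub' : uIcc a l ⊆ uIcc 0 l := by
    rw [uIcc_of_le ha.2, uIcc_of_le hl.le]
    exact Icc_subset_Icc_left ha.1
  have hQa := hQ.mono_set hsub
  have hm : IntervalIntegrable (fun s => Q s * max (a - s) 0) volume 0 l :=
    hQ.mul_continuousOn (by fun_prop)
  have h1 : ∫ s in (0)..l, Q s * max (a - s) 0 = ∫ s in (0)..a, Q s * (a - s) := by
    rw [← intervalIntegral.integral_add_adjacent_intervals (hm.mono_set hsub) (hm.mono_set hsub')]
    have h2 : ∫ s in a..l, Q s * max (a - s) 0 = ∫ s in a..l, (0 : ℝ) := by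
      refine intervalIntegral.integral_congr fun s hs => ?_
      rw [uIcc_of_le ha.2] at hs
      simp [max_eq_right (sub_nonpos.2 hs.1)]
    have h3 : ∫ s in (0)..a, Q s * max (a - s) 0 = ∫ s in (0)..a, Q s * (a - s) := by
      refine intervalIntegral.integral_congr fun s hs => ?_
      rw [uIcc_of_le ha.1] at hs
      simp [max_eq_left (sub_nonneg.2 hs.2)]
    rw [h2, h3, intervalIntegral.integral_zero, add_zero]
  rw [← integral_mul_sub_eq_integral_integral hQ, ← integral_mul_sub_eq_integral_integral hQa, ← h1,
    ← intervalIntegral.integral_const_mul, ← intervalIntegral.integral_sub _ hm]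
  · refine intervalIntegral.integral_congr fun s _ => ?_
    ring
  · exact (hQ.mul_continuousOn (by fun_prop)).const_mul _

/-- A function that solves `u'' = Q` in the integrated sense is continuously differentiable. -/
theorem exists_deriv_of_integral_eq {Q u : ℝ → ℝ} {l c : ℝ} (hl : 0 < l)
    (hQ : IntervalIntegrable Q volume 0 l)
    (hu : ∀ t ∈ Icc 0 l, u t = u 0 + (∫ s in (0)..t, ∫ r in (0)..s, Q r) + c * t) :
    ∃ p : ℝ → ℝ, Continuous p ∧ (∀ t ∈ Icc 0 l, p t = c + ∫ r in (0)..t, Q r) ∧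
      (∀ t ∈ Icc 0 l, HasDerivWithinAt u (p t) (Icc 0 l) t) ∧
      AbsolutelyContinuousOnInterval p 0 l ∧
      ∀ᵐ t, t ∈ Icc 0 l → HasDerivAt p (Q t) t := by
  -- Extended by zero, `Q` has a primitive that is continuous on all of `ℝ`, so the two-sided
  -- fundamental theorem applies even at the ends.
  set Q' : ℝ → ℝ := (Ioc 0 l).indicator Q with hQ'
  have hQi : Integrable Q' := by
    rw [hQ', integrable_indicator_iff measurableSet_Ioc,
      ← intervalIntegrable_iff_integrableOn_Ioc_of_le hl.le]
    exact hQ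
  have hQQ : ∀ t ∈ Icc 0 l, ∫ r in (0)..t, Q' r = ∫ r in (0)..t, Q r := fun t ht => by
    refine intervalIntegral.integral_congr_ae (ae_of_all _ fun r hr => ?_)
    rw [uIoc_of_le ht.1] at hr
    exact indicator_of_mem (Ioc_subset_Ioc_right ht.2 hr) Q
  have hcont : Continuous fun t => c + ∫ r in (0)..t, Q' r :=
    continuous_const.add (intervalIntegral.continuous_primitive
      (fun a b => hQi.intervalIntegrable) 0)
  have hac := hQ.absolutelyContinuousOnInterval_intervalIntegral (c := 0) left_mem_uIcc
  have hconst : AbsolutelyContinuousOnInterval (fun _ : ℝ => c) 0 l :=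
    ((LipschitzWith.const c).lipschitzOnWith).absolutelyContinuousOnInterval
  refine ⟨_, hcont, fun t ht => by rw [hQQ t ht], fun t ht => ?_, ?_, ?_⟩
  · have h1 : HasDerivAt (fun t => u 0 + ∫ s in (0)..t, c + ∫ r in (0)..s, Q' r)
        (c + ∫ r in (0)..t, Q' r) t :=
      (intervalIntegral.integral_hasDerivAt_right (hcont.intervalIntegrable _ _)
        hcont.stronglyMeasurable.stronglyMeasurableAtFilter hcont.continuousAt).const_add _
    refine h1.hasDerivWithinAt.congr_of_mem (fun s hs => ?_) ht
    have h2 : ∫ r in (0)..s, c + ∫ x in (0)..r, Q' x = ∫ r in (0)..s, c + ∫ x in (0)..r, Q x := by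
      refine intervalIntegral.integral_congr fun r hr => ?_
      rw [uIcc_of_le hs.1] at hr
      rw [hQQ r ⟨hr.1, hr.2.trans hs.2⟩]
    have h3 : IntervalIntegrable (fun r => ∫ x in (0)..r, Q x) volume 0 s := by
      refine ContinuousOn.intervalIntegrable (hac.continuousOn.mono ?_)
      rw [uIcc_of_le hs.1, uIcc_of_le hl.le]
      exact Icc_subset_Icc_right hs.2
    rw [hu s hs, h2, intervalIntegral.integral_add (by simp) h3]
    simp only [intervalIntegral.integral_const, smul_eq_mul]
    ring
  · refine (hconst.add hac).congr_on fun t ht => ?_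
    rw [uIcc_of_le hl.le] at ht
    change c + _ = c + _
    rw [hQQ t ht]
  -- The point `0` is discarded because `Q'` agrees with `Q` only on the half-open interval.
  · have h0 : ∀ᵐ t : ℝ, t ≠ 0 := by simp [ae_iff, measure_singleton]
    filter_upwards [LocallyIntegrable.ae_hasDerivAt_integral hQi.locallyIntegrable, h0]
      with t ht ht0 hmem
    have := (ht 0).const_add c
    rwa [hQ', indicator_of_mem (show t ∈ Ioc 0 l from
      ⟨lt_of_le_of_ne hmem.1 ht0.symm, hmem.2⟩)] at this

/-- If `w'' = r` and `r ≥ 0` where `w > 0`, then `w` is constant to the right of a critical point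
where it has a positive maximum. -/
theorem eq_of_max_of_deriv_eq_zero_left {w p r : ℝ → ℝ} {a b M : ℝ} (hM : 0 < M)
    (hw : ∀ t ∈ Icc a b, HasDerivWithinAt w (p t) (Icc a b) t)
    (hp : ∀ s t, a ≤ s → s ≤ t → t ≤ b → p t - p s = ∫ x in s..t, r x)
    (hr : ∀ t ∈ Icc a b, 0 < w t → 0 ≤ r t) (hmax : ∀ t ∈ Icc a b, w t ≤ M)
    (hwa : w a = M) (hpa : p a = 0) : ∀ t ∈ Icc a b, w t = M := by
  have hwc : ContinuousOn w (Icc a b) := fun t ht => (hw t ht).continuousWithinAt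
  have hd : ∀ t ∈ Ioo a b, HasDerivAt w (p t) t := fun t ht =>
    (hw t (Ioo_subset_Icc_self ht)).hasDerivAt (Icc_mem_nhds ht.1 ht.2)
  -- Continuous induction: a point where `w = M` is critical, and `w` stays positive just to its
  -- right, so there `p` starts at `0` and is nonnegative; `w` is nondecreasing and cannot leave its
  -- maximum.
  refine IsClosed.Icc_subset_of_forall_exists_gt (s := {t | w t = M}) ?_ hwa ?_
  · rw [inter_comm]
    exact hwc.preimage_isClosed_of_isClosed isClosed_Icc isClosed_singleton
  · rintro x ⟨hxM, hx⟩ y hy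
    have hxM' : w x = M := hxM
    have hxy : x < y := hy
    have hxI : x ∈ Icc a b := Ico_subset_Icc_self hx
    have hpx : p x = 0 := by
      rcases hx.1.eq_or_lt with rfl | h
      · exact hpa
      · refine IsLocalMax.hasDerivAt_eq_zero ?_ (hd x ⟨h, hx.2⟩)
        filter_upwards [Icc_mem_nhds h hx.2] with t ht
        rw [hxM']
        exact hmax t ht
    have hpos : ∀ᶠ t in 𝓝[Icc a b] x, 0 < w t :=
      (hwc x hxI).eventually (lt_mem_nhds (hxM' ▸ hM))
    obtain ⟨δ, hδ, hδw⟩ := Metric.mem_nhdsWithin_iff.1 hpos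
    set z := min y (min (x + δ / 2) b) with hz
    have hxz : x < z := lt_min hxy (lt_min (by linarith) hx.2)
    have hzb : z ≤ b := (min_le_right _ _).trans (min_le_right _ _)
    have hzδ : z ≤ x + δ / 2 := (min_le_right _ _).trans (min_le_left _ _)
    have hwpos : ∀ t ∈ Icc x z, 0 < w t := fun t ht =>
      hδw ⟨by rw [Metric.mem_ball, Real.dist_eq, abs_of_nonneg (by linarith [ht.1])]
              linarith [ht.2], hx.1.trans ht.1, ht.2.trans hzb⟩
    have hppos : ∀ t ∈ Icc x z, 0 ≤ p t := fun t ht => by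
      have h := hp x t hx.1 ht.1 (ht.2.trans hzb)
      rw [hpx, sub_zero] at h
      rw [h]
      exact intervalIntegral.integral_nonneg ht.1 fun s hs =>
        hr s ⟨hx.1.trans hs.1, hs.2.trans (ht.2.trans hzb)⟩ (hwpos s ⟨hs.1, hs.2.trans ht.2⟩)
    have hsub : Ioo x z ⊆ Ioo a b := Ioo_subset_Ioo hx.1 hzb
    have hmono : MonotoneOn w (Icc x z) := by
      refine monotoneOn_of_deriv_nonneg (convex_Icc x z) (hwc.mono (Icc_subset_Icc hx.1 hzb)) ?_ ?_
      · rw [interior_Icc]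
        exact fun t ht => (hd t (hsub ht)).differentiableAt.differentiableWithinAt
      · rw [interior_Icc]
        intro t ht
        rw [(hd t (hsub ht)).deriv]
        exact hppos t (Ioo_subset_Icc_self ht)
    refine ⟨z, le_antisymm (hmax z ⟨hx.1.trans hxz.le, hzb⟩) ?_, hxz, min_le_left _ _⟩
    have := hmono ⟨le_rfl, hxz.le⟩ ⟨hxz.le, le_rfl⟩ hxz.le
    rwa [hxM'] at this

/-- If `w'' = r` and `r ≥ 0` where `w > 0`, then `w` is constant if it has a critical point where
it has a positive maximum. -/
theorem eq_of_max_of_deriv_eq_zero {w p r : ℝ → ℝ} {a b c M : ℝ} (hc : c ∈ Icc a b) (hM : 0 < M)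
    (hw : ∀ t ∈ Icc a b, HasDerivWithinAt w (p t) (Icc a b) t)
    (hp : ∀ s t, a ≤ s → s ≤ t → t ≤ b → p t - p s = ∫ x in s..t, r x)
    (hr : ∀ t ∈ Icc a b, 0 < w t → 0 ≤ r t) (hmax : ∀ t ∈ Icc a b, w t ≤ M)
    (hwc : w c = M) (hpc : p c = 0) : ∀ t ∈ Icc a b, w t = M := by
  intro t ht
  rcases le_total c t with h | h
  · have hsub : ∀ s ∈ Icc c b, s ∈ Icc a b := fun s hs => ⟨hc.1.trans hs.1, hs.2⟩
    exact eq_of_max_of_deriv_eq_zero_left hM (fun s hs => (hw s (hsub s hs)).mono hsub)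
      (fun s s' h1 h2 h3 => hp s s' (hc.1.trans h1) h2 h3) (fun s hs => hr s (hsub s hs))
      (fun s hs => hmax s (hsub s hs)) hwc hpc t ⟨h, ht.2⟩
  · have hsub : ∀ s ∈ Icc (-c) (-a), -s ∈ Icc a b := fun s hs =>
      ⟨by linarith [hs.2], by linarith [hs.1, hc.2]⟩
    -- The part left of `c` is the reflection of the right-hand case: the first derivative changes
    -- sign, the second does not.
    have key := eq_of_max_of_deriv_eq_zero_left (w := fun s => w (-s)) (p := fun s => -p (-s))
      (r := fun s => r (-s)) (a := -c) (b := -a) hM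
      (fun s hs => by
        have := (hw (-s) (hsub s hs)).comp s (hasDerivAt_neg s).hasDerivWithinAt hsub
        simpa only [Function.comp_def, mul_neg, mul_one] using this)
      (fun s s' h1 h2 h3 => by
        rw [intervalIntegral.integral_comp_neg, ← hp (-s') (-s) (by linarith) (by linarith)
          (by linarith [hc.2])]
        ring)
      (fun s hs => hr (-s) (hsub s hs)) (fun s hs => hmax (-s) (hsub s hs)) (by simpa using hwc)
      (by simpa using hpc) (-t) ⟨by linarith, by linarith [ht.1]⟩
    simpa using key

namespace MetricGraph

variable {V : Type*} {Γ : MetricGraph V}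

/-! ### Weak solutions are harmonic -/

/-- The function `q u` on an edge. -/
noncomputable def source (q : Γ.Point → ℝ) (u : Γ.Completion → ℝ) (e : Γ.Edge) (t : ℝ) : ℝ :=
  Γ.onEdge q e t * edgeFun u e t

theorem intervalIntegrable_source {q : Γ.Point → ℝ} (hq1 : Γ.GraphIntegrable (Γ.onEdge q))
    {u : Γ.Completion → ℝ} (hu : Continuous u) (e : Γ.Edge) :
    IntervalIntegrable (source q u e) volume 0 (Γ.len e) :=
  (intervalIntegrable_iff_edgeVol.2 (hq1.1 e)).mul_continuousOn
    (continuous_edgeFun hu e).continuousOn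

theorem integral_potentialMeasure_eq_sum [CompactSpace Γ.Completion] {q : Γ.Point → ℝ}
    (hq0 : ∀ p, 0 ≤ q p) (hq1 : Γ.GraphIntegrable (Γ.onEdge q)) {u h : Γ.Completion → ℝ}
    (hu : Continuous u) (hh : Continuous h) {S : Finset Γ.Edge}
    (hS : ∀ e ∉ S, ∀ t ∈ Icc 0 (Γ.len e), h (Γ.cpt e t) = 0) :
    ∫ x, u x * h x ∂potentialMeasure q =
      ∑ e ∈ S, ∫ t in (0)..(Γ.len e), source q u e t * h (Γ.cpt e t) := by
  have h1 := hasSum_integral_potentialMeasure hq0 hq1 (F := fun x => u x * h x) (hu.mul hh)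
  refine h1.unique ?_
  have h2 : ∀ e, ∫ t in (0)..(Γ.len e), Γ.onEdge q e t * (u (Γ.cpt e t) * h (Γ.cpt e t)) =
      ∫ t in (0)..(Γ.len e), source q u e t * h (Γ.cpt e t) := fun e => by
    simp only [source, edgeFun_apply, mul_assoc]
  simp only [h2]
  refine hasSum_sum_of_ne_finset_zero fun e he => ?_
  have h3 : ∫ t in (0)..(Γ.len e), source q u e t * h (Γ.cpt e t) =
      ∫ t in (0)..(Γ.len e), (0 : ℝ) := by
    refine intervalIntegral.integral_congr fun t ht => ?_
    rw [uIcc_of_le (Γ.len_pos e).le] at ht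
    simp [hS e he t ht]
  rw [h3, intervalIntegral.integral_zero]

variable (Γ) in
/-- The weak form of the equation `u'' = q u`, with the Kirchhoff conditions. -/
def IsWeakSolution (q : Γ.Point → ℝ) (u : C(Γ.Completion, ℝ)) (g : Γ.Field) : Prop :=
  HasWeakDeriv u g ∧ ∀ (h : C(Γ.Completion, ℝ)) (m : Γ.Field), HasWeakDeriv h m →
    (∀ x ∈ Γ.boundary, h x = 0) → inner ℝ g m + ∫ x, u x * h x ∂potentialMeasure q = 0

section

variable [CompactSpace Γ.Completion] {q : Γ.Point → ℝ} (hq0 : ∀ p, 0 ≤ q p)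
  (hq1 : Γ.GraphIntegrable (Γ.onEdge q)) {u : C(Γ.Completion, ℝ)} {g : Γ.Field}
  (hu : Γ.IsWeakSolution q u g)

include hq0 hq1 hu

/-- Test with the tent `exists_innerTent` at `a`. The derivative term gives `u(a)` minus the linear
interpolation of the end values, and the source term is a combination of twice iterated integrals.
The slope `c` is determined by the value at the far end. -/
theorem IsWeakSolution.eq_on_edge (e : Γ.Edge) : ∃ c : ℝ, ∀ t ∈ Icc 0 (Γ.len e),
    edgeFun u e t = edgeFun u e 0 + (∫ s in (0)..t, ∫ r in (0)..s, source q u e r) + c * t := by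
  have hl := Γ.len_pos e
  set U := ∫ s in (0)..(Γ.len e), ∫ r in (0)..s, source q u e r with hU
  refine ⟨(edgeFun u e (Γ.len e) - edgeFun u e 0 - U) / Γ.len e, fun a ha => ?_⟩
  obtain ⟨h, h0, h1, h2, h3⟩ := exists_innerTent e ha
  have key := hu.2 h _ h3 h0
  rw [integral_potentialMeasure_eq_sum hq0 hq1 u.continuous h.continuous (S := {e})
    (fun e' he' t _ => h2 e' (by simpa using he') t), Finset.sum_singleton, inner_sub_right,
    inner_smul_right, real_inner_comm, ← hu.1 e 0 a le_rfl ha.1 ha.2, real_inner_comm,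
    ← hu.1 e 0 _ le_rfl hl.le le_rfl] at key
  have h4 : ∫ t in (0)..(Γ.len e), source q u e t * h (Γ.cpt e t) =
      ∫ t in (0)..(Γ.len e), source q u e t * (a / Γ.len e * (Γ.len e - t) - max (a - t) 0) := by
    refine intervalIntegral.integral_congr fun t ht => ?_
    rw [uIcc_of_le hl.le] at ht
    simp [h1 t ht]
  rw [h4, integral_mul_tent hl ha (intervalIntegrable_source hq1 u.continuous e), ← hU] at key
  simp only [edgeFun_apply]
  field_simp at key ⊢
  linarith

/-- The derivative of a weak solution. -/
theorem IsWeakSolution.exists_deriv (e : Γ.Edge) :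
    ∃ p : ℝ → ℝ, Continuous p ∧
      (∀ t ∈ Icc 0 (Γ.len e), p t = p 0 + ∫ r in (0)..t, source q u e r) ∧
      (∀ t ∈ Icc 0 (Γ.len e), HasDerivWithinAt (edgeFun u e) (p t) (Icc 0 (Γ.len e)) t) ∧
      AbsolutelyContinuousOnInterval p 0 (Γ.len e) ∧
      (∀ᵐ t, t ∈ Icc 0 (Γ.len e) → HasDerivAt p (source q u e t) t) ∧
      edgeFun u e (Γ.len e) = edgeFun u e 0 +
        (∫ s in (0)..(Γ.len e), ∫ r in (0)..s, source q u e r) + p 0 * Γ.len e := by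
  obtain ⟨c, hc⟩ := hu.eq_on_edge hq0 hq1 e
  obtain ⟨p, h1, h2, h3, h4, h5⟩ := exists_deriv_of_integral_eq (Γ.len_pos e)
    (intervalIntegrable_source hq1 u.continuous e) hc
  have h0 : p 0 = c := by simp [h2 0 ⟨le_rfl, (Γ.len_pos e).le⟩]
  refine ⟨p, h1, fun t ht => by rw [h0, h2 t ht], h3, h4, h5, ?_⟩
  rw [h0]
  exact hc _ ⟨(Γ.len_pos e).le, le_rfl⟩

/-- A vertex of degree at least two is off the boundary, so its tent is an admissible test function;
by the integrated equation each incident edge contributes minus its outgoing derivative. -/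
theorem IsWeakSolution.kirchhoff (hfin : ∀ v, (Γ.graph.neighborSet v).Finite) {v : V}
    (hv : 2 ≤ (Γ.graph.neighborSet v).ncard) :
    ∑ᶠ e : {e : Γ.Edge // v ∈ e.1}, Γ.vertexDeriv (fun p => u p) e.1 v = 0 := by
  have h0 : ∀ x ∈ Γ.boundary, vertexTent hfin v x = 0 := fun x hx => by
    by_contra h
    have := (eq_of_mem_boundary hfin hx h).2
    omega
  have key := hu.2 _ _ (hasWeakDeriv_vertexTent hfin v) h0
  rw [integral_potentialMeasure_eq_sum hq0 hq1 u.continuous (vertexTent hfin v).continuous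
    (S := (finite_incident hfin v).toFinset) (fun e he t ht => by
      rw [vertexTent_cpt hfin v e ht, edgeTent_of_notMem (by simpa using he)]), inner_sum,
    ← Finset.sum_add_distrib] at key
  have hterm : ∀ e ∈ (finite_incident hfin v).toFinset,
      inner ℝ g (tentSlope v e • intervalField e 0 (Γ.len e)) +
        ∫ t in (0)..(Γ.len e), source q u e t * vertexTent hfin v (Γ.cpt e t) =
      -Γ.vertexDeriv (fun p => u p) e v := by
    intro e he
    have hl := Γ.len_pos e
    have hmem0 : (0 : ℝ) ∈ Icc 0 (Γ.len e) := ⟨le_rfl, hl.le⟩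
    have hmeml : Γ.len e ∈ Icc 0 (Γ.len e) := ⟨hl.le, le_rfl⟩
    have hQ := intervalIntegrable_source hq1 u.continuous e
    obtain ⟨p, -, hp, hd, -, -, hlen⟩ := hu.exists_deriv hq0 hq1 e
    have hud := uniqueDiffOn_Icc hl
    have h1 : ∫ t in (0)..(Γ.len e), source q u e t * vertexTent hfin v (Γ.cpt e t) =
        ∫ t in (0)..(Γ.len e), source q u e t * edgeTent v e t := by
      refine intervalIntegral.integral_congr fun t ht => ?_
      rw [uIcc_of_le hl.le] at ht
      simp only [vertexTent_cpt hfin v e ht]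
    have h2 := integral_mul_sub_eq_integral_integral hQ
    rw [h1, inner_smul_right, real_inner_comm, ← hu.1 e 0 _ le_rfl hl.le le_rfl,
      ← edgeFun_apply u e (Γ.len e), ← edgeFun_apply u e 0, hlen, ← h2]
    rcases mem_edge_iff.1 ((finite_incident hfin v).mem_toFinset.1 he) with rfl | rfl
    · have h3 : ∫ t in (0)..(Γ.len e), source q u e t * edgeTent (Γ.src e) e t =
          1 / Γ.len e * ∫ t in (0)..(Γ.len e), source q u e t * (Γ.len e - t) := by
        rw [← intervalIntegral.integral_const_mul]
        refine intervalIntegral.integral_congr fun t _ => ?_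
        simp only [edgeTent_of_src]
        field_simp
      rw [h3, vertexDeriv, if_pos rfl]
      change _ = -derivWithin (edgeFun u e) _ _
      rw [(hd 0 hmem0).derivWithin (hud 0 hmem0)]
      simp only [tentSlope, (src_ne_tgt e).symm, if_false, if_true]
      field_simp
      ring
    · have h3 : ∫ t in (0)..(Γ.len e), source q u e t * edgeTent (Γ.tgt e) e t =
          (∫ t in (0)..(Γ.len e), source q u e t) -
            1 / Γ.len e * ∫ t in (0)..(Γ.len e), source q u e t * (Γ.len e - t) := by
        rw [← intervalIntegral.integral_const_mul, ← intervalIntegral.integral_sub hQ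
          ((hQ.mul_continuousOn (by fun_prop)).const_mul _)]
        refine intervalIntegral.integral_congr fun t _ => ?_
        simp only [edgeTent_of_tgt]
        field_simp
        ring
      rw [h3, vertexDeriv, if_neg (src_ne_tgt e).symm]
      change _ = - -derivWithin (edgeFun u e) _ _
      rw [(hd _ hmeml).derivWithin (hud _ hmeml), hp _ hmeml]
      simp only [tentSlope, src_ne_tgt e, if_false, if_true]
      field_simp
      ring
  rw [Finset.sum_congr rfl hterm, Finset.sum_neg_distrib, neg_eq_zero] at key
  rw [← key, ← finsum_mem_eq_finite_toFinset_sum]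
  exact finsum_set_coe_eq_finsum_mem (f := fun e => Γ.vertexDeriv (fun p => u p) e v)
    {e : Γ.Edge | v ∈ e.1}

theorem IsWeakSolution.isHarmonic (hfin : ∀ v, (Γ.graph.neighborSet v).Finite) :
    Γ.IsHarmonic q fun p => u p := by
  have hud : ∀ e : Γ.Edge, UniqueDiffOn ℝ (Icc 0 (Γ.len e)) := fun e =>
    uniqueDiffOn_Icc (Γ.len_pos e)
  refine ⟨u.continuous.comp (UniformSpace.Completion.continuous_coe _), fun e => ?_, fun e => ?_,
    fun e => ?_, fun v hv => hu.kirchhoff hq0 hq1 hfin hv⟩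
  · obtain ⟨p, -, -, hd, -⟩ := hu.exists_deriv hq0 hq1 e
    exact fun t ht => (hd t ht).differentiableWithinAt
  · obtain ⟨p, -, -, hd, hac, -⟩ := hu.exists_deriv hq0 hq1 e
    refine hac.congr_on fun t ht => ?_
    rw [uIcc_of_le (Γ.len_pos e).le] at ht
    exact ((hd t ht).derivWithin (hud e t ht)).symm
  · obtain ⟨p, -, -, hd, -, hae, -⟩ := hu.exists_deriv hq0 hq1 e
    rw [ae_restrict_iff' measurableSet_Ioo]
    filter_upwards [hae] with t ht htm
    refine (ht (Ioo_subset_Icc_self htm)).congr_of_eventuallyEq ?_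
    filter_upwards [isOpen_Ioo.mem_nhds htm] with s hs
    exact ((hd s (Ioo_subset_Icc_self hs)).hasDerivAt (Icc_mem_nhds hs.1 hs.2)).deriv

end

end MetricGraph

/-! ### One-sided derivatives at a maximum at the end of an interval -/

theorem nonpos_of_hasDerivWithinAt_of_max_left {w : ℝ → ℝ} {l p : ℝ} (hl : 0 < l)
    (h : HasDerivWithinAt w p (Icc 0 l) 0) (hmax : ∀ t ∈ Icc 0 l, w t ≤ w 0) : p ≤ 0 := by
  have h1 := (hasDerivWithinAt_iff_tendsto_slope' (s := Ioc 0 l) (by simp)).1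
    (h.mono Ioc_subset_Icc_self)
  have := left_nhdsWithin_Ioc_neBot hl
  refine le_of_tendsto h1 ?_
  filter_upwards [self_mem_nhdsWithin] with t ht
  rw [slope_def_field]
  exact div_nonpos_of_nonpos_of_nonneg (sub_nonpos.2 (hmax t (Ioc_subset_Icc_self ht)))
    (sub_nonneg.2 ht.1.le)

theorem nonneg_of_hasDerivWithinAt_of_max_right {w : ℝ → ℝ} {l p : ℝ} (hl : 0 < l)
    (h : HasDerivWithinAt w p (Icc 0 l) l) (hmax : ∀ t ∈ Icc 0 l, w t ≤ w l) : 0 ≤ p := by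
  have h1 := (hasDerivWithinAt_iff_tendsto_slope' (s := Ico 0 l) (by simp)).1
    (h.mono Ico_subset_Icc_self)
  have := right_nhdsWithin_Ico_neBot hl
  refine ge_of_tendsto h1 ?_
  filter_upwards [self_mem_nhdsWithin] with t ht
  rw [slope_def_field]
  exact div_nonneg_of_nonpos (sub_nonpos.2 (hmax t (Ico_subset_Icc_self ht)))
    (sub_nonpos.2 ht.2.le)

namespace MetricGraph

variable {V : Type*} {Γ : MetricGraph V}

/-! ### Uniqueness of harmonic extensions -/

/-- The derivative of a function on the edge `e`, one-sided at the ends. -/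
noncomputable def edgeDeriv (u : Γ.Completion → ℝ) (e : Γ.Edge) : ℝ → ℝ :=
  derivWithin (edgeFun u e) (Icc 0 (Γ.len e))

section

variable {q : Γ.Point → ℝ} {u : Γ.Completion → ℝ} (hu : Γ.IsHarmonic q fun p => u p)

include hu

theorem IsHarmonic.hasDerivWithinAt (e : Γ.Edge) {t : ℝ} (ht : t ∈ Icc 0 (Γ.len e)) :
    HasDerivWithinAt (edgeFun u e) (edgeDeriv u e t) (Icc 0 (Γ.len e)) t :=
  (hu.differentiable e t ht).hasDerivWithinAt

theorem IsHarmonic.deriv_eq (e : Γ.Edge) {t : ℝ} (ht : t ∈ Ioo 0 (Γ.len e)) :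
    deriv (edgeFun u e) t = edgeDeriv u e t :=
  ((hu.hasDerivWithinAt e (Ioo_subset_Icc_self ht)).hasDerivAt (Icc_mem_nhds ht.1 ht.2)).deriv

theorem IsHarmonic.edgeDeriv_sub (e : Γ.Edge) {s t : ℝ} (hs : 0 ≤ s) (hst : s ≤ t)
    (ht : t ≤ Γ.len e) :
    edgeDeriv u e t - edgeDeriv u e s = ∫ x in s..t, source q u e x := by
  have hac : AbsolutelyContinuousOnInterval (edgeDeriv u e) s t := by
    refine (hu.absCont e).mono ?_
    rw [uIcc_of_le hst, uIcc_of_le (Γ.len_pos e).le]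
    exact Icc_subset_Icc hs ht
  rw [← hac.integral_deriv_eq_sub]
  have h : deriv (edgeDeriv u e) =ᵐ[edgeVol e] source q u e := by
    filter_upwards [hu.equation e, ae_restrict_mem measurableSet_Ioo] with x hx hxm
    have h1 : edgeDeriv u e =ᶠ[𝓝 x] deriv (edgeFun u e) := by
      filter_upwards [isOpen_Ioo.mem_nhds hxm] with y hy
      exact (hu.deriv_eq e hy).symm
    exact (hx.congr_of_eventuallyEq h1).deriv
  exact integral_congr_edgeVol h hs hst ht

end

theorem vertexDeriv_src (u : Γ.Completion → ℝ) (e : Γ.Edge) :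
    Γ.vertexDeriv (fun p => u p) e (Γ.src e) = edgeDeriv u e 0 := if_pos rfl

theorem vertexDeriv_tgt (u : Γ.Completion → ℝ) (e : Γ.Edge) :
    Γ.vertexDeriv (fun p => u p) e (Γ.tgt e) = -edgeDeriv u e (Γ.len e) :=
  if_neg (src_ne_tgt e).symm

theorem apply_eq_of_forall_vertex {w : Γ.Completion → ℝ} {M : ℝ} (hw : Continuous w)
    (hv : ∀ v, w (Point.vertex v : Γ.Point) = M)
    (he : ∀ e, edgeFun w e 0 = M → ∀ t ∈ Icc 0 (Γ.len e), edgeFun w e t = M)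
    (x : Γ.Completion) : w x = M := by
  refine denseRange_coe.induction_on (p := fun x => w x = M) x (isClosed_eq hw continuous_const) ?_
  rintro (v | ⟨e, t, h0, h1⟩)
  · exact hv v
  · rw [coe_inner]
    refine he e ?_ t ⟨h0.le, h1.le⟩
    rw [edgeFun_apply, cpt, pt_zero]
    exact hv _

/-- The maximum principle. -/
theorem IsHarmonic.le_of_boundary [CompactSpace Γ.Completion] (hconn : Γ.graph.Connected)
    (hfin : ∀ v, (Γ.graph.neighborSet v).Finite) (hne : Γ.boundary.Nonempty) {q : Γ.Point → ℝ}
    (hq0 : ∀ p, 0 ≤ q p) (hq1 : Γ.GraphIntegrable (Γ.onEdge q)) {u₁ u₂ : Γ.Completion → ℝ}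
    (hc₁ : Continuous u₁) (hc₂ : Continuous u₂) (h₁ : Γ.IsHarmonic q fun p => u₁ p)
    (h₂ : Γ.IsHarmonic q fun p => u₂ p) (hb : ∀ x ∈ Γ.boundary, u₁ x = u₂ x)
    (x : Γ.Completion) : u₁ x ≤ u₂ x := by
  by_contra! hx
  set w : Γ.Completion → ℝ := fun x => u₁ x - u₂ x with hw
  have hwc : Continuous w := hc₁.sub hc₂
  obtain ⟨z, -, hz⟩ := isCompact_univ.exists_isMaxOn ⟨x, mem_univ x⟩ hwc.continuousOn
  set M := w z with hMz
  have hmax : ∀ y, w y ≤ M := fun y => hz (mem_univ y)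
  have hM : 0 < M := (sub_pos.2 hx).trans_le (hmax x)
  have hwb : ∀ y ∈ Γ.boundary, w y ≠ M := fun y hy h => by
    simp only [hw, hb y hy, sub_self] at h
    exact hM.ne h
  have hd : ∀ e, ∀ t ∈ Icc 0 (Γ.len e), HasDerivWithinAt (edgeFun w e)
      (edgeDeriv u₁ e t - edgeDeriv u₂ e t) (Icc 0 (Γ.len e)) t := fun e t ht =>
    (h₁.hasDerivWithinAt e ht).sub (h₂.hasDerivWithinAt e ht)
  have hp : ∀ e s t, 0 ≤ s → s ≤ t → t ≤ Γ.len e → (edgeDeriv u₁ e t - edgeDeriv u₂ e t) -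
      (edgeDeriv u₁ e s - edgeDeriv u₂ e s) = ∫ x in s..t, source q w e x := by
    intro e s t hs hst ht
    have hsub : uIcc s t ⊆ uIcc 0 (Γ.len e) := by
      rw [uIcc_of_le hst, uIcc_of_le (Γ.len_pos e).le]
      exact Icc_subset_Icc hs ht
    rw [sub_sub_sub_comm, h₁.edgeDeriv_sub e hs hst ht, h₂.edgeDeriv_sub e hs hst ht,
      ← intervalIntegral.integral_sub ((intervalIntegrable_source hq1 hc₁ e).mono_set hsub)
        ((intervalIntegrable_source hq1 hc₂ e).mono_set hsub)]
    refine intervalIntegral.integral_congr fun r _ => ?_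
    simp only [source, edgeFun_apply, hw]
    ring
  have hedge : ∀ e, ∀ c ∈ Icc 0 (Γ.len e), edgeFun w e c = M →
      edgeDeriv u₁ e c - edgeDeriv u₂ e c = 0 → ∀ t ∈ Icc 0 (Γ.len e), edgeFun w e t = M :=
    fun e c hc hcM hc0 => eq_of_max_of_deriv_eq_zero hc hM (hd e) (hp e)
      (fun t _ ht => mul_nonneg (hq0 _) ht.le) (fun t _ => hmax _) hcM hc0
  have hinner : ∀ e, ∀ c ∈ Ioo 0 (Γ.len e), edgeFun w e c = M →
      ∀ t ∈ Icc 0 (Γ.len e), edgeFun w e t = M := fun e c hc hcM => by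
    refine hedge e c (Ioo_subset_Icc_self hc) hcM (IsLocalMax.hasDerivAt_eq_zero (f := edgeFun w e)
      (a := c) ?_ ((hd e c (Ioo_subset_Icc_self hc)).hasDerivAt (Icc_mem_nhds hc.1 hc.2)))
    exact Eventually.of_forall fun t => (hmax _).trans_eq hcM.symm
  have hsrc : ∀ e : Γ.Edge, edgeFun w e 0 = w (Point.vertex (Γ.src e) : Γ.Point) := fun e => by
    rw [edgeFun_apply, cpt, pt_zero]
  have htgt : ∀ e : Γ.Edge, edgeFun w e (Γ.len e) = w (Point.vertex (Γ.tgt e) : Γ.Point) :=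
    fun e => by rw [edgeFun_apply, cpt, pt_len]
  have hmem0 : ∀ e : Γ.Edge, (0 : ℝ) ∈ Icc 0 (Γ.len e) := fun e => ⟨le_rfl, (Γ.len_pos e).le⟩
  have hmeml : ∀ e : Γ.Edge, Γ.len e ∈ Icc 0 (Γ.len e) := fun e => ⟨(Γ.len_pos e).le, le_rfl⟩
  -- Such a vertex is off the boundary, so Kirchhoff's condition holds there. The outgoing
  -- derivatives of `w` are all nonpositive with sum zero, so they vanish, and `hedge` carries the
  -- value `M` along the incident edges.
  have hvertex : ∀ v, w (Point.vertex v : Γ.Point) = M → ∀ e : Γ.Edge, v ∈ e.1 →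
      ∀ t ∈ Icc 0 (Γ.len e), edgeFun w e t = M := by
    intro v hv e he
    have hdeg : 2 ≤ (Γ.graph.neighborSet v).ncard := by
      have h1 : (Γ.graph.neighborSet v).ncard ≠ 1 := fun h => hwb _ (.inl ⟨v, h, rfl⟩) hv
      have h0 : 0 < (Γ.graph.neighborSet v).ncard := by
        rw [Set.ncard_pos (hfin v)]
        rcases mem_edge_iff.1 he with rfl | rfl
        · exact ⟨_, adj_src_tgt e⟩
        · exact ⟨_, (adj_src_tgt e).symm⟩
      omega
    have hfe : Finite {e : Γ.Edge // v ∈ e.1} := (finite_incident hfin v).to_subtype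
    have hsum : ∑ᶠ e : {e : Γ.Edge // v ∈ e.1}, (Γ.vertexDeriv (fun p => u₁ p) e.1 v -
        Γ.vertexDeriv (fun p => u₂ p) e.1 v) = 0 := by
      rw [finsum_sub_distrib (Set.toFinite _) (Set.toFinite _), h₁.kirchhoff v hdeg,
        h₂.kirchhoff v hdeg, sub_zero]
    have hsign : ∀ e : {e : Γ.Edge // v ∈ e.1}, Γ.vertexDeriv (fun p => u₁ p) e.1 v -
        Γ.vertexDeriv (fun p => u₂ p) e.1 v ≤ 0 := by
      rintro ⟨e, he⟩
      rcases mem_edge_iff.1 he with rfl | rfl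
      · rw [vertexDeriv_src, vertexDeriv_src]
        exact nonpos_of_hasDerivWithinAt_of_max_left (Γ.len_pos e) (hd e 0 (hmem0 e))
          fun t _ => (hmax _).trans_eq (hv.symm.trans (hsrc e).symm)
      · rw [vertexDeriv_tgt, vertexDeriv_tgt]
        have := nonneg_of_hasDerivWithinAt_of_max_right (Γ.len_pos e) (hd e _ (hmeml e))
          fun t _ => (hmax _).trans_eq (hv.symm.trans (htgt e).symm)
        linarith
    have hzero : Γ.vertexDeriv (fun p => u₁ p) e v - Γ.vertexDeriv (fun p => u₂ p) e v = 0 := by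
      have := Fintype.ofFinite {e : Γ.Edge // v ∈ e.1}
      rw [finsum_eq_sum_of_fintype] at hsum
      exact (Finset.sum_eq_zero_iff_of_nonpos fun i _ => hsign i).1 hsum ⟨e, he⟩ (Finset.mem_univ _)
    rcases mem_edge_iff.1 he with rfl | rfl
    · rw [vertexDeriv_src, vertexDeriv_src] at hzero
      exact hedge e 0 (hmem0 e) ((hsrc e).trans hv) hzero
    · rw [vertexDeriv_tgt, vertexDeriv_tgt] at hzero
      exact hedge e _ (hmeml e) ((htgt e).trans hv) (by linarith)
  -- Connectedness carries `M` to all vertices and edges, density to the whole completion; but `w =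
  -- 0 < M` on the nonempty boundary.
  have hall : ∀ v₀, w (Point.vertex v₀ : Γ.Point) = M → False := by
    intro v₀ hv₀
    have hadj : ∀ a b, Γ.graph.Adj a b → w (Point.vertex a : Γ.Point) = M →
        w (Point.vertex b : Γ.Point) = M := by
      intro a b hab ha
      obtain ⟨e, he, h'⟩ := exists_edge_of_adj hab
      have hea : a ∈ e.1 := by
        rw [he]
        exact Sym2.mem_mk_left a b
      rcases h' with ⟨rfl, rfl⟩ | ⟨rfl, rfl⟩
      · rw [← htgt e]
        exact hvertex _ ha e hea _ (hmeml e)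
      · rw [← hsrc e]
        exact hvertex _ ha e hea _ (hmem0 e)
    have hwalk : ∀ {a b} (_ : Γ.graph.Walk a b), w (Point.vertex a : Γ.Point) = M →
        w (Point.vertex b : Γ.Point) = M := by
      intro a b p
      induction p with
      | nil => exact id
      | cons h _ ih => exact fun ha => ih (hadj _ _ h ha)
    have hv : ∀ v, w (Point.vertex v : Γ.Point) = M := fun v =>
      (hconn.preconnected v₀ v).elim fun p => hwalk p hv₀
    obtain ⟨y, hy⟩ := hne
    exact hwb y hy (apply_eq_of_forall_vertex hwc hv
      (fun e _ => hvertex _ (hv (Γ.src e)) e (src_mem e)) y)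
  have hzb : z ∉ Γ.boundary := fun h => hwb z h rfl
  have hzc : z ∈ Γ.carrier := by
    by_contra h
    exact hzb (.inr h)
  obtain ⟨p, hp'⟩ := hzc
  rcases p with v | ⟨e, t, h0, h1⟩
  · exact hall v (by rw [hMz, ← hp'])
  · refine hall (Γ.src e) ?_
    rw [← hsrc e]
    refine hinner e t ⟨h0, h1⟩ ?_ 0 (hmem0 e)
    rw [edgeFun_apply, ← coe_inner e t h0 h1, hMz, ← hp']

theorem IsHarmonicExtension.unique [CompactSpace Γ.Completion] (hconn : Γ.graph.Connected)
    (hfin : ∀ v, (Γ.graph.neighborSet v).Finite) (hne : Γ.boundary.Nonempty) {q : Γ.Point → ℝ}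
    (hq0 : ∀ p, 0 ≤ q p) (hq1 : Γ.GraphIntegrable (Γ.onEdge q)) {U : Γ.boundary → ℝ}
    {u₁ u₂ : Γ.Completion → ℝ} (h₁ : Γ.IsHarmonicExtension q U u₁)
    (h₂ : Γ.IsHarmonicExtension q U u₂) : u₁ = u₂ := by
  have hb : ∀ x ∈ Γ.boundary, u₁ x = u₂ x := fun x hx =>
    (h₁.boundary ⟨x, hx⟩).trans (h₂.boundary ⟨x, hx⟩).symm
  funext x
  exact le_antisymm
    (h₁.harmonic.le_of_boundary hconn hfin hne hq0 hq1 h₁.continuous h₂.continuous h₂.harmonic hb x)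
    (h₂.harmonic.le_of_boundary hconn hfin hne hq0 hq1 h₂.continuous h₁.continuous h₁.harmonic
      (fun x hx => (hb x hx).symm) x)

end MetricGraph

/-! ### Composition with contractions -/

theorem AbsolutelyContinuousOnInterval.lipschitz_comp {f F : ℝ → ℝ} {a b : ℝ}
    (hf : AbsolutelyContinuousOnInterval f a b) (hF : LipschitzWith 1 F) :
    AbsolutelyContinuousOnInterval (fun t => F (f t)) a b := by
  rw [absolutelyContinuousOnInterval_iff] at hf ⊢
  intro ε hε
  obtain ⟨δ, hδ, H⟩ := hf ε hε
  refine ⟨δ, hδ, fun E hE hlt => lt_of_le_of_lt (Finset.sum_le_sum fun i _ => ?_) (H E hE hlt)⟩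
  simpa using hF.dist_le_mul (f (E.2 i).1) (f (E.2 i).2)

/-- Difference quotients of `F ∘ f` are dominated by those of `f`; where `F ∘ f` is not
differentiable, `deriv` has the default value `0` and the bound is trivial. -/
theorem abs_deriv_lipschitz_comp_le {f F : ℝ → ℝ} (hF : LipschitzWith 1 F) {a t : ℝ}
    (h : HasDerivAt f a t) : |deriv (fun s => F (f s)) t| ≤ |a| := by
  by_cases hd : DifferentiableAt ℝ (fun s => F (f s)) t
  · have h1 := (hasDerivAt_iff_tendsto_slope.1 hd.hasDerivAt).abs
    have h2 := (hasDerivAt_iff_tendsto_slope.1 h).abs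
    refine le_of_tendsto_of_tendsto' h1 h2 fun s => ?_
    rw [slope_def_field, slope_def_field, abs_div, abs_div]
    exact div_le_div_of_nonneg_right (by simpa [Real.dist_eq] using hF.dist_le_mul (f s) (f t))
      (abs_nonneg _)
  · rw [deriv_zero_of_not_differentiableAt hd, abs_zero]
    exact abs_nonneg a

namespace MetricGraph

open scoped ContDiff

variable {V : Type*} {Γ : MetricGraph V}

/-! ### Functions with a weak derivative are absolutely continuous on the edges -/

theorem intervalIntegrable_field (g : Γ.Field) (e : Γ.Edge) :
    IntervalIntegrable (g e) volume 0 (Γ.len e) :=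
  intervalIntegrable_iff_edgeVol.2 ((Lp.memLp (g e)).integrable (by norm_num))

section

variable {f : Γ.Completion → ℝ} {g : Γ.Field} (h : HasWeakDeriv f g)

include h

theorem HasWeakDeriv.edgeFun_eq (e : Γ.Edge) {t : ℝ} (ht : t ∈ Icc 0 (Γ.len e)) :
    edgeFun f e t = edgeFun f e 0 + ∫ x in (0)..t, g e x := by
  rw [← h.sub_eq e le_rfl ht.1 ht.2, edgeFun_apply, edgeFun_apply]
  ring

theorem HasWeakDeriv.absolutelyContinuous (e : Γ.Edge) :
    AbsolutelyContinuousOnInterval (edgeFun f e) 0 (Γ.len e) := by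
  have hc : AbsolutelyContinuousOnInterval (fun _ : ℝ => edgeFun f e 0) 0 (Γ.len e) :=
    contDiff_const.contDiffOn.absolutelyContinuousOnInterval
  have hac := (intervalIntegrable_field g e).absolutelyContinuousOnInterval_intervalIntegral
    (c := 0) left_mem_uIcc
  refine (hc.add hac).congr_on fun t ht => ?_
  rw [uIcc_of_le (Γ.len_pos e).le] at ht
  exact (h.edgeFun_eq e ht).symm

theorem HasWeakDeriv.ae_hasDerivAt (e : Γ.Edge) :
    ∀ᵐ t ∂edgeVol e, HasDerivAt (edgeFun f e) (g e t) t := by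
  rw [ae_restrict_iff' measurableSet_Ioo]
  filter_upwards [(intervalIntegrable_field g e).ae_hasDerivAt_integral] with t ht htm
  have h1 : t ∈ uIcc 0 (Γ.len e) := by
    rw [uIcc_of_le (Γ.len_pos e).le]
    exact Ioo_subset_Icc_self htm
  refine ((ht h1 0 left_mem_uIcc).const_add (edgeFun f e 0)).congr_of_eventuallyEq ?_
  filter_upwards [isOpen_Ioo.mem_nhds htm] with s hs
  exact h.edgeFun_eq e (Ioo_subset_Icc_self hs)

/-- Composition with a Lipschitz function does not increase the energy. -/
theorem HasWeakDeriv.lipschitz_comp {F : ℝ → ℝ} (hF : LipschitzWith 1 F) :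
    ∃ m : Γ.Field, HasWeakDeriv (fun x => F (f x)) m ∧ ‖m‖ ≤ ‖g‖ := by
  obtain ⟨m, hm, hle⟩ := exists_field_of_abs_le (k := g)
    (g := fun e => deriv (edgeFun (fun x => F (f x)) e))
    (fun e => (stronglyMeasurable_deriv _).aestronglyMeasurable)
    (fun e => (h.ae_hasDerivAt e).mono fun t ht => abs_deriv_lipschitz_comp_le hF ht)
  refine ⟨m, hasWeakDeriv_iff.2 fun e s t hs hst ht => ?_, hle⟩
  have hac : AbsolutelyContinuousOnInterval (edgeFun (fun x => F (f x)) e) s t := by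
    refine ((h.absolutelyContinuous e).lipschitz_comp hF).mono ?_
    rw [uIcc_of_le hst, uIcc_of_le (Γ.len_pos e).le]
    exact Icc_subset_Icc hs ht
  rw [integral_congr_edgeVol (hm e) hs hst ht, hac.integral_deriv_eq_sub]
  rfl

/-- Integration by parts without boundary terms, since `φ'` vanishes at both ends of the edge. -/
theorem HasWeakDeriv.integral_mul_deriv_deriv {φ : Γ.Completion → ℝ} (hφ : Γ.IsEventuallyFlat φ)
    (e : Γ.Edge) : ∫ t in (0)..(Γ.len e), edgeFun f e t * deriv (deriv (edgeFun φ e)) t =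
      -∫ t in (0)..(Γ.len e), g e t * deriv (edgeFun φ e) t := by
  have h2 : AbsolutelyContinuousOnInterval (deriv (edgeFun φ e)) 0 (Γ.len e) :=
    (ContDiff.deriv' (n := 1) ((hφ.contDiff e).of_le
      (by norm_cast))).contDiffOn.absolutelyContinuousOnInterval
  rw [(h.absolutelyContinuous e).integral_mul_deriv_eq_deriv_mul h2, hφ.deriv_len, hφ.deriv_zero,
    mul_zero, mul_zero, sub_zero, zero_sub]
  congr 1
  refine integral_congr_edgeVol ?_ le_rfl (Γ.len_pos e).le le_rfl
  filter_upwards [h.ae_hasDerivAt e] with t ht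
  rw [ht.deriv]

end

/-! ### The pairing -/

section

variable [CompactSpace Γ.Completion] {q : Γ.Point → ℝ} (hq0 : ∀ p, 0 ≤ q p)
  (hq1 : Γ.GraphIntegrable (Γ.onEdge q)) {u : C(Γ.Completion, ℝ)} {g : Γ.Field}
  {φ : Γ.Completion → ℝ} (hφ : Γ.IsEventuallyFlat φ)

include hq1 hφ

omit [CompactSpace Γ.Completion] in
theorem intervalIntegrable_pairing_parts (u : C(Γ.Completion, ℝ)) (e : Γ.Edge) :
    IntervalIntegrable (fun t => edgeFun u e t * deriv (deriv (edgeFun φ e)) t) volume 0 (Γ.len e) ∧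
    IntervalIntegrable (fun t => Γ.onEdge q e t * (u (Γ.cpt e t) * φ (Γ.cpt e t))) volume 0
      (Γ.len e) := by
  refine ⟨Continuous.intervalIntegrable ?_ _ _, ?_⟩
  · have h1 : ContDiff ℝ 1 (deriv (edgeFun φ e)) :=
      ContDiff.deriv' (n := 1) ((hφ.contDiff e).of_le (by norm_cast))
    exact (continuous_edgeFun u.continuous e).mul (h1.continuous_deriv le_rfl)
  · exact (intervalIntegrable_iff_edgeVol.2 (hq1.1 e)).mul_continuousOn
      ((continuous_edgeFun u.continuous e).mul (continuous_edgeFun hφ.continuous e)).continuousOn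

/-- Outside finitely many edges `φ'' = 0`, and the integrand is dominated by a constant multiple of
`q`. -/
theorem graphIntegrable_pairing (u : C(Γ.Completion, ℝ)) :
    Γ.GraphIntegrable (Γ.pairing q u φ) := by
  have hpair : ∀ e, Γ.pairing q u φ e = fun t =>
      -(edgeFun u e t * deriv (deriv (edgeFun φ e)) t) +
        Γ.onEdge q e t * (u (Γ.cpt e t) * φ (Γ.cpt e t)) := fun e => by
    funext t
    simp only [pairing, onEdge, cpt]
    ring
  refine ⟨fun e => ?_, ?_⟩
  · have h := intervalIntegrable_pairing_parts hq1 hφ u e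
    rw [hpair]
    exact intervalIntegrable_iff_edgeVol.1 (h.1.neg.add h.2)
  · obtain ⟨C, hC⟩ := isCompact_univ.exists_bound_of_continuousOn
      (u.continuous.mul hφ.continuous).continuousOn
    refine Summable.of_norm_bounded_eventually (hq1.2.mul_left C) ?_
    refine hφ.finite.subset fun e he => ?_
    by_contra hflat
    simp only [mem_ofPred_eq, not_exists, not_and, not_not] at hflat
    refine he ?_
    change ‖∫ t in Ioo 0 (Γ.len e), |Γ.pairing q u φ e t|‖ ≤
      C * ∫ t in Ioo 0 (Γ.len e), |Γ.onEdge q e t|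
    rw [Real.norm_eq_abs, abs_of_nonneg (integral_nonneg fun t => abs_nonneg _),
      ← integral_const_mul]
    refine setIntegral_mono_on ?_ ((hq1.1 e).abs.const_mul C) measurableSet_Ioo fun t ht => ?_
    · have h := intervalIntegrable_pairing_parts hq1 hφ u e
      rw [hpair]
      exact (intervalIntegrable_iff_edgeVol.1 (h.1.neg.add h.2)).abs
    · have h0 : deriv (deriv (edgeFun φ e)) t = 0 := by
        have : deriv (edgeFun φ e) =ᶠ[𝓝 t] fun _ => 0 := by
          filter_upwards [isOpen_Ioo.mem_nhds ht] with s hs using hflat s hs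
        rw [this.deriv_eq, deriv_const]
      have := hC (Γ.cpt e t) (mem_univ _)
      rw [hpair]
      change |-(edgeFun u e t * deriv (deriv (edgeFun φ e)) t) +
        Γ.onEdge q e t * (u (Γ.cpt e t) * φ (Γ.cpt e t))| ≤ C * |Γ.onEdge q e t|
      rw [h0, mul_zero, neg_zero, zero_add, abs_mul, mul_comm]
      exact mul_le_mul_of_nonneg_right this (abs_nonneg _)

include hq0

theorem graphIntegral_pairing (h : HasWeakDeriv u g) {k : Γ.Field}
    (hk : ∀ e, k e =ᵐ[edgeVol e] deriv (edgeFun φ e)) :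
    Γ.graphIntegral (Γ.pairing q u φ) =
      inner ℝ g k + ∫ x, u x * φ x ∂potentialMeasure q := by
  have h1 := (hasSum_inner_field g k).add
    (hasSum_integral_potentialMeasure hq0 hq1 (F := fun x => u x * φ x)
      (u.continuous.mul hφ.continuous))
  rw [← h1.tsum_eq]
  refine tsum_congr fun e => ?_
  have hi := intervalIntegrable_pairing_parts hq1 hφ u e
  have h2 : ∫ t in (0)..(Γ.len e), g e t * k e t =
      ∫ t in (0)..(Γ.len e), g e t * deriv (edgeFun φ e) t := by
    refine integral_congr_edgeVol ?_ le_rfl (Γ.len_pos e).le le_rfl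
    filter_upwards [hk e] with t ht
    rw [ht]
  have hadd : (-∫ t in (0)..(Γ.len e), edgeFun u e t * deriv (deriv (edgeFun φ e)) t) +
      ∫ t in (0)..(Γ.len e), Γ.onEdge q e t * (u (Γ.cpt e t) * φ (Γ.cpt e t)) =
      ∫ t in (0)..(Γ.len e), (-(edgeFun u e t * deriv (deriv (edgeFun φ e)) t) +
        Γ.onEdge q e t * (u (Γ.cpt e t) * φ (Γ.cpt e t))) := by
    rw [← intervalIntegral.integral_neg]
    exact (intervalIntegral.integral_add hi.1.neg hi.2).symm
  rw [h2, ← neg_eq_iff_eq_neg.2 (h.integral_mul_deriv_deriv hφ e), hadd, ← integral_edgeVol]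
  refine integral_congr_ae (ae_of_all _ fun t => ?_)
  simp only [pairing, onEdge, cpt]
  ring

end

end MetricGraph

/-- The first order term decides for small `ε`. If `a < 0`, the choice `ε = -a / (|b| + 1)` gives `ε
b ≤ -a`, so the quadratic is at most `ε a < 0`. -/
theorem nonneg_of_forall_pos_quadratic {a b : ℝ} (h : ∀ ε > 0, 0 ≤ 2 * ε * a + ε ^ 2 * b) :
    0 ≤ a := by
  by_contra! ha
  have hb : 0 < |b| + 1 := by positivity
  have h1 := h (-a / (|b| + 1)) (div_pos (neg_pos.2 ha) hb)
  have h2 : -a / (|b| + 1) * b ≤ -a := by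
    rw [div_mul_eq_mul_div, div_le_iff₀ hb]
    nlinarith [le_abs_self b]
  have h3 : 0 < -a / (|b| + 1) := div_pos (neg_pos.2 ha) hb
  nlinarith

namespace MetricGraph

variable {V : Type*} {Γ : MetricGraph V}

/-! ### Positivity -/

section

variable [CompactSpace Γ.Completion] {q : Γ.Point → ℝ} (hq0 : ∀ p, 0 ≤ q p)
  (hq1 : Γ.GraphIntegrable (Γ.onEdge q))

include hq0 hq1

theorem integrable_potentialMeasure {f : Γ.Completion → ℝ} (hf : Continuous f) :
    Integrable f (potentialMeasure q) := by
  have := isFiniteMeasure_potentialMeasure hq0 hq1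
  have := secondCountableTopology_completion (Γ := Γ)
  exact hf.integrable_of_hasCompactSupport (HasCompactSupport.of_compactSpace _)

variable {u φ : C(Γ.Completion, ℝ)} {g k : Γ.Field} (hu : Γ.IsWeakSolution q u g)
  (hφ : HasWeakDeriv φ k)

include hu hφ

/-- The difference `φ - ψ` vanishes on the boundary, so the weak equation applies to it. This is why
the choice of test function is immaterial. -/
theorem IsWeakSolution.energy_congr {ψ : C(Γ.Completion, ℝ)} {l : Γ.Field} (hψ : HasWeakDeriv ψ l)
    (h : ∀ x ∈ Γ.boundary, φ x = ψ x) :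
    inner ℝ g k + ∫ x, u x * φ x ∂potentialMeasure q =
      inner ℝ g l + ∫ x, u x * ψ x ∂potentialMeasure q := by
  have h1 := hu.2 (φ - ψ) (k - l) (hφ.sub hψ) fun x hx => by simp [h x hx]
  have h2 : ∫ x, u x * (φ - ψ) x ∂potentialMeasure q =
      (∫ x, u x * φ x ∂potentialMeasure q) - ∫ x, u x * ψ x ∂potentialMeasure q := by
    have hI : ∀ f : C(Γ.Completion, ℝ), Integrable (fun x => u x * f x) (potentialMeasure q) :=
      fun f => integrable_potentialMeasure hq0 hq1 (u.continuous.mul f.continuous)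
    rw [← integral_sub (hI φ) (hI ψ)]
    simp only [ContinuousMap.sub_apply, mul_sub]
  rw [h2, inner_sub_right] at h1
  linarith

/-- Contractions decrease the energy, which is minimal at the weak solutions. -/
theorem IsWeakSolution.energy_nonneg {F : ℝ → ℝ} (hF : LipschitzWith 1 F)
    (hFx : ∀ x, F x ^ 2 ≤ x ^ 2) {ε : ℝ} (h : ∀ x ∈ Γ.boundary, F (u x + ε * φ x) = u x) :
    0 ≤ 2 * ε * (inner ℝ g k + ∫ x, u x * φ x ∂potentialMeasure q) +
      ε ^ 2 * (‖k‖ ^ 2 + ∫ x, φ x ^ 2 ∂potentialMeasure q) := by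
  have hI : ∀ {f : Γ.Completion → ℝ}, Continuous f → Integrable f (potentialMeasure q) :=
    integrable_potentialMeasure hq0 hq1
  obtain ⟨m, hm, hle⟩ := (hu.1.add (hφ.const_mul ε)).lipschitz_comp hF
  let w : C(Γ.Completion, ℝ) := ⟨fun x => F (u x + ε * φ x), by
    have := hF.continuous
    fun_prop⟩
  have hm' : HasWeakDeriv w m := hm
  -- As `w = u` on the boundary, `u` is orthogonal to `w - u`, so the energy of `w` is at least that
  -- of `u`; the contraction makes it at most that of `u + ε φ`. Expanding the latter gives the
  -- claim.
  have h1 := hu.2 (w - u) (m - g) (hm'.sub hu.1) fun x hx => by simp [w, h x hx]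
  have h2 : (0 : ℝ) ≤ ∫ x, (w x - u x) ^ 2 ∂potentialMeasure q :=
    integral_nonneg fun x => sq_nonneg _
  have h3 : (0 : ℝ) ≤ ∫ x, ((u x + ε * φ x) ^ 2 - w x ^ 2) ∂potentialMeasure q :=
    integral_nonneg fun x => sub_nonneg.2 (hFx _)
  have h4 : ∫ x, ((u x + ε * φ x) ^ 2 - w x ^ 2) ∂potentialMeasure q =
      ∫ x, (2 * ε * (u x * φ x) + ε ^ 2 * φ x ^ 2 - 2 * (u x * (w - u) x) - (w x - u x) ^ 2)
        ∂potentialMeasure q := by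
    congr 1 with x
    simp only [ContinuousMap.sub_apply]
    ring
  rw [h4, integral_sub (hI (by fun_prop)) (hI (by fun_prop)),
    integral_sub (hI (by fun_prop)) (hI (by fun_prop)),
    integral_add (hI (by fun_prop)) (hI (by fun_prop)), integral_const_mul, integral_const_mul,
    integral_const_mul] at h3
  have h5 : ‖m‖ ^ 2 ≤ ‖g + ε • k‖ ^ 2 := by gcongr
  have h6 : ‖g + ε • k‖ ^ 2 = ‖g‖ ^ 2 + 2 * ε * inner ℝ g k + ε ^ 2 * ‖k‖ ^ 2 := by
    rw [norm_add_sq_real, inner_smul_right, norm_smul, mul_pow, Real.norm_eq_abs, sq_abs]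
    ring
  have h7 : ‖m - g‖ ^ 2 = ‖m‖ ^ 2 - 2 * inner ℝ g (m - g) - ‖g‖ ^ 2 := by
    rw [norm_sub_sq_real, inner_sub_right, real_inner_self_eq_norm_sq, real_inner_comm]
    ring
  have h8 := sq_nonneg ‖m - g‖
  linarith

/-- Raising a boundary value that is equal to `1`, or lowering one that is equal to `0`, increases
the energy. -/
theorem IsWeakSolution.inner_nonneg
    (h : ∀ x ∈ Γ.boundary, u x = 1 ∧ 0 ≤ φ x ∨ u x = 0 ∧ φ x ≤ 0) :
    0 ≤ inner ℝ g k + ∫ x, u x * φ x ∂potentialMeasure q := by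
  -- Truncation to `[0, 1]` undoes the perturbation on the boundary, where `ε φ` pushes the values
  -- `0` and `1` of `u` out of this interval or leaves them fixed.
  have hF : LipschitzWith 1 fun x : ℝ => max 0 (min 1 x) :=
    (LipschitzWith.id.const_min 1).const_max 0
  refine nonneg_of_forall_pos_quadratic fun ε hε =>
    hu.energy_nonneg hq0 hq1 hφ hF (fun x => ?_) fun x hx => ?_
  · refine sq_le_sq.2 ?_
    rw [abs_of_nonneg (le_max_left _ _)]
    exact max_le (abs_nonneg x) ((min_le_right _ _).trans (le_abs_self x))
  · rcases h x hx with ⟨h1, h2⟩ | ⟨h1, h2⟩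
    · have : 0 ≤ ε * φ x := by positivity
      rw [h1, min_eq_left (by linarith), max_eq_right zero_le_one]
    · have : ε * φ x ≤ 0 := mul_nonpos_of_nonneg_of_nonpos hε.le h2
      rw [h1, zero_add, max_eq_left ((min_le_right _ _).trans this)]

end

/-! ### The Dirichlet-Neumann function -/

theorem charFun_apply_of_mem {E : Set Γ.boundary} {x : Γ.boundary} (h : x ∈ E) :
    Γ.charFun E x = 1 := indicator_of_mem h _

theorem charFun_apply_of_notMem {E : Set Γ.boundary} {x : Γ.boundary} (h : x ∉ E) :
    Γ.charFun E x = 0 := indicator_of_notMem h _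

theorem charFun_nonneg (E : Set Γ.boundary) (x : Γ.boundary) : 0 ≤ Γ.charFun E x :=
  indicator_nonneg (fun _ _ => zero_le_one) x

theorem IsTestFunction.add {A B : Set Γ.boundary} (hAB : Disjoint A B) {φ ψ : Γ.Completion → ℝ}
    (hφ : Γ.IsTestFunction A φ) (hψ : Γ.IsTestFunction B ψ) :
    Γ.IsTestFunction (A ∪ B) fun x => φ x + ψ x := by
  refine ⟨hφ.1.add hψ.1, fun x => ?_⟩
  change φ x + ψ x = _
  rw [hφ.2, hψ.2, charFun, charFun, charFun, indicator_union_of_disjoint hAB]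

section

variable [CompactSpace Γ.Completion] (hconn : Γ.graph.Connected)
  (hfin : ∀ v, (Γ.graph.neighborSet v).Finite) (hne : Γ.boundary.Nonempty)
  (hweak : Γ.WeaklyConnected) {q : Γ.Point → ℝ} (hq0 : ∀ p, 0 ≤ q p)
  (hq1 : Γ.GraphIntegrable (Γ.onEdge q)) {Ω : Set Γ.boundary} (hΩ : IsClopen Ω)

include hconn hfin hne hq0 hq1

/-- The Dirichlet problem is solvable for locally constant boundary values. -/
theorem exists_isWeakSolution (hweak : Γ.WeaklyConnected) (hΩ : IsClopen Ω) :
    ∃ (u : C(Γ.Completion, ℝ)) (g : Γ.Field), Γ.IsWeakSolution q u g ∧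
      Γ.IsHarmonicExtension q (Γ.charFun Ω) u := by
  have := isFiniteMeasure_potentialMeasure hq0 hq1
  obtain ⟨φ, hφ⟩ := exists_isTestFunction hfin hweak hΩ
  obtain ⟨k, hk, -⟩ := hφ.1.exists_hasWeakDeriv
  obtain ⟨u, g, hg, hb, hw⟩ := exists_weakSolution hconn hne (potentialMeasure q)
    (φ := ⟨φ, hφ.1.continuous⟩) hk
  have hu : Γ.IsWeakSolution q u g := ⟨hg, hw⟩
  exact ⟨u, g, hu, u.continuous, hu.isHarmonic hq0 hq1 hfin, fun x =>
    (hb x x.2).trans (hφ.2 x)⟩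

variable {u : C(Γ.Completion, ℝ)} {g : Γ.Field} (hu : Γ.IsWeakSolution q u g)
  (hb : Γ.IsHarmonicExtension q (Γ.charFun Ω) u)

include hu hb

/-- Both choices in the definition are harmless: the harmonic extension is unique, hence is the weak
solution `u`, and two test functions for `E` agree on the boundary. -/
theorem dirichletNeumann_eq {E : Set Γ.boundary} {φ : C(Γ.Completion, ℝ)} {k : Γ.Field}
    (hφ : Γ.IsTestFunction E φ) (hk : HasWeakDeriv φ k) :
    Γ.dirichletNeumann q (Γ.charFun Ω) E =
      inner ℝ g k + ∫ x, u x * φ x ∂potentialMeasure q := by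
  have h1 : Classical.epsilon (Γ.IsHarmonicExtension q (Γ.charFun Ω)) = u :=
    (Classical.epsilon_spec ⟨(u : Γ.Completion → ℝ), hb⟩ :
      Γ.IsHarmonicExtension q (Γ.charFun Ω) _).unique hconn hfin hne hq0 hq1 hb
  have h2 : Γ.IsTestFunction E (Classical.epsilon (Γ.IsTestFunction E)) :=
    Classical.epsilon_spec ⟨(φ : Γ.Completion → ℝ), hφ⟩
  rw [dirichletNeumann, h1]
  generalize Classical.epsilon (Γ.IsTestFunction E) = ψ at h2
  obtain ⟨l, hl, hl'⟩ := h2.1.exists_hasWeakDeriv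
  rw [graphIntegral_pairing hq0 hq1 h2.1 hu.1 hl']
  exact hu.energy_congr hq0 hq1 (φ := ⟨ψ, h2.1.continuous⟩) hl hk fun x hx =>
    (h2.2 ⟨x, hx⟩).trans (hφ.2 ⟨x, hx⟩).symm

theorem dirichletNeumann_eq_graphIntegral {E : Set Γ.boundary} {φ : Γ.Completion → ℝ}
    (hφ : Γ.IsTestFunction E φ) :
    Γ.dirichletNeumann q (Γ.charFun Ω) E = Γ.graphIntegral (Γ.pairing q u φ) := by
  obtain ⟨k, hk, hk'⟩ := hφ.1.exists_hasWeakDeriv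
  rw [graphIntegral_pairing hq0 hq1 hφ.1 hu.1 hk']
  exact dirichletNeumann_eq hconn hfin hne hq0 hq1 hu hb (φ := ⟨φ, hφ.1.continuous⟩) hφ hk

include hweak

theorem dirichletNeumann_union {A B : Set Γ.boundary} (hA : IsClopen A) (hB : IsClopen B)
    (hAB : Disjoint A B) :
    Γ.dirichletNeumann q (Γ.charFun Ω) (A ∪ B) =
      Γ.dirichletNeumann q (Γ.charFun Ω) A + Γ.dirichletNeumann q (Γ.charFun Ω) B := by
  obtain ⟨φ, hφ⟩ := exists_isTestFunction hfin hweak hA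
  obtain ⟨ψ, hψ⟩ := exists_isTestFunction hfin hweak hB
  obtain ⟨k, hk, -⟩ := hφ.1.exists_hasWeakDeriv
  obtain ⟨l, hl, -⟩ := hψ.1.exists_hasWeakDeriv
  have key := @dirichletNeumann_eq _ _ _ hconn hfin hne _ hq0 hq1 _ _ _ hu hb
  rw [key (φ := ⟨φ, hφ.1.continuous⟩) hφ hk, key (φ := ⟨ψ, hψ.1.continuous⟩) hψ hl,
    key (φ := ⟨fun x => φ x + ψ x, hφ.1.continuous.add hψ.1.continuous⟩) (hφ.add hAB hψ)
      (hk.add hl), inner_add_right]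
  have hI : ∀ {f : Γ.Completion → ℝ}, Continuous f →
      Integrable (fun x => u x * f x) (potentialMeasure q) :=
    fun hf => integrable_potentialMeasure hq0 hq1 (u.continuous.mul hf)
  simp only [ContinuousMap.coe_mk, mul_add]
  rw [integral_add (hI hφ.1.continuous) (hI hψ.1.continuous)]
  ring

theorem dirichletNeumann_empty : Γ.dirichletNeumann q (Γ.charFun Ω) ∅ = 0 := by
  have := dirichletNeumann_union hconn hfin hne hweak hq0 hq1 hu hb isClopen_empty isClopen_empty
    (disjoint_empty _)
  rw [empty_union] at this
  linarith

theorem dirichletNeumann_nonneg {E : Set Γ.boundary} (hE : IsClopen E) (h : E ⊆ Ω) :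
    0 ≤ Γ.dirichletNeumann q (Γ.charFun Ω) E := by
  obtain ⟨φ, hφ⟩ := exists_isTestFunction hfin hweak hE
  obtain ⟨k, hk, -⟩ := hφ.1.exists_hasWeakDeriv
  rw [dirichletNeumann_eq hconn hfin hne hq0 hq1 hu hb (φ := ⟨φ, hφ.1.continuous⟩) hφ hk]
  refine hu.inner_nonneg hq0 hq1 hk fun x hx => ?_
  rw [hb.boundary ⟨x, hx⟩]
  change _ ∧ 0 ≤ φ x ∨ _ ∧ φ x ≤ 0
  rw [hφ.2 ⟨x, hx⟩]
  by_cases hxΩ : (⟨x, hx⟩ : Γ.boundary) ∈ Ω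
  · exact .inl ⟨charFun_apply_of_mem hxΩ, charFun_nonneg _ _⟩
  · exact .inr ⟨charFun_apply_of_notMem hxΩ, (charFun_apply_of_notMem fun hxE => hxΩ (h hxE)).le⟩

/-- The sign argument applies to `-φ`, which is `0` on `Ω`, where `u = 1`, and nonpositive on the
rest of the boundary, where `u = 0`. -/
theorem dirichletNeumann_nonpos {E : Set Γ.boundary} (hE : IsClopen E) (h : Disjoint E Ω) :
    Γ.dirichletNeumann q (Γ.charFun Ω) E ≤ 0 := by
  obtain ⟨φ, hφ⟩ := exists_isTestFunction hfin hweak hE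
  obtain ⟨k, hk, -⟩ := hφ.1.exists_hasWeakDeriv
  rw [dirichletNeumann_eq hconn hfin hne hq0 hq1 hu hb (φ := ⟨φ, hφ.1.continuous⟩) hφ hk]
  have key := hu.inner_nonneg hq0 hq1
    (φ := ⟨fun x => -1 * φ x, continuous_const.mul hφ.1.continuous⟩) (hk.const_mul (-1))
    fun x hx => by
      rw [hb.boundary ⟨x, hx⟩]
      change _ ∧ 0 ≤ -1 * φ x ∨ _ ∧ -1 * φ x ≤ 0
      rw [hφ.2 ⟨x, hx⟩]
      by_cases hxΩ : (⟨x, hx⟩ : Γ.boundary) ∈ Ω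
      · refine .inl ⟨charFun_apply_of_mem hxΩ, ?_⟩
        rw [charFun_apply_of_notMem fun hxE => h.le_bot ⟨hxE, hxΩ⟩, mul_zero]
      · refine .inr ⟨charFun_apply_of_notMem hxΩ, ?_⟩
        linarith [charFun_nonneg E (⟨x, hx⟩ : Γ.boundary)]
  simp only [ContinuousMap.coe_mk, neg_one_mul, mul_neg, integral_neg, inner_smul_right] at key ⊢
  linarith

end

end MetricGraph

/-! ### Assembly of the main theorem -/

theorem mainTheorem4 {V : Type*} [Countable V] (Γ : MetricGraph V)
    (hfin : ∀ v, (Γ.graph.neighborSet v).Finite)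
    (hconn : Γ.graph.Connected)
    (hcompact : CompactSpace Γ.Completion)
    (hweak : Γ.WeaklyConnected)
    (q : Γ.Point → ℝ) (hq0 : ∀ p, 0 ≤ q p)
    (hq1 : Γ.GraphIntegrable (Γ.onEdge q))
    (ω : Γ.Edge → ℝ) (hω0 : ∀ e, 0 < ω e) (hω1 : Summable ω)
    (hω2 : Γ.GraphIntegrable fun e t => ((ω e)⁻¹ * Γ.onEdge q e t) ^ 2 * ω e)
    (Ω : Set Γ.boundary) (hΩ : IsClopen Ω) (hne : Ω.Nonempty) (hproper : Ω ≠ Set.univ) :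
    -- the Dirichlet-Neumann function is well defined
    (∃! u, Γ.IsHarmonicExtension q (Γ.charFun Ω) u) ∧
    (∀ E : Set Γ.boundary, IsClopen E → (∃ φ, Γ.IsTestFunction E φ) ∧
      ∀ u φ, Γ.IsHarmonicExtension q (Γ.charFun Ω) u → Γ.IsTestFunction E φ →
        Γ.GraphIntegrable (Γ.pairing q u φ) ∧
        Γ.dirichletNeumann q (Γ.charFun Ω) E = Γ.graphIntegral (Γ.pairing q u φ)) ∧
    -- it is countably additive on clopen sets
    (∀ E : ℕ → Set Γ.boundary, (∀ n, IsClopen (E n)) →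
      Pairwise (fun m n => Disjoint (E m) (E n)) → IsClopen (⋃ n, E n) →
      HasSum (fun n => Γ.dirichletNeumann q (Γ.charFun Ω) (E n))
        (Γ.dirichletNeumann q (Γ.charFun Ω) (⋃ n, E n))) ∧
    -- it extends uniquely to a finite positive Borel measure on `Ω`, which is Radon
    (∃ ν : Measure Ω, IsFiniteMeasure ν ∧ ν.Regular ∧
      (∀ E : Set Γ.boundary, IsClopen E → E ⊆ Ω →
        ν.real (Subtype.val ⁻¹' E) = Γ.dirichletNeumann q (Γ.charFun Ω) E) ∧
      ∀ ν' : Measure Ω, IsFiniteMeasure ν' →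
        (∀ E : Set Γ.boundary, IsClopen E → E ⊆ Ω →
          ν'.real (Subtype.val ⁻¹' E) = Γ.dirichletNeumann q (Γ.charFun Ω) E) → ν' = ν) ∧
    -- it extends uniquely to a signed Borel measure on the boundary, which is Radon
    (∃ μ : SignedMeasure Γ.boundary, μ.totalVariation.Regular ∧
      (∀ E : Set Γ.boundary, IsClopen E → μ E = Γ.dirichletNeumann q (Γ.charFun Ω) E) ∧
      ∀ μ' : SignedMeasure Γ.boundary,
        (∀ E : Set Γ.boundary, IsClopen E → μ' E = Γ.dirichletNeumann q (Γ.charFun Ω) E) →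
          μ' = μ) := by
  have hBne : Γ.boundary.Nonempty := ⟨hne.some, hne.some.2⟩
  have hBc := MetricGraph.isClosed_boundary hfin (Γ := Γ)
  have := isCompact_iff_compactSpace.1 hBc.isCompact
  have := MetricGraph.totallySeparatedSpace_boundary hfin hweak
  have := MetricGraph.secondCountableTopology_completion (Γ := Γ)
  have := MetricGraph.metrizableSpace_completion (Γ := Γ)
  obtain ⟨u, g, hu, hb⟩ := MetricGraph.exists_isWeakSolution hconn hfin hBne hq0 hq1 hweak hΩ
  have huniq : ∀ w, Γ.IsHarmonicExtension q (Γ.charFun Ω) w → w = u := fun w hw =>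
    hw.unique hconn hfin hBne hq0 hq1 hb
  set Λ := Γ.dirichletNeumann q (Γ.charFun Ω) with hΛ
  have hadd : ∀ A B, IsClopen A → IsClopen B → Disjoint A B → Λ (A ∪ B) = Λ A + Λ B :=
    fun A B hA hB =>
      MetricGraph.dirichletNeumann_union hconn hfin hBne hweak hq0 hq1 hu hb hA hB
  have hempty : Λ ∅ = 0 := MetricGraph.dirichletNeumann_empty hconn hfin hBne hweak hq0 hq1 hu hb
  have hdecomp : ∀ E, IsClopen E → Λ E = Λ (E ∩ Ω) + Λ (E \ Ω) := fun E hE => by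
    rw [← hadd _ _ (hE.inter hΩ) (hE.diff hΩ) disjoint_sdiff_inter.symm, inter_union_sdiff]
  -- Splitting along `Ω` gives two functions of constant sign, each of which extends to a positive
  -- measure.
  obtain ⟨ν₁, hν₁f, hν₁⟩ := exists_measure_of_isClopen (m := fun E => Λ (E ∩ Ω))
    (by simp [hempty])
    (fun A B hA hB hAB => by
      rw [union_inter_distrib_right]
      exact hadd _ _ (hA.inter hΩ) (hB.inter hΩ)
        (hAB.mono inter_subset_left inter_subset_left))
    (fun A hA => MetricGraph.dirichletNeumann_nonneg hconn hfin hBne hweak hq0 hq1 hu hb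
      (hA.inter hΩ) inter_subset_right)
  obtain ⟨ν₂, hν₂f, hν₂⟩ := exists_measure_of_isClopen (m := fun E => -Λ (E \ Ω))
    (by simp [hempty])
    (fun A B hA hB hAB => by
      rw [union_sdiff_distrib, hadd _ _ (hA.diff hΩ) (hB.diff hΩ)
        (hAB.mono sdiff_subset sdiff_subset), neg_add])
    (fun A hA => neg_nonneg.2 <|
      MetricGraph.dirichletNeumann_nonpos hconn hfin hBne hweak hq0 hq1 hu hb (hA.diff hΩ)
        disjoint_sdiff_left)
  refine ⟨⟨u, hb, huniq⟩,
    fun E hE => ⟨MetricGraph.exists_isTestFunction hfin hweak hE, fun w φ hw hφ => ?_⟩,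
    fun E hE hd hU => hasSum_of_isClopen_iUnion hempty hadd hE hd hU.isClosed, ?_, ?_⟩
  · rw [huniq w hw]
    exact ⟨MetricGraph.graphIntegrable_pairing hq1 hφ.1 u,
      MetricGraph.dirichletNeumann_eq_graphIntegral hconn hfin hBne hq0 hq1 hu hb hφ⟩
  · have hemb := MeasurableEmbedding.subtype_coe hΩ.isOpen.measurableSet
    have := isCompact_iff_compactSpace.1 hΩ.isClosed.isCompact
    have hfinite : IsFiniteMeasure (ν₁.comap (Subtype.val : Ω → Γ.boundary)) :=
      ⟨by rw [hemb.comap_apply]; exact measure_lt_top _ _⟩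
    have hν : ∀ E : Set Γ.boundary, IsClopen E → E ⊆ Ω →
        (ν₁.comap Subtype.val).real (Subtype.val ⁻¹' E : Set Ω) = Λ E := fun E hE hEΩ => by
      rw [measureReal_def, hemb.comap_apply, Subtype.image_preimage_coe, ← measureReal_def,
        inter_eq_right.2 hEΩ, hν₁ E hE, inter_eq_left.2 hEΩ]
    refine ⟨ν₁.comap Subtype.val, hfinite, inferInstance, hν, fun ν' _ hν' => ?_⟩
    refine measure_ext_of_isClopen fun A hA => ?_
    -- Since `Ω` is clopen, its clopen subsets are exactly the clopen sets of the boundary contained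
    -- in it, so the two measures agree on a generating π-system.
    have hA' : IsClopen (Subtype.val '' A : Set Γ.boundary) :=
      ⟨hΩ.isClosed.isClosedMap_subtype_val A hA.isClosed,
        hΩ.isOpen.isOpenMap_subtype_val A hA.isOpen⟩
    have hsub : Subtype.val '' A ⊆ Ω := Subtype.coe_image_subset Ω A
    rw [← preimage_image_eq A Subtype.val_injective, hν' _ hA' hsub, hν _ hA' hsub]
  · have hμ : ∀ E : Set Γ.boundary, IsClopen E →
        (ν₁.toSignedMeasure - ν₂.toSignedMeasure) E = Λ E := fun E hE => by
      rw [Measure.toSignedMeasure_sub_apply hE.isOpen.measurableSet, hν₁ E hE, hν₂ E hE,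
        hdecomp E hE, sub_neg_eq_add]
    refine ⟨ν₁.toSignedMeasure - ν₂.toSignedMeasure, ?_, hμ, fun μ' hμ' => ?_⟩
    -- Finite Borel measures on a compact metrizable space are regular.
    · rw [SignedMeasure.totalVariation]
      infer_instance
    · exact signedMeasure_ext_of_isClopen fun E hE => (hμ' E hE).trans (hμ E hE).symm
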